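/- Let $K$ be a field. A (nonunital) 2-associative algebra is a $K$-vector space $A$ with two bilinear associative products $*$ and $\cdot$ (with no relation between them). Let $2as$ be the symmetric $K$-linear operad of 2-associative algebras, i.e. the binary quadratic operad $\mathcal P(E,R)$ where $E=K[\{*,\cdot\}]\otimes K[S_2]$ is generated by two binary operations without symmetry and $R\subset \mathcal F(E)(3)$ is the $S_3$-submodule generated by $(x*y)*z-x*(y*z)$ and $(x\cdot y)\cdot z-x\cdot (y\cdot z)$. (1) The operad $2as$ is Koszul in the sense of Ginzburg–Kapranov: for every $n$, the complex $$D(2as)(n):\quad 2as(n)^*\to\cdots\to\bigoplus_{T\ n\text{-tree},\ k\text{ vertices}} 2as(T)^*\otimes \mathrm{Det}(T)\to\cdots\to\bigoplus_{T\ \text{binary } n\text{-tree}} 2as(T)^*\otimes\mathrm{Det}(T)$$ is exact everywhere except at its right end. Here $T$ runs over the reduced rooted trees with leaves labelled by $\{1,\dots,n\}$, $2as(T)=\bigotimes_{v} 2as(\mathrm{In}(v))$ over the internal vertices $v$ of $T$, $\mathrm{Det}(T)$ is the top exterior power of the space spanned by the internal edges of $T$, and the differential is dual to the operadic composition along internal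 edges. (2) Identify $E^\vee=E^*\otimes \mathrm{sgn}$ with $K[\{*,\cdot\}]\otimes K[S_2]$ by means of the dual basis. Then the quadratic dual operad $2as^!=\mathcal P(E^\vee,R^\perp)$ is the operad generated by two binary operations $*$ and $\cdot$, where $R^\perp\subset\mathcal F(E^\vee)(3)$ is exactly the $S_3$-submodule generated by the associativity relations of $*$ and of $\cdot$ together with the relations $$(x*y)\cdot z=0,\quad x*(y\cdot z)=0,\quad (x\cdot y)*z=0,\quad x\cdot(y*z)=0 .$$ (3) For a 2-associative algebra $A$, let $H^{2as}_n(A)$ be the homology of the chain complex $C_n(A)=\bigl(2as^!(n)^\vee\otimes A^{\otimes n}\bigr)_{S_n}$, where $2as^!(n)^\vee=2as^!(n)^*\otimes\mathrm{sgn}_n$, with the Ginzburg–Kapranov differential, which replaces two inputs by the value on them of the canonical element of $E^\vee\otimes E$. For an associative algebra $(A,\mu)$ let $H^{As}_n(A,\mu)$ be the homology of the complex $\cdots\to A^{\otimes n}\xrightarrow{b'}A^{\otimes n-1}\to\cdots\to A$, where $b'(a_1,\dots,a_n)=\sum_{i=1}^{n-1}(-1)^i(a_1,\dots,\mu(a_i,a_{i+1}),\dots,a_n)$.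 Then for every $n\ge 3$ $$H^{2as}_n(A)\cong H^{As}_n(A,*)\oplus H^{As}_n(A,\cdot),$$ the isomorphism being induced by the two maps $C_n(A)\to A^{\otimes n}$ given, for $\circ=*$ and $\circ=\cdot$, by $$\varphi\otimes(a_1,\dots,a_n)\mapsto \sum_{\sigma\in S_n}\mathrm{sgn}(\sigma)\,\varphi(x_{\sigma(1)}\circ\cdots\circ x_{\sigma(n)})\,(a_{\sigma(1)},\dots,a_{\sigma(n)}),$$ where $x_{\sigma(1)}\circ\cdots\circ x_{\sigma(n)}$ denotes the iterated product, as an element of $2as^!(n)$ with inputs $x_1,\dots,x_n$. -/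

import Mathlib

open scoped TensorProduct

universe u v

set_option maxSynthPendingDepth 3

/-! ## Symmetric operads -/

namespace Operadic

section Relabelling

variable {I J L : Type}

/-- The canonical bijection `((I ∖ i) ⊔ J) ∖ j ⊔ L ≃ (I ∖ i) ⊔ ((J ∖ j) ⊔ L)`. -/
def seqEquiv (i : I) (j : J) :
    {y : {x : I // x ≠ i} ⊕ J // y ≠ Sum.inr j} ⊕ L ≃
      {x : I // x ≠ i} ⊕ ({y : J // y ≠ j} ⊕ L) where
  toFun
    | Sum.inl ⟨Sum.inl x, _⟩ => Sum.inl x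
    | Sum.inl ⟨Sum.inr y, h⟩ => Sum.inr (Sum.inl ⟨y, fun e => h (congrArg Sum.inr e)⟩)
    | Sum.inr l => Sum.inr (Sum.inr l)
  invFun
    | Sum.inl x => Sum.inl ⟨Sum.inl x, Sum.inl_ne_inr⟩
    | Sum.inr (Sum.inl y) => Sum.inl ⟨Sum.inr y.1, fun e => y.2 (Sum.inr_injective e)⟩
    | Sum.inr (Sum.inr l) => Sum.inr l
  left_inv := by rintro (⟨x | y, h⟩ | l) <;> rfl
  right_inv := by rintro (x | y | l) <;> rfl

/-- The canonical bijection `((I ∖ i) ⊔ J) ∖ i' ⊔ L ≃ ((I ∖ i') ⊔ L) ∖ i ⊔ J` for `i ≠ i'`. -/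
def parEquiv (i i' : I) (h : i' ≠ i) :
    {y : {x : I // x ≠ i} ⊕ J // y ≠ Sum.inl ⟨i', h⟩} ⊕ L ≃
      {y : {x : I // x ≠ i'} ⊕ L // y ≠ Sum.inl ⟨i, h.symm⟩} ⊕ J where
  toFun
    | Sum.inl ⟨Sum.inl x, hy⟩ =>
        Sum.inl ⟨Sum.inl ⟨x.1, fun e => hy (congrArg Sum.inl (Subtype.ext e))⟩,
          fun e => x.2 (congrArg Subtype.val (Sum.inl_injective e))⟩
    | Sum.inl ⟨Sum.inr y, _⟩ => Sum.inr y
    | Sum.inr l => Sum.inl ⟨Sum.inr l, Sum.inr_ne_inl⟩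
  invFun
    | Sum.inl ⟨Sum.inl x, hy⟩ =>
        Sum.inl ⟨Sum.inl ⟨x.1, fun e => hy (congrArg Sum.inl (Subtype.ext e))⟩,
          fun e => x.2 (congrArg Subtype.val (Sum.inl_injective e))⟩
    | Sum.inl ⟨Sum.inr l, _⟩ => Sum.inr l
    | Sum.inr y => Sum.inl ⟨Sum.inr y, Sum.inr_ne_inl⟩
  left_inv := by rintro (⟨x | y, h⟩ | l) <;> rfl
  right_inv := by rintro (⟨x | y, h⟩ | l) <;> rfl

/-- The bijection `(I ∖ i) ⊔ J ≃ (I' ∖ f i) ⊔ J'` induced by `f : I ≃ I'` and `g : J ≃ J'`. -/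
def plugEquiv {I' J' : Type} (f : I ≃ I') (g : J ≃ J') (i : I) :
    {x : I // x ≠ i} ⊕ J ≃ {x : I' // x ≠ f i} ⊕ J' :=
  Equiv.sumCongr (f.subtypeEquiv fun _ => not_congr f.injective.eq_iff.symm) g

end Relabelling

/-- A (symmetric, `K`-linear) operad, in its coordinate-free form: `obj I` is the space of
operations whose inputs are labelled by the finite set `I` (so `obj (Fin n)` is `P(n)`), `map`
is the relabelling of inputs (for `I = Fin n` the action of the symmetric group), and
`comp i p q` is the partial composite `p ∘ᵢ q`, which plugs `q` into the input `i` of `p`. -/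
structure SymOperad (K : Type u) [Field K] where
  obj : (I : Type) → [Finite I] → Type u
  [acg : ∀ (I : Type) [Finite I], AddCommGroup (obj I)]
  [mod : ∀ (I : Type) [Finite I], Module K (obj I)]
  map : ∀ {I J : Type} [Finite I] [Finite J], I ≃ J → (obj I →ₗ[K] obj J)
  one : obj Unit
  comp : ∀ {I J : Type} [Finite I] [Finite J] (i : I),
    obj I →ₗ[K] obj J →ₗ[K] obj ({x : I // x ≠ i} ⊕ J)
  map_refl : ∀ {I : Type} [Finite I] (p : obj I), map (Equiv.refl I) p = p
  map_trans : ∀ {I J L : Type} [Finite I] [Finite J] [Finite L] (f : I ≃ J) (g : J ≃ L)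
    (p : obj I), map (f.trans g) p = map g (map f p)
  map_comp : ∀ {I J I' J' : Type} [Finite I] [Finite J] [Finite I'] [Finite J']
    (f : I ≃ I') (g : J ≃ J') (i : I) (p : obj I) (q : obj J),
    map (plugEquiv f g i) (comp i p q) =
      comp (f i) (map f p) (map g q)
  one_comp : ∀ {J : Type} [Finite J] (e : {x : Unit // x ≠ ()} ⊕ J ≃ J)
    (_ : ∀ j, e (Sum.inr j) = j) (q : obj J), map e (comp () one q) = q
  comp_one : ∀ {I : Type} [Finite I] (i : I) (e : {x : I // x ≠ i} ⊕ Unit ≃ I)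
    (_ : ∀ x, e (Sum.inl x) = x) (_ : e (Sum.inr ()) = i) (p : obj I),
    map e (comp i p one) = p
  assoc_seq : ∀ {I J L : Type} [Finite I] [Finite J] [Finite L] (i : I) (j : J)
    (p : obj I) (q : obj J) (r : obj L),
    map (seqEquiv i j) (comp (Sum.inr j) (comp i p q) r) = comp i p (comp j q r)
  assoc_par : ∀ {I J L : Type} [Finite I] [Finite J] [Finite L] (i i' : I) (h : i' ≠ i)
    (p : obj I) (q : obj J) (r : obj L),
    map (parEquiv i i' h) (comp (Sum.inl ⟨i', h⟩) (comp i p q) r) =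
      comp (Sum.inl ⟨i, h.symm⟩) (comp i' p r) q

attribute [instance] SymOperad.acg SymOperad.mod

/-! ## The free operad on a set of binary operations (without symmetry) -/

/-- Formal composites of the binary operations `X` with inputs labelled by `I`: planar binary
trees with vertices decorated by `X` and leaves labelled by `I`. -/
inductive BinTerm (X I : Type) : Type
  | leaf (i : I) : BinTerm X I
  | node (x : X) (l r : BinTerm X I) : BinTerm X I

namespace BinTerm

variable {X I J L : Type}

/-- Simultaneous substitution into the leaves. -/
def bind : BinTerm X I → (I → BinTerm X J) → BinTerm X J
  | leaf i, f => f i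
  | node x l r, f => node x (l.bind f) (r.bind f)

/-- The labels of the leaves, from left to right. -/
def leaves : BinTerm X I → List I
  | leaf i => [i]
  | node _ l r => l.leaves ++ r.leaves

/-- Every label occurs exactly once. -/
def IsMultilinear (t : BinTerm X I) : Prop := t.leaves.Nodup ∧ ∀ i, i ∈ t.leaves

theorem bind_bind (t : BinTerm X I) (f : I → BinTerm X J) (g : J → BinTerm X L) :
    (t.bind f).bind g = t.bind fun i => (f i).bind g := by
  induction t with
  | leaf i => rfl
  | node x l r hl hr => simp only [bind, hl, hr]

theorem bind_leaf (t : BinTerm X I) : t.bind leaf = t := by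
  induction t with
  | leaf i => rfl
  | node x l r hl hr => simp only [bind, hl, hr]

theorem leaves_bind (t : BinTerm X I) (f : I → BinTerm X J) :
    (t.bind f).leaves = t.leaves.flatMap fun i => (f i).leaves := by
  induction t with
  | leaf i => simp [bind, leaves]
  | node x l r hl hr => simp [bind, leaves, hl, hr]

/-- Relabelling. -/
def relabel (f : I → J) (t : BinTerm X I) : BinTerm X J := t.bind fun i => leaf (f i)

theorem leaves_relabel (f : I → J) (t : BinTerm X I) :
    (t.relabel f).leaves = t.leaves.map f := by
  simp only [relabel, leaves_bind, leaves]
  induction t.leaves <;> simp_all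

open Classical in
/-- What a label becomes when `s` is plugged into the leaf `i`. -/
noncomputable def plug (i : I) (s : BinTerm X J) (k : I) :
    BinTerm X ({x : I // x ≠ i} ⊕ J) :=
  if h : k = i then s.relabel Sum.inr else leaf (Sum.inl ⟨k, h⟩)

theorem plug_self (i : I) (s : BinTerm X J) : plug i s i = s.relabel Sum.inr := by
  simp [plug]

theorem plug_of_ne (i : I) (s : BinTerm X J) (k : I) (h : k ≠ i) :
    plug i s k = leaf (Sum.inl ⟨k, h⟩) := by
  simp [plug, h]

/-- Plugging `s` into the leaf `i` of `t`. -/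
noncomputable def subst (i : I) (t : BinTerm X I) (s : BinTerm X J) :
    BinTerm X ({x : I // x ≠ i} ⊕ J) := t.bind (plug i s)

theorem IsMultilinear.relabel {t : BinTerm X I} (ht : t.IsMultilinear) (f : I ≃ J) :
    (t.relabel f).IsMultilinear := by
  refine ⟨?_, fun j => ?_⟩
  · rw [leaves_relabel]; exact ht.1.map f.injective
  · rw [leaves_relabel]; exact List.mem_map.2 ⟨f.symm j, ht.2 _, by simp⟩

theorem IsMultilinear.subst {t : BinTerm X I} {s : BinTerm X J} (i : I)
    (ht : t.IsMultilinear) (hs : s.IsMultilinear) : (t.subst i s).IsMultilinear := by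
  refine ⟨?_, ?_⟩
  · rw [BinTerm.subst, leaves_bind, List.nodup_flatMap]
    refine ⟨fun k _ => ?_, ht.1.imp_of_mem ?_⟩
    · by_cases h : k = i
      · subst h
        rw [plug_self, leaves_relabel]; exact hs.1.map Sum.inr_injective
      · rw [plug_of_ne i s k h]; simp [leaves]
    · intro a b _ _ hab
      simp only [Function.onFun]
      by_cases ha : a = i
      · subst ha
        rw [plug_self, plug_of_ne _ s b (Ne.symm hab), leaves_relabel]
        simp [leaves]
      · by_cases hb : b = i
        · subst hb
          rw [plug_self, plug_of_ne _ s a ha, leaves_relabel]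
          simp [leaves]
        · rw [plug_of_ne _ s a ha, plug_of_ne _ s b hb]
          simpa [leaves] using Ne.symm hab
  · rintro (⟨k, hk⟩ | j)
    · rw [BinTerm.subst, leaves_bind, List.mem_flatMap]
      exact ⟨k, ht.2 k, by rw [plug_of_ne i s k hk]; simp [leaves]⟩
    · rw [BinTerm.subst, leaves_bind, List.mem_flatMap]
      exact ⟨i, ht.2 i, by rw [plug_self, leaves_relabel]; simp [hs.2 j]⟩

end BinTerm

/-- Multilinear monomials on `I` in the operations `X`. -/
def MTerm (X I : Type) : Type := {t : BinTerm X I // t.IsMultilinear}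

namespace MTerm

variable {X I J L : Type}

/-- Relabelling of the inputs of a monomial. -/
def relabel (f : I ≃ J) (t : MTerm X I) : MTerm X J := ⟨t.1.relabel f, t.2.relabel f⟩

/-- Partial composition of monomials. -/
noncomputable def subst (i : I) (t : MTerm X I) (s : MTerm X J) :
    MTerm X ({x : I // x ≠ i} ⊕ J) := ⟨t.1.subst i s.1, t.2.subst i s.2⟩

/-- The identity operation. -/
def one : MTerm X Unit := ⟨.leaf (), by simp [BinTerm.IsMultilinear, BinTerm.leaves]⟩

/-- The generator `x`, as the operation `(a₀, a₁) ↦ x(a₀, a₁)`. -/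
def gen (x : X) : MTerm X (Fin 2) :=
  ⟨.node x (.leaf 0) (.leaf 1), by
    simp [BinTerm.IsMultilinear, BinTerm.leaves, Fin.forall_fin_two]⟩

end MTerm

section Free

variable (K : Type u) [Field K] (X : Type)

/-- `F(E)(I)` for the free operad on the `S₂`-module `E = K[X] ⊗ K[S₂]`. -/
abbrev Free (I : Type) : Type u := MTerm X I →₀ K

variable {X} {I J : Type}

/-- Relabelling in the free operad. -/
noncomputable def freeMap (f : I ≃ J) : Free K X I →ₗ[K] Free K X J :=
  Finsupp.lmapDomain K K (MTerm.relabel f)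

/-- Partial composition in the free operad. -/
noncomputable def freeComp (i : I) :
    Free K X I →ₗ[K] Free K X J →ₗ[K] Free K X ({x : I // x ≠ i} ⊕ J) :=
  Finsupp.linearCombination K fun t => Finsupp.lmapDomain K K (MTerm.subst i t)

theorem freeMap_single (f : I ≃ J) (t : MTerm X I) (a : K) :
    freeMap K f (Finsupp.single t a) = Finsupp.single (t.relabel f) a := by
  simp [freeMap, Finsupp.mapDomain_single]

theorem freeComp_single (i : I) (t : MTerm X I) (s : MTerm X J) (a b : K) :
    freeComp K i (Finsupp.single t a) (Finsupp.single s b) =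
      Finsupp.single (t.subst i s) (a * b) := by
  simp [freeComp, Finsupp.mapDomain_single]

end Free

/-- The free operad on the binary operations `X`. -/
noncomputable def freeOperad (K : Type u) [Field K] (X : Type) : SymOperad K where
  obj I _ := Free K X I
  map f := freeMap K f
  one := Finsupp.single MTerm.one 1
  comp i := freeComp K i
  map_refl p := by
    induction p using Finsupp.induction_linear with
    | zero => simp
    | add f g hf hg => simp only [map_add, hf, hg]
    | single t a =>
      rw [freeMap_single]; congr 1; exact Subtype.ext (BinTerm.bind_leaf _)
  map_trans f g p := by
    induction p using Finsupp.induction_linear with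
    | zero => simp
    | add f g hf hg => simp only [map_add, hf, hg]
    | single t a =>
      simp only [freeMap_single]; congr 1
      refine Subtype.ext ?_
      change t.1.bind _ = ((t.1.bind _).bind _)
      rw [BinTerm.bind_bind]; rfl
  map_comp f g i p q := by
    induction p using Finsupp.induction_linear with
    | zero => simp
    | add f g hf hg => simp only [map_add, LinearMap.add_apply, hf, hg]
    | single t a =>
      induction q using Finsupp.induction_linear with
      | zero => simp
      | add f g hf hg => simp only [map_add, hf, hg]
      | single s b =>
        simp only [freeMap_single, freeComp_single]; congr 1
        refine Subtype.ext ?_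
        change ((t.1.bind _).bind _) = ((t.1.bind _).bind _)
        rw [BinTerm.bind_bind, BinTerm.bind_bind]
        congr 1; funext k
        by_cases h : k = i
        · subst h
          simp [BinTerm.plug_self, BinTerm.relabel, BinTerm.bind_bind, BinTerm.bind, MTerm.relabel,
            plugEquiv]
        · have h' : f k ≠ f i := fun e => h (f.injective e)
          simp [BinTerm.plug_of_ne, h, BinTerm.bind, plugEquiv]
  one_comp e he q := by
    induction q using Finsupp.induction_linear with
    | zero => simp
    | add f g hf hg => simp only [map_add, hf, hg]
    | single s b =>
      simp only [freeMap_single, freeComp_single, one_mul]; congr 1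
      refine Subtype.ext ?_
      change ((BinTerm.plug _ s.1 ()).bind _) = s.1
      rw [BinTerm.plug_self, BinTerm.relabel, BinTerm.bind_bind]
      simp only [BinTerm.bind, he]
      exact BinTerm.bind_leaf _
  comp_one i e h1 h2 p := by
    induction p using Finsupp.induction_linear with
    | zero => simp
    | add f g hf hg => simp only [map_add, LinearMap.add_apply, hf, hg]
    | single t a =>
      simp only [freeMap_single, freeComp_single, mul_one]; congr 1
      refine Subtype.ext ?_
      change ((t.1.bind _).bind _) = t.1
      rw [BinTerm.bind_bind]
      conv_rhs => rw [← BinTerm.bind_leaf t.1]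
      congr 1; funext k
      by_cases h : k = i
      · subst h
        simp [BinTerm.plug_self, BinTerm.relabel, BinTerm.bind, MTerm.one, h2]
      · simp [BinTerm.plug_of_ne, h, BinTerm.bind, h1]
  assoc_seq i j p q r := by
    induction p using Finsupp.induction_linear with
    | zero => simp
    | add f g hf hg => simp only [map_add, LinearMap.add_apply, hf, hg]
    | single t a =>
      induction q using Finsupp.induction_linear with
      | zero => simp
      | add f g hf hg => simp only [map_add, LinearMap.add_apply, hf, hg]
      | single s b =>
        induction r using Finsupp.induction_linear with
        | zero => simp
        | add f g hf hg => simp only [map_add, hf, hg]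
        | single w c =>
          simp only [freeMap_single, freeComp_single, mul_assoc]; congr 1
          refine Subtype.ext ?_
          change (((t.1.bind _).bind _).bind _) = t.1.bind _
          rw [BinTerm.bind_bind, BinTerm.bind_bind]
          congr 1; funext k
          by_cases h : k = i
          · subst h
            simp only [BinTerm.plug_self, BinTerm.relabel, BinTerm.bind_bind]
            change _ = ((s.1.bind _).bind _)
            rw [BinTerm.bind_bind]
            congr 1; funext m
            by_cases hm : m = j
            · subst hm
              simp [BinTerm.plug_self, BinTerm.relabel, BinTerm.bind_bind, BinTerm.bind, seqEquiv]
            · simp [BinTerm.plug_of_ne, hm, BinTerm.bind, seqEquiv]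
          · simp [BinTerm.plug_of_ne, h, BinTerm.bind, seqEquiv]
  assoc_par i i' hii p q r := by
    induction p using Finsupp.induction_linear with
    | zero => simp
    | add f g hf hg => simp only [map_add, LinearMap.add_apply, hf, hg]
    | single t a =>
      induction q using Finsupp.induction_linear with
      | zero => simp
      | add f g hf hg => simp only [map_add, LinearMap.add_apply, hf, hg]
      | single s b =>
        induction r using Finsupp.induction_linear with
        | zero => simp
        | add f g hf hg => simp only [map_add, LinearMap.add_apply, hf, hg]
        | single w c =>
          simp only [freeMap_single, freeComp_single, mul_right_comm a b c]; congr 1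
          refine Subtype.ext ?_
          change (((t.1.bind _).bind _).bind _) = (t.1.bind _).bind _
          rw [BinTerm.bind_bind, BinTerm.bind_bind, BinTerm.bind_bind]
          congr 1; funext k
          by_cases h : k = i
          · subst h
            simp [BinTerm.plug_self, BinTerm.plug_of_ne, hii.symm, BinTerm.relabel,
              BinTerm.bind_bind, BinTerm.bind, parEquiv]
          · by_cases h' : k = i'
            · subst h'
              simp [BinTerm.plug_self, BinTerm.plug_of_ne, h, BinTerm.relabel,
                BinTerm.bind_bind, BinTerm.bind, parEquiv]
            · simp [BinTerm.plug_of_ne, h, h', BinTerm.bind, parEquiv]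

/-! ## Quotients of operads, quadratic operads -/

section Quotient

variable {K : Type u} [Field K]

/-- Membership in the operadic ideal generated by a set `R` of ternary operations. -/
inductive InIdeal (P : SymOperad K) (R : Set (P.obj (Fin 3))) :
    ∀ (I : Type) [Finite I], P.obj I → Prop
  | of (r : P.obj (Fin 3)) : r ∈ R → InIdeal P R (Fin 3) r
  | zero (I : Type) [Finite I] : InIdeal P R I 0
  | add (I : Type) [Finite I] (p q : P.obj I) :
      InIdeal P R I p → InIdeal P R I q → InIdeal P R I (p + q)
  | smul (I : Type) [Finite I] (a : K) (p : P.obj I) :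
      InIdeal P R I p → InIdeal P R I (a • p)
  | map (I J : Type) [Finite I] [Finite J] (f : I ≃ J) (p : P.obj I) :
      InIdeal P R I p → InIdeal P R J (P.map f p)
  | comp_left (I J : Type) [Finite I] [Finite J] (i : I) (p : P.obj I) (q : P.obj J) :
      InIdeal P R I p → InIdeal P R ({x : I // x ≠ i} ⊕ J) (P.comp i p q)
  | comp_right (I J : Type) [Finite I] [Finite J] (i : I) (p : P.obj I) (q : P.obj J) :
      InIdeal P R J q → InIdeal P R ({x : I // x ≠ i} ⊕ J) (P.comp i p q)

/-- The arity `I` component of the operadic ideal generated by `R`. -/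
def idealSpan (P : SymOperad K) (R : Set (P.obj (Fin 3))) (I : Type) [Finite I] :
    Submodule K (P.obj I) where
  carrier := {p | InIdeal P R I p}
  zero_mem' := .zero I
  add_mem' hp hq := .add I _ _ hp hq
  smul_mem' a _ hp := .smul I a _ hp

/-- Composition in the quotient of an operad by an ideal. -/
def quotComp (P : SymOperad K) (R : Set (P.obj (Fin 3))) {I J : Type} [Finite I] [Finite J]
    (i : I) : (P.obj I ⧸ idealSpan P R I) →ₗ[K] (P.obj J ⧸ idealSpan P R J) →ₗ[K]
      (P.obj ({x : I // x ≠ i} ⊕ J) ⧸ idealSpan P R ({x : I // x ≠ i} ⊕ J)) :=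
  (idealSpan P R I).liftQ
    { toFun := fun p => (idealSpan P R J).mapQ _ (P.comp i p)
        fun q hq => InIdeal.comp_right I J i p q hq
      map_add' := fun p p' => by
        refine LinearMap.ext fun q => ?_
        obtain ⟨q, rfl⟩ := Submodule.Quotient.mk_surjective _ q
        exact congrArg Submodule.Quotient.mk (LinearMap.congr_fun (map_add (P.comp i) p p') q)
      map_smul' := fun a p => by
        refine LinearMap.ext fun q => ?_
        obtain ⟨q, rfl⟩ := Submodule.Quotient.mk_surjective _ q
        exact congrArg Submodule.Quotient.mk (LinearMap.congr_fun (map_smul (P.comp i) a p) q) }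
    (fun p hp => by
      refine LinearMap.mem_ker.2 (LinearMap.ext fun q => ?_)
      obtain ⟨q, rfl⟩ := Submodule.Quotient.mk_surjective _ q
      exact (Submodule.Quotient.mk_eq_zero _).2 (InIdeal.comp_left I J i p q hp))

/-- The quotient of the operad `P` by the operadic ideal generated by `R`. -/
def SymOperad.quotient (P : SymOperad K) (R : Set (P.obj (Fin 3))) : SymOperad K where
  obj I _ := P.obj I ⧸ idealSpan P R I
  map {I J} _ _ f := (idealSpan P R I).mapQ (idealSpan P R J) (P.map f)
    fun p hp => InIdeal.map I J f p hp
  one := Submodule.Quotient.mk P.one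
  comp i := quotComp P R i
  map_refl p := by
    obtain ⟨p, rfl⟩ := Submodule.Quotient.mk_surjective _ p
    exact congrArg Submodule.Quotient.mk (P.map_refl p)
  map_trans f g p := by
    obtain ⟨p, rfl⟩ := Submodule.Quotient.mk_surjective _ p
    exact congrArg Submodule.Quotient.mk (P.map_trans f g p)
  map_comp f g i p q := by
    obtain ⟨p, rfl⟩ := Submodule.Quotient.mk_surjective _ p
    obtain ⟨q, rfl⟩ := Submodule.Quotient.mk_surjective _ q
    exact congrArg Submodule.Quotient.mk (P.map_comp f g i p q)
  one_comp e he q := by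
    obtain ⟨q, rfl⟩ := Submodule.Quotient.mk_surjective _ q
    exact congrArg Submodule.Quotient.mk (P.one_comp e he q)
  comp_one i e h1 h2 p := by
    obtain ⟨p, rfl⟩ := Submodule.Quotient.mk_surjective _ p
    exact congrArg Submodule.Quotient.mk (P.comp_one i e h1 h2 p)
  assoc_seq i j p q r := by
    obtain ⟨p, rfl⟩ := Submodule.Quotient.mk_surjective _ p
    obtain ⟨q, rfl⟩ := Submodule.Quotient.mk_surjective _ q
    obtain ⟨r, rfl⟩ := Submodule.Quotient.mk_surjective _ r
    exact congrArg Submodule.Quotient.mk (P.assoc_seq i j p q r)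
  assoc_par i i' h p q r := by
    obtain ⟨p, rfl⟩ := Submodule.Quotient.mk_surjective _ p
    obtain ⟨q, rfl⟩ := Submodule.Quotient.mk_surjective _ q
    obtain ⟨r, rfl⟩ := Submodule.Quotient.mk_surjective _ r
    exact congrArg Submodule.Quotient.mk (P.assoc_par i i' h p q r)

/-- The binary quadratic operad `P(E, R)`, where `E = K[X] ⊗ K[S₂]` and `R ⊆ F(E)(3)`. -/
noncomputable def quadOperad {X : Type} (R : Submodule K (Free K X (Fin 3))) : SymOperad K :=
  (freeOperad K X).quotient (R : Set (Free K X (Fin 3)))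

/-- The class of a monomial in a quadratic operad. -/
noncomputable def quadMk {X : Type} (R : Submodule K (Free K X (Fin 3))) {I : Type} [Finite I]
    (t : MTerm X I) : (quadOperad R).obj I :=
  Submodule.Quotient.mk (p := idealSpan (freeOperad K X) (R : Set (Free K X (Fin 3))) I)
    (Finsupp.single t (1 : K) : Free K X I)

end Quotient

/-! ## The quadratic dual -/

section Dual

/-- The sign of the ordering `(a, b, c)` of `{0, 1, 2}`. -/
def orderSign (a b c : Fin 3) : ℤ :=
  Int.sign (((b : ℤ) - a) * ((c : ℤ) - a) * ((c : ℤ) - b))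

/-- The sign attached to a ternary monomial: the sign of the order of its leaves for
`x(y(a, b), c)`, and the opposite sign for `x(a, y(b, c))`. -/
def combSign {X : Type} : BinTerm X (Fin 3) → ℤ
  | .node _ (.node _ (.leaf a) (.leaf b)) (.leaf c) => orderSign a b c
  | .node _ (.leaf a) (.node _ (.leaf b) (.leaf c)) => -orderSign a b c
  | _ => 0

variable {K : Type u} [Field K] {X : Type}

/-- The pairing between `F(E^∨)(3)` and `F(E)(3)`, where `E^∨ = E^* ⊗ sgn`. Here
`E = K[X] ⊗ K[S₂]`, and `E^∨` is again free over `K[S₂]`, on the elements `x^∨` of the dual basis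
(with `(x^∨)^op = -(x^op)^*`), so that it is written `K[X] ⊗ K[S₂]` as well. The pairing is the
`sgn`-equivariant one which on the monomials `α(β(1, 2), 3)` is induced by the evaluation
`E^∨ × E → K`. Distinct monomials are orthogonal, and a monomial pairs with itself to the sign
`combSign`. -/
noncomputable def dualPairing (g f : Free K X (Fin 3)) : K :=
  g.sum fun t a => a * f t * (combSign t.1 : K)

/-- The orthogonal `R^⊥` of the relations. -/
noncomputable def quadDualRel (R : Submodule K (Free K X (Fin 3))) :
    Submodule K (Free K X (Fin 3)) where
  carrier := {g | ∀ f ∈ R, dualPairing g f = 0}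
  zero_mem' f _ := by simp [dualPairing]
  add_mem' {g h} hg hh f hf := by
    have := hg f hf
    have := hh f hf
    simp only [dualPairing] at *
    rw [Finsupp.sum_add_index' (by simp) (by intros; ring)]
    simp_all
  smul_mem' a g hg f hf := by
    have := hg f hf
    simp only [dualPairing] at *
    rw [Finsupp.sum_smul_index' (by simp)]
    simp only [smul_eq_mul, mul_assoc, ← Finsupp.mul_sum] at *
    rw [this, mul_zero]

/-- The quadratic dual operad `P^! = P(E^∨, R^⊥)` of `P = P(E, R)`. -/
noncomputable def quadDual (R : Submodule K (Free K X (Fin 3))) : SymOperad K :=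
  quadOperad (quadDualRel R)

end Dual

/-! ## Trees, the dual dg operad `D(P)`, and Koszul operads -/

section Trees

variable {n : ℕ}

/-- Reduced trees (every vertex has at least two inputs) with leaves labelled by `Fin n`. A vertex
is identified with the set of leaves above it, and a tree with the set of its vertices: this is a
family of subsets with at least two elements, pairwise nested or disjoint, and containing the
whole set, which is the root vertex. -/
structure IsTree (T : Finset (Finset (Fin n))) : Prop where
  univ_mem : Finset.univ ∈ T
  two_le : ∀ v ∈ T, 2 ≤ v.card
  nested : ∀ v ∈ T, ∀ w ∈ T, v ⊆ w ∨ w ⊆ v ∨ Disjoint v w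

/-- The vertices and the leaves of `T`, as sets of leaves. -/
def IsCell (T : Finset (Finset (Fin n))) (c : Finset (Fin n)) : Prop := c ∈ T ∨ c.card = 1

/-- `c` is an input of the vertex `w`: a vertex or leaf lying immediately above `w`. -/
def IsInput (T : Finset (Finset (Fin n))) (w c : Finset (Fin n)) : Prop :=
  IsCell T c ∧ c ⊂ w ∧ ∀ c', IsCell T c' → c ⊂ c' → ¬ c' ⊂ w

/-- The set `In(w)` of inputs of the vertex `w` of `T`. -/
abbrev Inputs (T : Finset (Finset (Fin n))) (w : Finset (Fin n)) : Type :=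
  {c : Finset (Fin n) // IsInput T w c}

variable {T : Finset (Finset (Fin n))} {u w c : Finset (Fin n)}

theorem IsTree.cell_nonempty (hT : IsTree T) (hc : IsCell T c) : c.Nonempty := by
  rw [← Finset.card_pos]
  rcases hc with h | h
  · have := hT.two_le c h; omega
  · omega

theorem IsTree.cell_nested (hT : IsTree T) (hu : u ∈ T) (hc : IsCell T c) :
    c ⊆ u ∨ u ⊆ c ∨ Disjoint c u := by
  rcases hc with h | h
  · exact hT.nested c h u hu
  · obtain ⟨a, rfl⟩ := Finset.card_eq_one.1 h
    by_cases ha : a ∈ u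
    · exact .inl (by simpa using ha)
    · exact .inr (.inr (by simpa using ha))

theorem IsTree.isCell_erase (hT : IsTree T) (hu : u ∈ T) :
    IsCell (T.erase u) c ↔ IsCell T c ∧ c ≠ u := by
  constructor
  · rintro (h | h)
    · exact ⟨.inl (Finset.mem_of_mem_erase h), Finset.ne_of_mem_erase h⟩
    · refine ⟨.inr h, ?_⟩
      rintro rfl
      have := hT.two_le c hu; omega
  · rintro ⟨h | h, hne⟩
    · exact .inl (Finset.mem_erase.2 ⟨hne, h⟩)
    · exact .inr h

/-- The inputs of `w` after the contraction of the edge from `u` to `w`. -/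
theorem IsTree.isInput_erase_of_isInput (hT : IsTree T) (hu : u ∈ T) (h : IsInput T w u) :
    IsInput (T.erase u) w c ↔ (IsInput T w c ∧ c ≠ u) ∨ IsInput T u c := by
  simp only [IsInput, hT.isCell_erase hu]
  constructor
  · rintro ⟨⟨hc, hcu⟩, hcw, hmax⟩
    by_cases hsub : c ⊂ u
    · exact .inr ⟨hc, hsub, fun c' h1 h2 h3 => hmax c' ⟨h1, h3.ne⟩ h2 (h3.trans h.2.1)⟩
    · refine .inl ⟨⟨hc, hcw, fun c' h1 h2 h3 => ?_⟩, hcu⟩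
      by_cases he : c' = u
      · exact hsub (he ▸ h2)
      · exact hmax c' ⟨h1, he⟩ h2 h3
  · rintro (⟨⟨hc, hcw, hmax⟩, hne⟩ | ⟨hc, hcu, hmax⟩)
    · exact ⟨⟨hc, hne⟩, hcw, fun c' h1 h2 h3 => hmax c' h1.1 h2 h3⟩
    · refine ⟨⟨hc, hcu.ne⟩, hcu.trans h.2.1, fun c' h1 h2 h3 => ?_⟩
      rcases hT.cell_nested hu h1.1 with h' | h' | h'
      · exact hmax c' h1.1 h2 (lt_of_le_of_ne h' h1.2)
      · exact h.2.2 c' h1.1 (lt_of_le_of_ne h' h1.2.symm) h3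
      · obtain ⟨a, ha⟩ := hT.cell_nonempty hc
        exact Finset.disjoint_left.1 h' (h2.1 ha) (hcu.1 ha)

/-- The other vertices keep their inputs. -/
theorem IsTree.isInput_erase_of_not_isInput (hT : IsTree T) (hu : u ∈ T)
    (h : ¬ IsInput T w u) : IsInput T w c ↔ IsInput (T.erase u) w c := by
  simp only [IsInput, hT.isCell_erase hu]
  constructor
  · rintro ⟨hc, hcw, hmax⟩
    refine ⟨⟨hc, ?_⟩, hcw, fun c' h1 h2 h3 => hmax c' h1.1 h2 h3⟩
    rintro rfl
    exact h ⟨hc, hcw, hmax⟩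
  · rintro ⟨⟨hc, hcu⟩, hcw, hmax⟩
    refine ⟨hc, hcw, fun c' h1 h2 h3 => ?_⟩
    by_cases he : c' = u
    · subst he
      refine h ⟨.inl hu, h3, fun c'' h4 h5 h6 => ?_⟩
      exact hmax c'' ⟨h4, h5.ne'⟩ (h2.trans h5) h6
    · exact hmax c' ⟨h1, he⟩ h2 h3

theorem IsTree.isInput_unique (hT : IsTree T) {w' : Finset (Fin n)} (hw : w ∈ T) (hw' : w' ∈ T)
    (h : IsInput T w u) (h' : IsInput T w' u) : w = w' := by
  rcases hT.nested w hw w' hw' with h1 | h1 | h1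
  · by_contra hne
    exact h'.2.2 w (.inl hw) h.2.1 (lt_of_le_of_ne h1 hne)
  · by_contra hne
    exact h.2.2 w' (.inl hw') h'.2.1 (lt_of_le_of_ne h1 (Ne.symm hne))
  · obtain ⟨a, ha⟩ := hT.cell_nonempty h.1
    exact absurd (h'.2.1.1 ha) (Finset.disjoint_left.1 h1 (h.2.1.1 ha))

theorem IsTree.erase (hT : IsTree T) (h : IsInput T w u) : IsTree (T.erase u) where
  univ_mem := by
    refine Finset.mem_erase.2 ⟨?_, hT.univ_mem⟩
    rintro rfl
    exact h.2.1.2 (Finset.subset_univ _)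
  two_le v hv := hT.two_le v (Finset.mem_of_mem_erase hv)
  nested v hv w hw := hT.nested v (Finset.mem_of_mem_erase hv) w (Finset.mem_of_mem_erase hw)

/-- `(In(w) ∖ u) ⊔ In(u)` is the set of inputs of `w` after the contraction of the edge from `u`
to `w`. -/
noncomputable def contractEquiv (hT : IsTree T) (hu : u ∈ T) (h : IsInput T w u) :
    {x : Inputs T w // x ≠ ⟨u, h⟩} ⊕ Inputs T u ≃ Inputs (T.erase u) w :=
  Equiv.ofBijective
    (Sum.elim
      (fun x => ⟨x.1.1, (hT.isInput_erase_of_isInput hu h).2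
        (.inl ⟨x.1.2, fun e => x.2 (Subtype.ext e)⟩)⟩)
      (fun c => ⟨c.1, (hT.isInput_erase_of_isInput hu h).2 (.inr c.2)⟩))
    (by
      constructor
      · rintro (⟨⟨x, hx⟩, hxu⟩ | ⟨x, hx⟩) (⟨⟨y, hy⟩, hyu⟩ | ⟨y, hy⟩) hxy <;>
          simp only [Sum.elim_inl, Sum.elim_inr, Subtype.mk.injEq] at hxy <;> subst hxy
        · rfl
        · exact absurd h.2.1 (hx.2.2 u (.inl hu) hy.2.1)
        · exact absurd h.2.1 (hy.2.2 u (.inl hu) hx.2.1)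
        · rfl
      · rintro ⟨c, hc⟩
        rcases (hT.isInput_erase_of_isInput hu h).1 hc with h' | h'
        · exact ⟨.inl ⟨⟨c, h'.1⟩, fun e => h'.2 (congrArg Subtype.val e)⟩, rfl⟩
        · exact ⟨.inr ⟨c, h'⟩, rfl⟩)

/-- The inputs of the other vertices. -/
def keepEquiv (hT : IsTree T) (hu : u ∈ T) (h : ¬ IsInput T w u) :
    Inputs T w ≃ Inputs (T.erase u) w :=
  Equiv.subtypeEquivRight fun _ => hT.isInput_erase_of_not_isInput hu h

end Trees

section Bar

variable {K : Type u} [Field K] (P : SymOperad K) {n : ℕ}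

/-- `P(T)`, the tensor product of the spaces `P(In(v))` over the vertices `v` of `T`. -/
abbrev TreeSpace (T : Finset (Finset (Fin n))) : Type u :=
  ⨂[K] v : {v // v ∈ T}, P.obj (Inputs T v.1)

variable {T : Finset (Finset (Fin n))} {u w : Finset (Fin n)}

open Classical in
/-- Contraction of the internal edge from `u` to the vertex below it, on decorations. -/
noncomputable def contractFun (hT : IsTree T) (hu : u ∈ T)
    (x : ∀ v : {v // v ∈ T}, P.obj (Inputs T v.1)) (v : {v // v ∈ T.erase u}) :
    P.obj (Inputs (T.erase u) v.1) :=
  if h : IsInput T v.1 u then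
    P.map (contractEquiv hT hu h)
      (P.comp ⟨u, h⟩ (x ⟨v.1, Finset.mem_of_mem_erase v.2⟩) (x ⟨u, hu⟩))
  else P.map (keepEquiv hT hu h) (x ⟨v.1, Finset.mem_of_mem_erase v.2⟩)

theorem contractFun_update [DecidableEq {v // v ∈ T}] [DecidableEq {v // v ∈ T.erase u}]
    (hT : IsTree T) (hu : u ∈ T) (hw : w ∈ T)
    (h : IsInput T w u) (x : ∀ v : {v // v ∈ T}, P.obj (Inputs T v.1)) (v : {v // v ∈ T}) :
    ∃ (v' : {v // v ∈ T.erase u})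
      (L : P.obj (Inputs T v.1) →ₗ[K] P.obj (Inputs (T.erase u) v'.1)),
      ∀ a, contractFun P hT hu (Function.update x v a) =
        Function.update (contractFun P hT hu x) v' (L a) := by
  by_cases hv : v = ⟨u, hu⟩
  · subst hv
    have hwu : w ≠ u := h.2.1.ne'
    refine ⟨⟨w, Finset.mem_erase.2 ⟨hwu, hw⟩⟩,
      P.map (contractEquiv hT hu h) ∘ₗ P.comp ⟨u, h⟩ (x ⟨w, hw⟩), fun a => ?_⟩
    funext v'
    have hv'u : (⟨v'.1, Finset.mem_of_mem_erase v'.2⟩ : {v // v ∈ T}) ≠ ⟨u, hu⟩ := fun e =>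
      Finset.ne_of_mem_erase v'.2 (congrArg Subtype.val e)
    by_cases hv' : v' = ⟨w, Finset.mem_erase.2 ⟨hwu, hw⟩⟩
    · subst hv'
      rw [Function.update_self, contractFun, dif_pos h, Function.update_self,
        Function.update_of_ne hv'u]
      rfl
    · have hn : ¬ IsInput T v'.1 u := fun h' => hv' (Subtype.ext
        (hT.isInput_unique (Finset.mem_of_mem_erase v'.2) hw h' h))
      rw [Function.update_of_ne hv', contractFun, dif_neg hn, Function.update_of_ne hv'u,
        contractFun, dif_neg hn]
  · obtain ⟨v, hvT⟩ := v
    have hvu : v ≠ u := fun e => hv (Subtype.ext e)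
    have huv : (⟨u, hu⟩ : {v // v ∈ T}) ≠ ⟨v, hvT⟩ := Ne.symm hv
    have key : ∀ (v' : {v // v ∈ T.erase u}) (_ : v' ≠ ⟨v, Finset.mem_erase.2 ⟨hvu, hvT⟩⟩),
        (⟨v'.1, Finset.mem_of_mem_erase v'.2⟩ : {v // v ∈ T}) ≠ ⟨v, hvT⟩ := fun v' h1 e =>
      h1 (Subtype.ext (by simpa using e))
    by_cases hi : IsInput T v u
    · refine ⟨⟨v, Finset.mem_erase.2 ⟨hvu, hvT⟩⟩,
        P.map (contractEquiv hT hu hi) ∘ₗ (P.comp (I := Inputs T v) (J := Inputs T u) ⟨u, hi⟩).flip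
          (x ⟨u, hu⟩), fun a => ?_⟩
      funext v'
      by_cases hv' : v' = ⟨v, Finset.mem_erase.2 ⟨hvu, hvT⟩⟩
      · subst hv'
        rw [Function.update_self, contractFun, dif_pos hi, Function.update_self,
          Function.update_of_ne huv]
        rfl
      · rw [Function.update_of_ne hv', contractFun, contractFun,
          Function.update_of_ne (key v' hv'), Function.update_of_ne huv]
    · refine ⟨⟨v, Finset.mem_erase.2 ⟨hvu, hvT⟩⟩, P.map (keepEquiv hT hu hi), fun a => ?_⟩
      funext v'
      by_cases hv' : v' = ⟨v, Finset.mem_erase.2 ⟨hvu, hvT⟩⟩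
      · subst hv'
        rw [Function.update_self, contractFun, dif_neg hi, Function.update_self]
      · rw [Function.update_of_ne hv', contractFun, contractFun,
          Function.update_of_ne (key v' hv'), Function.update_of_ne huv]

/-- The map `P(T) → P(T/e)` given by the composition of `P` along the internal edge `e` from `u`
to `w`. -/
noncomputable def contract (hT : IsTree T) (hu : u ∈ T) (hw : w ∈ T) (h : IsInput T w u) :
    TreeSpace P T →ₗ[K] TreeSpace P (T.erase u) :=
  PiTensorProduct.lift
    { toFun := fun x => PiTensorProduct.tprod K (contractFun P hT hu x)
      map_update_add' := by
        classical
        intro inst x v a b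
        obtain ⟨v', L, hL⟩ := contractFun_update P hT hu hw h x v
        rw [hL, hL, hL, map_add, MultilinearMap.map_update_add]
      map_update_smul' := by
        classical
        intro inst x v a b
        obtain ⟨v', L, hL⟩ := contractFun_update P hT hu hw h x v
        rw [hL, hL, map_smul, MultilinearMap.map_update_smul] }

/-- The trees with `n` leaves and `k` vertices. -/
abbrev Tree (n k : ℕ) : Type := {T : Finset (Finset (Fin n)) // IsTree T ∧ T.card = k}

/-- The internal edges of a tree, as pairs consisting of the lower and the upper vertex. -/
abbrev Edge (T : Finset (Finset (Fin n))) : Type :=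
  {e : {v // v ∈ T} × {v // v ∈ T} // IsInput T e.1.1 e.2.1}

/-- The tree `T/e`. -/
def Tree.contract {k : ℕ} (T : Tree n (k + 1)) (e : Edge T.1) : Tree n k :=
  ⟨T.1.erase e.1.2.1, T.2.1.erase e.2, by
    rw [Finset.card_erase_of_mem e.1.2.2, T.2.2, Nat.add_sub_cancel]⟩

open Classical in
/-- The sign of the contraction of an edge `e`: the internal edges of `T` (which correspond to the
vertices `≠` root) are listed in the colexicographic order of their upper vertices, which trivializes
`Det(T)`, the top exterior power of the space spanned by the internal edges; the sign is `(-1)^j`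
where `j` is the number of edges that precede `e`. -/
noncomputable def edgeSign (e : Edge T) : ℤˣ :=
  (-1) ^ (T.filter fun v => toColex v < toColex e.1.2.1).card

/-- `⨁ P(T) ⊗ Det(T)`, over the trees with `n` leaves and `k` vertices. -/
abbrev BarChains (n k : ℕ) : Type u := ∀ T : Tree n k, TreeSpace P T.1

open Classical in
/-- The signed sum of all the contractions of one internal edge. -/
noncomputable def barDiff (n k : ℕ) : BarChains P n (k + 1) →ₗ[K] BarChains P n k :=
  ∑ T : Tree n (k + 1), ∑ e : Edge T.1, ((edgeSign e : ℤ) : K) •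
    (LinearMap.single K (fun S : Tree n k => TreeSpace P S.1) (T.contract e) ∘ₗ
      Operadic.contract P T.2.1 e.1.2.2 e.1.1.2 e.2 ∘ₗ LinearMap.proj T)

/-- The component of `D(P)(n)` spanned by the trees with `k` vertices: the sum of the
`P(T)^* ⊗ Det(T)`. -/
abbrev DChains (n k : ℕ) : Type u := Module.Dual K (BarChains P n k)

/-- The differential of the complex `D(P)(n)`, dual to the compositions of `P` along edges:
`0 → P(n)^* → ⨁ P(T)^* ⊗ Det(T) → ⋯`, the `k`th term being indexed by the trees with `k` vertices,
and the last one by the binary trees, which have `n - 1` vertices. -/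
noncomputable def dDiff (n k : ℕ) : DChains P n k →ₗ[K] DChains P n (k + 1) :=
  (barDiff P n k).dualMap

/-- A quadratic operad `P` is Koszul if every complex `D(P)(n)` is exact everywhere but at its
right end, the term of binary trees. (The cohomology at the right end is `P^!(n)`, up to the
sign representation, so this says that `D(P) → P^!` is a quasi-isomorphism.) -/
def SymOperad.IsKoszul : Prop :=
  ∀ n k : ℕ, k + 2 ≠ n → Function.Exact (dDiff P n k) (dDiff P n (k + 1))

end Bar

/-! ## Hochschild homology -/

section Hochschild

variable {K : Type u} [Field K] {A : Type v} [AddCommGroup A] [Module K A]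

/-- `(a₀, …, aₙ) ↦ (a₀, …, μ(a_k, a_{k+1}), …, aₙ)`. -/
def mulAtFun {n : ℕ} (μ : A →ₗ[K] A →ₗ[K] A) (k : Fin n) (a : Fin (n + 1) → A) (l : Fin n) : A :=
  if l < k then a l.castSucc else if l = k then μ (a k.castSucc) (a k.succ) else a l.succ

theorem mulAtFun_update {n : ℕ} [DecidableEq (Fin (n + 1))] (μ : A →ₗ[K] A →ₗ[K] A) (k : Fin n)
    (a : Fin (n + 1) → A) (v : Fin (n + 1)) :
    ∃ (l : Fin n) (L : A →ₗ[K] A), ∀ b,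
      mulAtFun μ k (Function.update a v b) = Function.update (mulAtFun μ k a) l (L b) := by
  have hne : k.castSucc ≠ k.succ := k.castSucc_lt_succ.ne
  rcases lt_trichotomy v k.castSucc with h | h | h
  · obtain ⟨l, rfl⟩ := Fin.exists_castSucc_eq.2 (h.trans (Fin.castSucc_lt_last k)).ne
    have hlk : l < k := h
    refine ⟨l, LinearMap.id, fun b => funext fun m => ?_⟩
    by_cases hm : m = l
    · subst hm; simp [mulAtFun, hlk]
    · have h1 : k.castSucc ≠ l.castSucc := h.ne'
      have h2 : k.succ ≠ l.castSucc := (h.trans k.castSucc_lt_succ).ne'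
      have h3 : m.castSucc ≠ l.castSucc := fun e => hm (Fin.castSucc_injective _ e)
      by_cases h4 : m < k
      · simp [mulAtFun, Function.update_of_ne hm, h4, Function.update_of_ne h3]
      · have h5 : m.succ ≠ l.castSucc := by
          intro e
          have := congrArg Fin.val e
          simp only [Fin.val_succ, Fin.val_castSucc, Fin.lt_def] at this h4 hlk
          omega
        simp [mulAtFun, Function.update_of_ne hm, h4, Function.update_of_ne h1,
          Function.update_of_ne h2, Function.update_of_ne h5]
  · subst h
    refine ⟨k, μ.flip (a k.succ), fun b => funext fun m => ?_⟩
    by_cases hm : m = k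
    · subst hm; simp [mulAtFun, Function.update_of_ne hne.symm]
    · have h3 : m.castSucc ≠ k.castSucc := fun e => hm (Fin.castSucc_injective _ e)
      by_cases h4 : m < k
      · simp [mulAtFun, Function.update_of_ne hm, h4, Function.update_of_ne h3]
      · have h5 : m.succ ≠ k.castSucc := by
          intro e
          have := congrArg Fin.val e
          simp only [Fin.val_succ, Fin.val_castSucc, Fin.lt_def] at this h4
          omega
        simp [mulAtFun, h4, hm, Function.update_of_ne h5]
  · obtain ⟨l, rfl⟩ := Fin.exists_succ_eq.2 (Fin.ne_zero_of_lt h)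
    have hkl : k ≤ l := by
      simp only [Fin.lt_def, Fin.val_succ, Fin.val_castSucc] at h
      exact Fin.le_def.2 (by omega)
    rcases hkl.eq_or_lt with rfl | hkl
    · refine ⟨k, μ (a k.castSucc), fun b => funext fun m => ?_⟩
      by_cases hm : m = k
      · subst hm; simp [mulAtFun, Function.update_of_ne hne]
      · have h3 : m.succ ≠ k.succ := fun e => hm (Fin.succ_injective _ e)
        by_cases h4 : m < k
        · have h5 : m.castSucc ≠ k.succ := by
            intro e
            have := congrArg Fin.val e
            simp only [Fin.val_succ, Fin.val_castSucc, Fin.lt_def] at this h4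
            omega
          simp [mulAtFun, Function.update_of_ne hm, h4, Function.update_of_ne h5]
        · simp [mulAtFun, h4, hm]
    · refine ⟨l, LinearMap.id, fun b => funext fun m => ?_⟩
      by_cases hm : m = l
      · subst hm; simp [mulAtFun, hkl.not_gt, hkl.ne']
      · have h1 : k.castSucc ≠ l.succ := h.ne
        have h2 : k.succ ≠ l.succ := fun e => hkl.ne (Fin.succ_injective _ e)
        have h3 : m.succ ≠ l.succ := fun e => hm (Fin.succ_injective _ e)
        by_cases h4 : m < k
        · have h5 : m.castSucc ≠ l.succ := by
            intro e
            have := congrArg Fin.val e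
            simp only [Fin.val_succ, Fin.val_castSucc, Fin.lt_def] at this h4 hkl
            omega
          simp [mulAtFun, Function.update_of_ne hm, h4, Function.update_of_ne h5]
        · simp [mulAtFun, Function.update_of_ne hm, h4, Function.update_of_ne h1,
            Function.update_of_ne h2, Function.update_of_ne h3]

/-- The linear map `a₀ ⊗ ⋯ ⊗ aₙ ↦ a₀ ⊗ ⋯ ⊗ μ(a_k, a_{k+1}) ⊗ ⋯ ⊗ aₙ`. -/
noncomputable def mulAt {n : ℕ} (μ : A →ₗ[K] A →ₗ[K] A) (k : Fin n) :
    (⨂[K] _ : Fin (n + 1), A) →ₗ[K] ⨂[K] _ : Fin n, A :=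
  PiTensorProduct.lift
    { toFun := fun a => PiTensorProduct.tprod K (mulAtFun μ k a)
      map_update_add' := by
        intro inst x v a b
        obtain ⟨v', L, hL⟩ := mulAtFun_update μ k x v
        rw [hL, hL, hL, map_add, MultilinearMap.map_update_add]
      map_update_smul' := by
        intro inst x v a b
        obtain ⟨v', L, hL⟩ := mulAtFun_update μ k x v
        rw [hL, hL, map_smul, MultilinearMap.map_update_smul] }

/-- The differential `b'` of the Hochschild complex of a nonunital associative algebra `(A, μ)`:
`b'(a₁, …, a_{n+1}) = ∑ᵢ (-1)^i (a₁, …, μ(aᵢ, a_{i+1}), …, a_{n+1})`, where `1 ≤ i ≤ n`. -/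
noncomputable def hochDiff (μ : A →ₗ[K] A →ₗ[K] A) (n : ℕ) :
    (⨂[K] _ : Fin (n + 1), A) →ₗ[K] ⨂[K] _ : Fin n, A :=
  ∑ i : Fin n, (-1 : K) ^ (i.val + 1) • mulAt μ i

/-- The cycles of the complex `⋯ → A^{⊗ n} → A^{⊗ (n-1)} → ⋯ → A` (which is zero in degree `0`). -/
noncomputable def hochCycles (μ : A →ₗ[K] A →ₗ[K] A) : (n : ℕ) → Submodule K (⨂[K] _ : Fin n, A)
  | 0 => ⊥
  | n + 1 => LinearMap.ker (hochDiff μ n)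

/-- `H^As_n(A, μ)`. -/
abbrev HochHomology (μ : A →ₗ[K] A →ₗ[K] A) (n : ℕ) : Type (max u v) :=
  hochCycles μ n ⧸ (LinearMap.range (hochDiff μ n)).submoduleOf (hochCycles μ n)

end Hochschild

/-! ## Homology of algebras over a quadratic operad -/

section Homology

variable {K : Type u} [Field K] (A : Type v) [AddCommGroup A] [Module K A]

/-- `P(n)^* ⊗ A^{⊗ n}`. -/
abbrev KoszulPre (P : SymOperad K) (n : ℕ) : Type (max u v) :=
  Module.Dual K (P.obj (Fin n)) ⊗[K] (⨂[K] _ : Fin n, A)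

/-- The diagonal action of the symmetric group on `P(n)^* ⊗ A^{⊗ n}` (without signs). -/
noncomputable def permAct (P : SymOperad K) {n : ℕ} (σ : Equiv.Perm (Fin n)) :
    KoszulPre A P n →ₗ[K] KoszulPre A P n :=
  TensorProduct.map (P.map σ.symm).dualMap
    (PiTensorProduct.reindex K (fun _ : Fin n => A) σ).toLinearMap

/-- The space `C_n = (P(n)^∨ ⊗ A^{⊗ n})_{S_n}`, with `P(n)^∨ = P(n)^* ⊗ sgn`, is the quotient of
`P(n)^* ⊗ A^{⊗ n}` by this submodule. -/
def coinvRel (P : SymOperad K) (n : ℕ) : Submodule K (KoszulPre A P n) :=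
  Submodule.span K {z | ∃ (σ : Equiv.Perm (Fin n)) (m : KoszulPre A P n),
    z = m - ((Equiv.Perm.sign σ : ℤ) : K) • permAct A P σ m}

/-- The bijection `(Fin (n+1) ∖ 0) ⊔ Fin 2 ≃ Fin (n+2)` sending the elements of `Fin 2` to
`0` and `1`, and shifting the others by one. -/
def frontEquiv (n : ℕ) : {k : Fin (n + 1) // k ≠ 0} ⊕ Fin 2 ≃ Fin (n + 2) where
  toFun := Sum.elim (fun k => k.1.succ) (fun j => j.castLE (by omega))
  invFun k := if h : k.val < 2 then Sum.inr ⟨k.val, h⟩ else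
    Sum.inl ⟨⟨k.val - 1, by omega⟩, fun e => by
      have := congrArg Fin.val e
      simp only [Fin.val_zero] at this
      omega⟩
  left_inv := by
    rintro (⟨k, hk⟩ | j)
    · have : k.val ≠ 0 := fun e => hk (Fin.ext e)
      simp [this]
    · have : j.val < 2 := j.2
      simp [this]
  right_inv k := by
    by_cases h : k.val < 2
    · simp [h]
    · simp only [h, dite_false, Sum.elim_inl]
      ext; simp only [Fin.val_succ]; omega

variable {X : Type} [Fintype X] (R : Submodule K (Free K X (Fin 3)))

/-- The map `f ↦ f(x(a₀, a₁), a₂, …, a_{n+1})` on a quadratic operad. -/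
noncomputable def insertFront (x : X) (n : ℕ) :
    (quadOperad R).obj (Fin (n + 1)) →ₗ[K] (quadOperad R).obj (Fin (n + 2)) :=
  (quadOperad R).map (frontEquiv n) ∘ₗ
    ((quadOperad R).comp (0 : Fin (n + 1))).flip (quadMk R (MTerm.gen x))

variable {A}

/-- The contribution of the first two inputs to the differential:
`φ ⊗ (a₀, …, a_{n+1}) ↦ ∑ₓ φ(- ∘₀ x^∨) ⊗ (x(a₀, a₁), a₂, …, a_{n+1})`. -/
noncomputable def koszulFront (op : X → A →ₗ[K] A →ₗ[K] A) (n : ℕ) :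
    KoszulPre A (quadDual R) (n + 2) →ₗ[K] KoszulPre A (quadDual R) (n + 1) :=
  ∑ x : X, TensorProduct.map (insertFront (quadDualRel R) x n).dualMap (mulAt (op x) 0)

/-- The permutations `ρ` with `ρ(2) < ρ(3) < ⋯`; they correspond to the ordered pairs
`(i, j) = (ρ(0), ρ(1))` with `i ≠ j`. -/
def pairShuffles (n : ℕ) : Finset (Equiv.Perm (Fin (n + 2))) :=
  Finset.univ.filter fun ρ => ∀ k l : Fin (n + 2), 2 ≤ k.val → k < l → ρ k < ρ l

/-- The differential on `P^!(n)^* ⊗ A^{⊗ n}`, where `P = P(E, R)`, which induces that of the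
chain complex `C_n(A) = (P^!(n)^∨ ⊗ A^{⊗ n})_{S_n}` of the `P`-algebra `A`. For each pair of
inputs it replaces two elements `aᵢ`, `aⱼ` by the value on them of the canonical element of
`E^∨ ⊗ E`, and the sum over the unordered pairs and over the basis `x, x^op` of `E` is written as
a sum over the ordered pairs and over `x`, as `(x^∨)^op = -(x^op)^*`. -/
noncomputable def koszulDiff (op : X → A →ₗ[K] A →ₗ[K] A) : (n : ℕ) →
    KoszulPre A (quadDual R) (n + 1) →ₗ[K] KoszulPre A (quadDual R) n
  | 0 => 0
  | n + 1 => ∑ ρ ∈ pairShuffles n, ((Equiv.Perm.sign ρ : ℤ) : K) •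
      (koszulFront R op n ∘ₗ permAct A (quadDual R) ρ.symm)

/-- The elements of `P^!(n)^* ⊗ A^{⊗ n}` whose classes in `C_n(A)` are cycles. -/
noncomputable def koszulCycles (op : X → A →ₗ[K] A →ₗ[K] A) : (n : ℕ) →
    Submodule K (KoszulPre A (quadDual R) n)
  | 0 => ⊤
  | n + 1 => (coinvRel A (quadDual R) n).comap (koszulDiff R op n)

/-- The elements of `P^!(n)^* ⊗ A^{⊗ n}` whose classes in `C_n(A)` are boundaries. -/
noncomputable def koszulBoundaries (op : X → A →ₗ[K] A →ₗ[K] A) (n : ℕ) :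
    Submodule K (KoszulPre A (quadDual R) n) :=
  coinvRel A (quadDual R) n ⊔ LinearMap.range (koszulDiff R op n)

/-- `H^P_n(A)`, the homology of `C_n(A)`, for an algebra `A` over `P = P(E, R)` with operations
`op`. -/
abbrev KoszulHomology (op : X → A →ₗ[K] A →ₗ[K] A) (n : ℕ) : Type (max u v) :=
  koszulCycles R op n ⧸ (koszulBoundaries R op n).submoduleOf (koszulCycles R op n)

end Homology

/-! ## 2-associative algebras -/

section TwoAs

/-- The two operations `*` and `·`. -/
inductive TwoOp : Type
  | star
  | dot
  deriving DecidableEq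

instance : Fintype TwoOp := ⟨{.star, .dot}, by rintro (_ | _) <;> simp⟩

/-- The monomial `x(y(a, b), c)`, for `(a, b, c) = (σ 0, σ 1, σ 2)`. -/
def leftComb {X : Type} (x y : X) (σ : Equiv.Perm (Fin 3)) : MTerm X (Fin 3) :=
  MTerm.relabel σ ⟨.node x (.node y (.leaf 0) (.leaf 1)) (.leaf 2), by
    simp [BinTerm.IsMultilinear, BinTerm.leaves, Fin.forall_fin_succ]⟩

/-- The monomial `x(a, y(b, c))`, for `(a, b, c) = (σ 0, σ 1, σ 2)`. -/
def rightComb {X : Type} (x y : X) (σ : Equiv.Perm (Fin 3)) : MTerm X (Fin 3) :=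
  MTerm.relabel σ ⟨.node x (.leaf 0) (.node y (.leaf 1) (.leaf 2)), by
    simp [BinTerm.IsMultilinear, BinTerm.leaves, Fin.forall_fin_succ]⟩

variable (K : Type u) [Field K]

/-- The relations of 2-associative algebras: `*` and `·` are associative. -/
noncomputable def twoAsRel : Submodule K (Free K TwoOp (Fin 3)) :=
  Submodule.span K {r | ∃ (x : TwoOp) (σ : Equiv.Perm (Fin 3)),
    r = Finsupp.single (leftComb x x σ) 1 - Finsupp.single (rightComb x x σ) 1}

/-- The relations: `*` and `·` are associative, and
`(a * b) · c = 0`, `a * (b · c) = 0`, `(a · b) * c = 0`, `a · (b * c) = 0`. -/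
noncomputable def twoAsZeroRel : Submodule K (Free K TwoOp (Fin 3)) :=
  twoAsRel K ⊔ Submodule.span K {r | ∃ (x y : TwoOp) (σ : Equiv.Perm (Fin 3)), x ≠ y ∧
    (r = Finsupp.single (leftComb x y σ) 1 ∨ r = Finsupp.single (rightComb x y σ) 1)}

/-- The operad `2as` of (nonunital) 2-associative algebras over `K`. -/
noncomputable def twoAs : SymOperad K := quadOperad (twoAsRel K)

/-- The iterated product `((a₀ x a₁) x a₂) ⋯ x aₙ`, as a term. -/
def powTerm {X : Type} (x : X) : (n : ℕ) → BinTerm X (Fin (n + 1))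
  | 0 => .leaf 0
  | n + 1 => .node x ((powTerm x n).relabel Fin.castSucc) (.leaf (Fin.last (n + 1)))

theorem isMultilinear_powTerm {X : Type} (x : X) (n : ℕ) : (powTerm x n).IsMultilinear := by
  induction n with
  | zero => exact ⟨by simp [powTerm, BinTerm.leaves], fun i => by
      simp [powTerm, BinTerm.leaves]; omega⟩
  | succ n ih =>
    refine ⟨?_, fun i => ?_⟩
    · simp only [powTerm, BinTerm.leaves, BinTerm.leaves_relabel]
      refine (ih.1.map (Fin.castSucc_injective _)).append (by simp) ?_
      simp only [List.disjoint_left, List.mem_map, List.mem_singleton, Fin.ext_iff]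
      rintro _ ⟨a, _, ha⟩ h
      have := a.2
      simp only [Fin.val_castSucc, Fin.val_last] at h ha
      omega
    · simp only [powTerm, BinTerm.leaves, BinTerm.leaves_relabel, List.mem_append, List.mem_map,
        List.mem_singleton]
      induction i using Fin.lastCases with
      | last => exact .inr rfl
      | cast i => exact .inl ⟨i, ih.2 i, rfl⟩

variable {K}

/-- The operation `a₀ x a₁ x ⋯ x a_{n-1}` in `P(n)` (set to `0` for `n = 0`). -/
noncomputable def powElem {X : Type} (R : Submodule K (Free K X (Fin 3))) (x : X) : (n : ℕ) →
    (quadOperad R).obj (Fin n)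
  | 0 => 0
  | n + 1 => quadMk R ⟨powTerm x n, isMultilinear_powTerm x n⟩

/-- The projection of `C_n(A)` onto the copy of `A^{⊗ n}` which corresponds to the operation `x`:
`φ ⊗ (a₀, …, a_{n-1}) ↦ ∑_σ sgn(σ) φ(a_{σ 0} x ⋯ x a_{σ (n-1)}) (a_{σ 0}, …, a_{σ (n-1)})`. -/
noncomputable def koszulProj (A : Type v) [AddCommGroup A] [Module K A] {X : Type}
    (R : Submodule K (Free K X (Fin 3))) (x : X) (n : ℕ) :
    KoszulPre A (quadDual R) n →ₗ[K] ⨂[K] _ : Fin n, A :=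
  ∑ σ : Equiv.Perm (Fin n), ((Equiv.Perm.sign σ : ℤ) : K) •
    ((TensorProduct.lid K _).toLinearMap ∘ₗ
      TensorProduct.map (Module.Dual.eval K _ (powElem (quadDualRel R) x n)) LinearMap.id ∘ₗ
      permAct A (quadDual R) σ.symm)

end TwoAs

end Operadic

open Operadic

namespace Operadic

/-! ## Recursion on multilinear monomials -/

namespace BinTerm

variable {X I J L : Type}

/-! Koszulness. A monomial defines a relation on its leaves: to `i ≠ j` it attaches the operation at
their last common vertex and the order of `i` and `j`. Modulo the two associativities a monomial is
recovered from this relation (`relEquiv_of_rel_eq`): rotating products to the right yields a first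
cut `x(l, r)` in which `l` is not itself an `x`-product, and this cut can be read off the relation.
Conversely the relation of a composite depends only on the relations of its factors, so the
relations form a basis of `2as` (`ker_toCoTree`), and composites of basis elements are basis
elements.

Contracting an edge of a decorated tree does not change its total composite `ρ`. For fixed `ρ` a
tree carries at most one decoration with composite `ρ`, and it carries one exactly when all its
vertices are modules of `ρ` (sets whose elements are indistinguishable from outside). So `D(2as)(n)`
splits over `ρ` into augmented simplicial cochain complexes, whose simplices are the nested families
of modules (`cochainOf_dDiff`).

Each of them is exact outside the right end (`exists_isConeLike`). Along the rightmost branch of a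
monomial either the operation changes or it stays the same. If it changes, some proper module
overlaps no module, and the complex is a cone over it. If it stays the same, there is a last point
`m`, related in one way to all other points. Then the chain of the vertices of a tree that contain
`m` serves as a filtration: if two consecutive members `v' ⊂ v` differ by at least two points, `v \
v'` is a module that may be added or removed without touching the chain. The trees without such a
gap are full flags of sets containing `m`, and have `n - 1` vertices.

Quadratic dual. The ternary monomials are orthogonal up to signs, with opposite signs for the two
bracketings. Orthogonality to associativity therefore relates the coefficients of `x(x(a, b), c)`
and `x(a, x(b, c))`, and leaves the mixed monomials free (`quadDualRel_twoAsRel`).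

Homology. In the dual operad monomials involving both operations vanish, and those in a single
operation are determined by the word of their leaves. In arity at least two it is thus free over the
symmetric group on the two iterated products, and the coinvariants are two copies of `A^{⊗ n}`,
detected by `koszulProj` (`exists_section`, `mem_coinvRel_iff`). The projections carry the Koszul
differential to `-b'` (`koszulProj_koszulDiff`). In arity one both products are the identity, so
that degree `n - 1` must be at least two as well, whence `3 ≤ n`. -/

theorem relabel_relabel (t : BinTerm X I) (f : I → J) (g : J → L) :
    (t.relabel f).relabel g = t.relabel (g ∘ f) := by
  simp only [relabel, bind_bind, bind, Function.comp_def]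

theorem exists_mem_leaves (t : BinTerm X I) : ∃ i, i ∈ t.leaves := by
  induction t with
  | leaf i => exact ⟨i, by simp [leaves]⟩
  | node x l r hl _ => exact ⟨hl.choose, by simp [leaves, hl.choose_spec]⟩

/-- The factors of a product use only part of the labels. Corestricting them to that part makes them
multilinear in their own right, so that a monomial can be cut into two elements of `MTerm`. -/
theorem exists_relabel_val (t : BinTerm X I) (A : I → Prop) (h : ∀ i ∈ t.leaves, A i) :
    ∃ s : BinTerm X {i // A i}, s.relabel Subtype.val = t := by
  induction t with
  | leaf i => exact ⟨.leaf ⟨i, h i (by simp [leaves])⟩, rfl⟩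
  | node x l r hl hr =>
    obtain ⟨l', hl'⟩ := hl fun i hi => h i (by simp [leaves, hi])
    obtain ⟨r', hr'⟩ := hr fun i hi => h i (by simp [leaves, hi])
    exact ⟨.node x l' r', by rw [← hl', ← hr']; rfl⟩

end BinTerm

namespace MTerm

variable {X I J L M : Type}

theorem relabel_relabel (t : MTerm X I) (f : I ≃ J) (g : J ≃ L) :
    (t.relabel f).relabel g = t.relabel (f.trans g) :=
  Subtype.ext (BinTerm.relabel_relabel _ _ _)

theorem relabel_refl (t : MTerm X I) : t.relabel (Equiv.refl I) = t :=
  Subtype.ext (BinTerm.bind_leaf _)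

theorem nonempty (t : MTerm X I) : Nonempty I := ⟨t.1.exists_mem_leaves.choose⟩

/-- The monomial `x(l, r)`. -/
def node (x : X) (l : MTerm X I) (r : MTerm X J) : MTerm X (I ⊕ J) :=
  ⟨.node x (l.1.relabel Sum.inl) (r.1.relabel Sum.inr), by
    constructor
    · simp only [BinTerm.leaves, BinTerm.leaves_relabel]
      refine (l.2.1.map Sum.inl_injective).append (r.2.1.map Sum.inr_injective) ?_
      simp [List.disjoint_left]
    · rintro (i | j)
      · simp [BinTerm.leaves, BinTerm.leaves_relabel, l.2.2 i]
      · simp [BinTerm.leaves, BinTerm.leaves_relabel, r.2.2 j]⟩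

theorem node_relabel {I' J' : Type} (x : X) (l : MTerm X I) (r : MTerm X J) (f : I ≃ I')
    (g : J ≃ J') :
    node x (l.relabel f) (r.relabel g) = (node x l r).relabel (Equiv.sumCongr f g) := by
  refine Subtype.ext ?_
  change BinTerm.node x ((l.1.relabel f).relabel Sum.inl) ((r.1.relabel g).relabel Sum.inr) =
    .node x ((l.1.relabel Sum.inl).relabel (Equiv.sumCongr f g))
      ((r.1.relabel Sum.inr).relabel (Equiv.sumCongr f g))
  simp only [BinTerm.relabel_relabel]
  rfl

/-- A monomial is a leaf or a product of two smaller monomials. -/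
theorem exists_node (t : MTerm X M) :
    (∃ i, t.1 = .leaf i ∧ ∀ j, j = i) ∨
    ∃ (x : X) (A : M → Prop) (_ : DecidablePred A) (l : MTerm X {i // A i})
      (r : MTerm X {i // ¬ A i}), t = (node x l r).relabel (Equiv.sumCompl A) := by
  classical
  obtain ⟨t, ht⟩ := t
  rcases t with i | ⟨x, l, r⟩
  · exact .inl ⟨i, rfl, fun j => by simpa [BinTerm.leaves] using ht.2 j⟩
  · right
    have hnd := List.nodup_append.1 ht.1
    obtain ⟨l', hl'⟩ := l.exists_relabel_val (fun i => i ∈ l.leaves) fun i hi => hi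
    obtain ⟨r', hr'⟩ := r.exists_relabel_val (fun i => ¬ i ∈ l.leaves) fun i hi hi' =>
      hnd.2.2 i hi' i hi rfl
    refine ⟨x, fun i => i ∈ l.leaves, inferInstance, ⟨l', ?_, ?_⟩, ⟨r', ?_, ?_⟩, ?_⟩
    · refine List.Nodup.of_map Subtype.val ?_
      rw [← BinTerm.leaves_relabel, hl']; exact hnd.1
    · rintro ⟨i, hi⟩
      have h2 := hi
      rw [← hl', BinTerm.leaves_relabel] at h2
      simpa [hi] using h2
    · refine List.Nodup.of_map Subtype.val ?_
      rw [← BinTerm.leaves_relabel, hr']; exact hnd.2.1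
    · rintro ⟨i, hi⟩
      have h2 : i ∈ r.leaves := by
        have := ht.2 i
        simp only [BinTerm.leaves, List.mem_append] at this
        tauto
      rw [← hr', BinTerm.leaves_relabel] at h2
      simpa [hi] using h2
    · refine Subtype.ext ?_
      change _ = BinTerm.node x ((l'.relabel Sum.inl).relabel _) ((r'.relabel Sum.inr).relabel _)
      simp only [BinTerm.relabel_relabel]
      conv_lhs => rw [← hl', ← hr']
      rfl

/-- Induction on multilinear monomials. -/
theorem induction {C : ∀ (I : Type) [Finite I], MTerm X I → Prop}
    (relabel : ∀ (I J : Type) [Finite I] [Finite J] (f : I ≃ J) (t : MTerm X I), C I t →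
      C J (t.relabel f))
    (one : C Unit one)
    (node : ∀ (I J : Type) [Finite I] [Finite J] (x : X) (l : MTerm X I) (r : MTerm X J), C I l →
      C J r → C (I ⊕ J) (node x l r)) (I : Type) [Finite I] (t : MTerm X I) : C I t := by
  -- The factors live on other label types, so the induction runs on the number of labels rather
  -- than on the term.
  obtain ⟨N, hN⟩ : ∃ N, Nat.card I = N := ⟨_, rfl⟩
  induction N using Nat.strong_induction_on generalizing I with
  | _ N ih =>
    rcases t.exists_node with ⟨i, hi, hj⟩ | ⟨x, A, _, l, r, rfl⟩
    · let e : Unit ≃ I := ⟨fun _ => i, fun _ => (), fun _ => rfl, fun j => (hj j).symm⟩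
      have : t = MTerm.one.relabel e := Subtype.ext hi
      rw [this]
      exact relabel _ _ _ _ one
    · obtain ⟨a⟩ := l.nonempty
      obtain ⟨b⟩ := r.nonempty
      have hl : Nat.card {i // A i} < N := hN ▸ Finite.card_subtype_lt b.2
      have hr : Nat.card {i // ¬ A i} < N := hN ▸ Finite.card_subtype_lt (not_not.2 a.2)
      exact relabel _ _ _ _ (node _ _ x l r (ih _ hl _ _ rfl) (ih _ hr _ _ rfl))

end MTerm

/-! ## The ideal generated by ternary relations -/

section Ideal

variable {K : Type u} [Field K] {X : Type}

/-- The arity `I` component of the ideal of the free operad generated by `R`. -/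
noncomputable def relIdeal (R : Submodule K (Free K X (Fin 3))) (I : Type) [Finite I] :
    Submodule K (Free K X I) :=
  idealSpan (freeOperad K X) (R : Set (Free K X (Fin 3))) I

variable {R : Submodule K (Free K X (Fin 3))} {I J L : Type}

section

variable [Finite I] [Finite J]

theorem freeMap_mem_relIdeal (f : I ≃ J) {p : Free K X I} (hp : p ∈ relIdeal R I) :
    freeMap K f p ∈ relIdeal R J :=
  InIdeal.map (P := freeOperad K X) I J f p hp

theorem mem_relIdeal_of_mem {r : Free K X (Fin 3)} (h : r ∈ R) : r ∈ relIdeal R (Fin 3) :=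
  InIdeal.of (P := freeOperad K X) r h

theorem freeComp_mem_relIdeal_left (i : I) {p : Free K X I} (q : Free K X J)
    (hp : p ∈ relIdeal R I) : freeComp K i p q ∈ relIdeal R _ :=
  InIdeal.comp_left (P := freeOperad K X) I J i p q hp

theorem freeComp_mem_relIdeal_right (i : I) (p : Free K X I) {q : Free K X J}
    (hq : q ∈ relIdeal R J) : freeComp K i p q ∈ relIdeal R _ :=
  InIdeal.comp_right (P := freeOperad K X) I J i p q hq

/-- The ideal generated by `R` is the smallest one containing `R`. -/
theorem relIdeal_le (W : ∀ (I : Type) [Finite I], Submodule K (Free K X I)) (of : R ≤ W (Fin 3))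
    (map : ∀ (I J : Type) [Finite I] [Finite J] (f : I ≃ J) (p : Free K X I), p ∈ W I →
      freeMap K f p ∈ W J)
    (comp_left : ∀ (I J : Type) [Finite I] [Finite J] (i : I) (p : Free K X I) (q : Free K X J),
      p ∈ W I → freeComp K i p q ∈ W _)
    (comp_right : ∀ (I J : Type) [Finite I] [Finite J] (i : I) (p : Free K X I) (q : Free K X J),
      q ∈ W J → freeComp K i p q ∈ W _) (I : Type) [Finite I] : relIdeal R I ≤ W I :=
  fun _ hp => InIdeal.rec (P := freeOperad K X) (R := (R : Set (Free K X (Fin 3))))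
    (motive := fun I _ p _ => p ∈ W I) (fun _ hr => of hr) (fun I _ => (W I).zero_mem)
    (fun I _ _ _ _ _ hp hq => (W I).add_mem hp hq) (fun I _ a _ _ hp => (W I).smul_mem a hp)
    (fun I J _ _ f p _ hp => map I J f p hp) (fun I J _ _ i p q _ hp => comp_left I J i p q hp)
    (fun I J _ _ i p q _ hq => comp_right I J i p q hq) hp

end

/-- The bijection relating the composite `x ∘₀ l ∘₁ r` to the product `x(l, r)`. -/
def nodeEquiv (I J : Type) :
    {z : {k : Fin 2 // k ≠ 0} ⊕ I // z ≠ Sum.inl ⟨1, one_ne_zero⟩} ⊕ J ≃ I ⊕ J where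
  toFun
    | Sum.inl ⟨Sum.inl k, h⟩ => absurd (congrArg Sum.inl (Subtype.ext (by have := k.2; lia))) h
    | Sum.inl ⟨Sum.inr i, _⟩ => Sum.inl i
    | Sum.inr j => Sum.inr j
  invFun
    | Sum.inl i => Sum.inl ⟨Sum.inr i, Sum.inr_ne_inl⟩
    | Sum.inr j => Sum.inr j
  left_inv := by
    rintro (⟨k | i, h⟩ | j)
    · exact absurd (congrArg Sum.inl (Subtype.ext (by have := k.2; lia))) h
    · rfl
    · rfl
  right_inv := by rintro (i | j) <;> rfl

/-- Writing a product as two partial composites of a generator shows that operadic ideals absorb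
products, which gives the congruence `RelEquiv.node`. -/
theorem node_eq_subst (x : X) (l : MTerm X I) (r : MTerm X J) :
    MTerm.node x l r =
      (((MTerm.gen x).subst 0 l).subst (Sum.inl ⟨1, one_ne_zero⟩) r).relabel (nodeEquiv I J) := by
  refine Subtype.ext ?_
  simp only [MTerm.node, MTerm.relabel, MTerm.subst, MTerm.gen, BinTerm.subst, BinTerm.bind]
  rw [BinTerm.plug_self, BinTerm.plug_of_ne _ _ _ one_ne_zero]
  simp only [BinTerm.relabel, BinTerm.bind, BinTerm.bind_bind, BinTerm.plug_self]
  congr 1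
  congr 1
  funext i
  rw [BinTerm.plug_of_ne _ _ _ Sum.inr_ne_inl]
  rfl

/-- The product `x(l, r)` in the free operad. -/
noncomputable def freeNode (x : X) :
    Free K X I →ₗ[K] Free K X J →ₗ[K] Free K X (I ⊕ J) :=
  Finsupp.linearCombination K fun l => Finsupp.lmapDomain K K (MTerm.node x l)

theorem freeNode_single (x : X) (l : MTerm X I) (r : MTerm X J) (a b : K) :
    freeNode x (Finsupp.single l a) (Finsupp.single r b) =
      Finsupp.single (MTerm.node x l r) (a * b) := by
  simp [freeNode, Finsupp.mapDomain_single]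

theorem freeNode_eq (x : X) (p : Free K X I) (q : Free K X J) :
    freeNode x p q = freeMap K (nodeEquiv I J) (freeComp K (Sum.inl ⟨1, one_ne_zero⟩)
      (freeComp K 0 (Finsupp.single (MTerm.gen x) 1) p) q) := by
  induction p using Finsupp.induction_linear with
  | zero => simp
  | add f g hf hg => simp only [map_add, LinearMap.add_apply, hf, hg]
  | single t a =>
    induction q using Finsupp.induction_linear with
    | zero => simp
    | add f g hf hg => simp only [map_add, hf, hg]
    | single s b =>
      simp only [freeNode_single, freeComp_single, freeMap_single, one_mul]
      rw [node_eq_subst]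

/-- The bijection relating the composite of a ternary operation with three operations to the
disjoint union of their inputs. -/
def plugThreeEquiv (I J L : Type) :
    {z : {y : {k : Fin 3 // k ≠ 0} ⊕ I // y ≠ Sum.inl ⟨1, by decide⟩} ⊕ J //
      z ≠ Sum.inl ⟨Sum.inl ⟨2, by decide⟩, by simp⟩} ⊕ L ≃ (I ⊕ J) ⊕ L where
  toFun
    | Sum.inl ⟨Sum.inl ⟨Sum.inl k, h⟩, h'⟩ =>
        (h' (congrArg Sum.inl (Subtype.ext (congrArg Sum.inl (Subtype.ext (by
          have h2 : k.1 ≠ 1 := fun e => h (congrArg Sum.inl (Subtype.ext e))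
          have := k.2; lia)))))).elim
    | Sum.inl ⟨Sum.inl ⟨Sum.inr i, _⟩, _⟩ => Sum.inl (Sum.inl i)
    | Sum.inl ⟨Sum.inr j, _⟩ => Sum.inl (Sum.inr j)
    | Sum.inr l => Sum.inr l
  invFun
    | Sum.inl (Sum.inl i) => Sum.inl ⟨Sum.inl ⟨Sum.inr i, Sum.inr_ne_inl⟩, by simp⟩
    | Sum.inl (Sum.inr j) => Sum.inl ⟨Sum.inr j, Sum.inr_ne_inl⟩
    | Sum.inr l => Sum.inr l
  left_inv := by
    rintro (⟨⟨k | i, h⟩ | j, h'⟩ | l)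
    · exact (h' (congrArg Sum.inl (Subtype.ext (congrArg Sum.inl (Subtype.ext (by
          have h2 : k.1 ≠ 1 := fun e => h (congrArg Sum.inl (Subtype.ext e))
          have := k.2; lia)))))).elim
    · rfl
    · rfl
    · rfl
  right_inv := by rintro ((i | j) | l) <;> rfl

/-- Composition of a ternary operation with three monomials. -/
noncomputable def plugThree (a : MTerm X I) (b : MTerm X J) (c : MTerm X L) :
    Free K X (Fin 3) →ₗ[K] Free K X ((I ⊕ J) ⊕ L) :=
  freeMap K (plugThreeEquiv I J L) ∘ₗ
    (freeComp K (I := {y : {k : Fin 3 // k ≠ 0} ⊕ I // y ≠ Sum.inl ⟨1, by decide⟩} ⊕ J)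
      (Sum.inl ⟨Sum.inl ⟨2, by decide⟩, by simp⟩)).flip (Finsupp.single c 1) ∘ₗ
    (freeComp K (I := {k : Fin 3 // k ≠ 0} ⊕ I) (Sum.inl ⟨1, by decide⟩)).flip
      (Finsupp.single b 1) ∘ₗ
    (freeComp K 0).flip (Finsupp.single a 1)

/-- The three successive partial composites amount to one simultaneous substitution, so evaluating
them on a comb is a computation with `bind`. -/
theorem plugThree_single_val (a : MTerm X I) (b : MTerm X J) (c : MTerm X L) (t : MTerm X (Fin 3)) :
    ∃ s : MTerm X ((I ⊕ J) ⊕ L), plugThree (K := K) a b c (Finsupp.single t 1) =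
        Finsupp.single s 1 ∧
      s.1 = t.1.bind ![a.1.relabel (Sum.inl ∘ Sum.inl), b.1.relabel (Sum.inl ∘ Sum.inr),
        c.1.relabel Sum.inr] := by
  refine ⟨(((t.subst 0 a).subst (Sum.inl ⟨1, by decide⟩) b).subst
    (Sum.inl ⟨Sum.inl ⟨2, by decide⟩, by simp⟩) c).relabel (plugThreeEquiv I J L), ?_, ?_⟩
  · simp only [plugThree, LinearMap.comp_apply, LinearMap.flip_apply, freeComp_single,
      freeMap_single, one_mul]
  · change (((t.1.bind _).bind _).bind _).bind _ = _
    rw [BinTerm.bind_bind, BinTerm.bind_bind, BinTerm.bind_bind]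
    congr 1; funext k
    fin_cases k
    · simp [BinTerm.plug_self, BinTerm.plug_of_ne, BinTerm.relabel, BinTerm.bind_bind,
        BinTerm.bind, plugThreeEquiv]
    · simp [BinTerm.plug_self, BinTerm.plug_of_ne, BinTerm.relabel, BinTerm.bind_bind,
        BinTerm.bind, plugThreeEquiv]
    · simp [BinTerm.plug_self, BinTerm.plug_of_ne, BinTerm.relabel, BinTerm.bind_bind,
        BinTerm.bind, plugThreeEquiv]

theorem plugThree_leftComb (a : MTerm X I) (b : MTerm X J) (c : MTerm X L) (x y : X) :
    plugThree (K := K) a b c (Finsupp.single (leftComb x y 1) 1) =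
      Finsupp.single (MTerm.node x (MTerm.node y a b) c) 1 := by
  obtain ⟨s, h, hs⟩ := plugThree_single_val (K := K) a b c (leftComb x y 1)
  rw [h]
  congr 1
  refine Subtype.ext ?_
  rw [hs]
  simp [leftComb, MTerm.relabel, BinTerm.relabel, BinTerm.bind, MTerm.node, BinTerm.bind_bind]

/-- The relabelling appears because the right bracketing has inputs `I ⊕ (J ⊕ L)`, while `plugThree`
is normalized to the left bracketing. -/
theorem plugThree_rightComb (a : MTerm X I) (b : MTerm X J) (c : MTerm X L) (x y : X) :
    plugThree (K := K) a b c (Finsupp.single (rightComb x y 1) 1) =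
      Finsupp.single ((MTerm.node x a (MTerm.node y b c)).relabel (Equiv.sumAssoc I J L).symm) 1 := by
  obtain ⟨s, h, hs⟩ := plugThree_single_val (K := K) a b c (rightComb x y 1)
  rw [h]
  congr 1
  refine Subtype.ext ?_
  rw [hs]
  simp [rightComb, MTerm.relabel, BinTerm.relabel, BinTerm.bind, MTerm.node, BinTerm.bind_bind]

variable [Finite I] [Finite J] [Finite L]

theorem freeNode_mem_relIdeal_left (x : X) {p : Free K X I} (q : Free K X J)
    (hp : p ∈ relIdeal R I) : freeNode x p q ∈ relIdeal R (I ⊕ J) := by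
  rw [freeNode_eq]
  exact freeMap_mem_relIdeal _ (freeComp_mem_relIdeal_left _ _ (freeComp_mem_relIdeal_right _ _ hp))

theorem freeNode_mem_relIdeal_right (x : X) (p : Free K X I) {q : Free K X J}
    (hq : q ∈ relIdeal R J) : freeNode x p q ∈ relIdeal R (I ⊕ J) := by
  rw [freeNode_eq]
  exact freeMap_mem_relIdeal _ (freeComp_mem_relIdeal_right _ _ hq)

theorem plugThree_mem (a : MTerm X I) (b : MTerm X J) (c : MTerm X L) {r : Free K X (Fin 3)}
    (hr : r ∈ R) : plugThree a b c r ∈ relIdeal R ((I ⊕ J) ⊕ L) :=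
  freeMap_mem_relIdeal _ (freeComp_mem_relIdeal_left _ _ (freeComp_mem_relIdeal_left _ _
    (freeComp_mem_relIdeal_left _ _ (mem_relIdeal_of_mem hr))))

/-- Two monomials are equivalent if they coincide in the quadratic operad with relations `R`. -/
def RelEquiv (R : Submodule K (Free K X (Fin 3))) (t s : MTerm X I) : Prop :=
  (Finsupp.single t 1 - Finsupp.single s 1 : Free K X I) ∈ relIdeal R I

theorem RelEquiv.refl (t : MTerm X I) : RelEquiv R t t := by
  simp [RelEquiv]

theorem RelEquiv.symm {t s : MTerm X I} (h : RelEquiv R t s) : RelEquiv R s t := by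
  have := (relIdeal R I).neg_mem h
  rwa [neg_sub] at this

theorem RelEquiv.trans {t s w : MTerm X I} (h : RelEquiv R t s) (h' : RelEquiv R s w) :
    RelEquiv R t w := by
  have := (relIdeal R I).add_mem h h'
  rwa [sub_add_sub_cancel] at this

theorem RelEquiv.relabel {t s : MTerm X I} (h : RelEquiv R t s) (f : I ≃ J) :
    RelEquiv R (t.relabel f) (s.relabel f) := by
  have := freeMap_mem_relIdeal f h
  rwa [map_sub, freeMap_single, freeMap_single] at this

theorem RelEquiv.node {t s : MTerm X I} {t' s' : MTerm X J} (x : X) (h : RelEquiv R t s)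
    (h' : RelEquiv R t' s') : RelEquiv R (MTerm.node x t t') (MTerm.node x s s') := by
  have h1 := freeNode_mem_relIdeal_left x (Finsupp.single t' 1) h
  have h2 := freeNode_mem_relIdeal_right x (Finsupp.single s 1) h'
  simp only [map_sub, LinearMap.sub_apply, freeNode_single, one_mul] at h1 h2
  exact RelEquiv.trans h1 h2

/-- Since arbitrary monomials can be plugged into the three inputs, only the relation for the
identity ordering of the inputs is needed. -/
theorem RelEquiv.assoc {x : X}
    (hR : Finsupp.single (leftComb x x 1) 1 - Finsupp.single (rightComb x x 1) 1 ∈ R)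
    (a : MTerm X I) (b : MTerm X J) (c : MTerm X L) :
    RelEquiv R (MTerm.node x (MTerm.node x a b) c)
      ((MTerm.node x a (MTerm.node x b c)).relabel (Equiv.sumAssoc I J L).symm) := by
  have := plugThree_mem a b c hR
  rwa [map_sub, plugThree_leftComb, plugThree_rightComb] at this

end Ideal

end Operadic

namespace Operadic

/-! ## The relation on the leaves defined by a monomial -/

/-- A binary relation with values in the operations and a direction. -/
abbrev LeafRel (X I : Type) : Type := I → I → Option (X × Bool)

namespace BinTerm

variable {X I J : Type}

open Classical in
/-- For two distinct leaves `i`, `j`: the operation at their last common vertex, and whether `i`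
comes before `j`. -/
noncomputable def rel : BinTerm X I → LeafRel X I
  | leaf _, _, _ => none
  | node x l r, i, j =>
    if i ∈ l.leaves then if j ∈ l.leaves then l.rel i j else some (x, true)
    else if j ∈ l.leaves then some (x, false) else r.rel i j

/-- The common inductive step for `rel_relabel` and for most of the substitution formulas: two terms
are descended in parallel, and it suffices that the two leaves fall on the same sides at each
vertex. -/
theorem rel_node_congr (x : X) {l r : BinTerm X I} {l' r' : BinTerm X J} {i j : I} {i' j' : J}
    (hi : i ∈ l.leaves ↔ i' ∈ l'.leaves) (hj : j ∈ l.leaves ↔ j' ∈ l'.leaves)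
    (h1 : i ∈ l.leaves → j ∈ l.leaves → l.rel i j = l'.rel i' j')
    (h2 : i ∉ l.leaves → j ∉ l.leaves → r.rel i j = r'.rel i' j') :
    (node x l r).rel i j = (node x l' r').rel i' j' := by
  by_cases hi' : i ∈ l.leaves <;> by_cases hj' : j ∈ l.leaves
  · simp only [rel, hi', hj', hi.1 hi', hj.1 hj', if_true, h1]
  · simp only [rel, hi', hj', hi.1 hi', mt hj.2 hj', if_true, if_false]
  · simp only [rel, hi', hj', mt hi.2 hi', hj.1 hj', if_true, if_false]
  · simp only [rel, hi', hj', mt hi.2 hi', mt hj.2 hj', if_false, h2, not_false_eq_true]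

theorem rel_relabel {f : I → J} (hf : Function.Injective f) (t : BinTerm X I) (i j : I) :
    (t.relabel f).rel (f i) (f j) = t.rel i j := by
  induction t with
  | leaf k => rfl
  | node x l r hl hr =>
    have h (i : I) : f i ∈ (l.relabel f).leaves ↔ i ∈ l.leaves := by
      rw [leaves_relabel, List.mem_map_of_injective hf]
    exact rel_node_congr x (h i) (h j) (fun _ _ => hl) fun _ _ => hr

theorem rel_self (t : BinTerm X I) (i : I) : t.rel i i = none := by
  induction t with
  | leaf k => rfl
  | node x l r hl hr => simp only [rel]; split_ifs <;> assumption

theorem inl_mem_leaves_subst (i : I) (t : BinTerm X I) (s : BinTerm X J) (a : {x // x ≠ i}) :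
    Sum.inl a ∈ (t.subst i s).leaves ↔ a.1 ∈ t.leaves := by
  rw [subst, leaves_bind, List.mem_flatMap]
  constructor
  · rintro ⟨k, hk, h⟩
    by_cases hki : k = i
    · subst hki; rw [plug_self, leaves_relabel] at h; simp at h
    · rw [plug_of_ne _ _ _ hki] at h
      simp only [leaves, List.mem_singleton, Sum.inl.injEq] at h
      rw [h]; exact hk
  · exact fun h => ⟨a.1, h, by rw [plug_of_ne _ _ _ a.2]; simp [leaves]⟩

theorem inr_mem_leaves_subst (i : I) (t : BinTerm X I) {s : BinTerm X J} (hs : s.IsMultilinear)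
    (j : J) : Sum.inr j ∈ (t.subst i s).leaves ↔ i ∈ t.leaves := by
  rw [subst, leaves_bind, List.mem_flatMap]
  constructor
  · rintro ⟨k, hk, h⟩
    by_cases hki : k = i
    · exact hki ▸ hk
    · rw [plug_of_ne _ _ _ hki] at h
      simp [leaves] at h
  · exact fun h => ⟨i, h, by rw [plug_self, leaves_relabel]; simp [hs.2 j]⟩

theorem rel_subst_inl_inl (i : I) (t : BinTerm X I) (s : BinTerm X J) (a b : {x // x ≠ i})
    (ha : a.1 ∈ t.leaves) (hb : b.1 ∈ t.leaves) :
    (t.subst i s).rel (Sum.inl a) (Sum.inl b) = t.rel a b := by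
  induction t with
  | leaf k =>
    simp only [leaves, List.mem_singleton] at ha
    change (plug i s k).rel _ _ = _
    rw [plug_of_ne _ _ _ (ha ▸ a.2)]
    rfl
  | node x l r hl hr =>
    simp only [leaves, List.mem_append] at ha hb
    have h (c : {x // x ≠ i}) := inl_mem_leaves_subst i l s c
    exact rel_node_congr x (h a) (h b) (fun h1 h2 => hl ((h a).1 h1) ((h b).1 h2)) fun h1 h2 =>
      hr (ha.resolve_left (mt (h a).2 h1)) (hb.resolve_left (mt (h b).2 h2))

theorem rel_subst_inl_inr (i : I) (t : BinTerm X I) {s : BinTerm X J} (hs : s.IsMultilinear)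
    (a : {x // x ≠ i}) (j : J) (ha : a.1 ∈ t.leaves) (hi : i ∈ t.leaves) :
    (t.subst i s).rel (Sum.inl a) (Sum.inr j) = t.rel a i := by
  induction t with
  | leaf k =>
    simp only [leaves, List.mem_singleton] at ha hi
    exact absurd (ha.trans hi.symm) a.2
  | node x l r hl hr =>
    simp only [leaves, List.mem_append] at ha hi
    have h1 := inl_mem_leaves_subst i l s a
    have h2 := inr_mem_leaves_subst i l hs j
    exact rel_node_congr x h1 h2 (fun g1 g2 => hl (h1.1 g1) (h2.1 g2)) fun g1 g2 =>
      hr (ha.resolve_left (mt h1.2 g1)) (hi.resolve_left (mt h2.2 g2))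

theorem rel_subst_inr_inl (i : I) (t : BinTerm X I) {s : BinTerm X J} (hs : s.IsMultilinear)
    (a : {x // x ≠ i}) (j : J) (ha : a.1 ∈ t.leaves) (hi : i ∈ t.leaves) :
    (t.subst i s).rel (Sum.inr j) (Sum.inl a) = t.rel i a := by
  induction t with
  | leaf k =>
    simp only [leaves, List.mem_singleton] at ha hi
    exact absurd (ha.trans hi.symm) a.2
  | node x l r hl hr =>
    simp only [leaves, List.mem_append] at ha hi
    have h1 := inl_mem_leaves_subst i l s a
    have h2 := inr_mem_leaves_subst i l hs j
    exact rel_node_congr x h2 h1 (fun g2 g1 => hl (h1.1 g1) (h2.1 g2)) fun g2 g1 =>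
      hr (ha.resolve_left (mt h1.2 g1)) (hi.resolve_left (mt h2.2 g2))

/-- Two leaves of `s` fall on the same side of every vertex of `t`, so the descent ends at the leaf
`i`, where `s` itself is found. -/
theorem rel_subst_inr_inr (i : I) (t : BinTerm X I) {s : BinTerm X J} (hs : s.IsMultilinear)
    (j j' : J) (hi : i ∈ t.leaves) :
    (t.subst i s).rel (Sum.inr j) (Sum.inr j') = s.rel j j' := by
  induction t with
  | leaf k =>
    simp only [leaves, List.mem_singleton] at hi
    change (plug i s k).rel _ _ = _
    rw [← hi, plug_self, rel_relabel Sum.inr_injective]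
  | node x l r hl hr =>
    change (node x (l.subst i s) (r.subst i s)).rel _ _ = _
    simp only [leaves, List.mem_append] at hi
    have h := inr_mem_leaves_subst i l hs
    by_cases h' : i ∈ l.leaves
    · simp only [rel, (h _).2 h', if_true, hl h']
    · simp only [rel, mt (h _).1 h', if_false, hr (hi.resolve_left h')]

end BinTerm

namespace LeafRel

variable {X I J : Type}

/-- Relabelling. -/
def map (f : I ≃ J) (ρ : LeafRel X I) : LeafRel X J := fun i j => ρ (f.symm i) (f.symm j)

/-- Substitution of a relation for a point. -/
def comp (i : I) (ρ : LeafRel X I) (σ : LeafRel X J) : LeafRel X ({x : I // x ≠ i} ⊕ J)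
  | Sum.inl a, Sum.inl b => ρ a b
  | Sum.inl a, Sum.inr _ => ρ a i
  | Sum.inr _, Sum.inl b => ρ i b
  | Sum.inr j, Sum.inr j' => σ j j'

end LeafRel

/-! ### The relation of a multilinear monomial: relabelling, substitution, products -/

namespace MTerm

variable {X I J L : Type}

/-- The relation defined by a monomial. -/
noncomputable def rel (t : MTerm X I) : LeafRel X I := t.1.rel

theorem rel_relabel (t : MTerm X I) (f : I ≃ J) : (t.relabel f).rel = t.rel.map f := by
  funext i j
  have := BinTerm.rel_relabel f.injective t.1 (f.symm i) (f.symm j)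
  rw [f.apply_symm_apply, f.apply_symm_apply] at this
  exact this

theorem rel_relabel_apply (t : MTerm X I) (f : I ≃ J) (i j : I) :
    (t.relabel f).rel (f i) (f j) = t.rel i j :=
  BinTerm.rel_relabel f.injective t.1 i j

theorem rel_self (t : MTerm X I) (i : I) : t.rel i i = none := t.1.rel_self i

/-- The last common vertex of two leaves lies in `s` when both come from `s`; otherwise it lies in
`t`, where all of `s` counts as the point `i`. Hence composition is well defined on relations. -/
theorem rel_subst (i : I) (t : MTerm X I) (s : MTerm X J) :
    (t.subst i s).rel = t.rel.comp i s.rel := by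
  funext a b
  rcases a with a | a <;> rcases b with b | b
  · exact BinTerm.rel_subst_inl_inl i t.1 s.1 a b (t.2.2 _) (t.2.2 _)
  · exact BinTerm.rel_subst_inl_inr i t.1 s.2 a b (t.2.2 _) (t.2.2 _)
  · exact BinTerm.rel_subst_inr_inl i t.1 s.2 b a (t.2.2 _) (t.2.2 _)
  · exact BinTerm.rel_subst_inr_inr i t.1 s.2 a b (t.2.2 _)

section

variable (x : X) (l : MTerm X I) (r : MTerm X J)

theorem inl_mem_leaves (i : I) :
    (Sum.inl i : I ⊕ J) ∈ (l.1.relabel Sum.inl : BinTerm X (I ⊕ J)).leaves := by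
  rw [BinTerm.leaves_relabel]; simp [l.2.2 i]

theorem inr_notMem_leaves (j : J) :
    (Sum.inr j : I ⊕ J) ∉ (l.1.relabel Sum.inl : BinTerm X (I ⊕ J)).leaves := by
  rw [BinTerm.leaves_relabel]; simp

@[simp]
theorem rel_node_inl_inl (i j : I) : (node x l r).rel (Sum.inl i) (Sum.inl j) = l.rel i j := by
  have h1 := l.inl_mem_leaves (J := J) i
  have h2 := l.inl_mem_leaves (J := J) j
  simp only [rel, node, BinTerm.rel, h1, h2, if_true]
  exact BinTerm.rel_relabel Sum.inl_injective _ _ _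

@[simp]
theorem rel_node_inl_inr (i : I) (j : J) :
    (node x l r).rel (Sum.inl i) (Sum.inr j) = some (x, true) := by
  have h1 := l.inl_mem_leaves (J := J) i
  have h2 := l.inr_notMem_leaves j
  simp only [rel, node, BinTerm.rel, h1, h2, if_true, if_false]

@[simp]
theorem rel_node_inr_inl (i : I) (j : J) :
    (node x l r).rel (Sum.inr j) (Sum.inl i) = some (x, false) := by
  have h1 := l.inl_mem_leaves (J := J) i
  have h2 := l.inr_notMem_leaves j
  simp only [rel, node, BinTerm.rel, h1, h2, if_true, if_false]

@[simp]
theorem rel_node_inr_inr (i j : J) : (node x l r).rel (Sum.inr i) (Sum.inr j) = r.rel i j := by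
  have h1 := l.inr_notMem_leaves i
  have h2 := l.inr_notMem_leaves j
  simp only [rel, node, BinTerm.rel, h1, h2, if_false]
  exact BinTerm.rel_relabel Sum.inr_injective _ _ _

end

end MTerm

/-! ## Normal forms modulo associativity -/

section NormalForm

variable {X I J : Type}

/-- Two nontrivial cuts of a set are crossed by a common pair. -/
theorem exists_crossing {U A B : Set I} (hA : (U ∩ A).Nonempty) (hA' : (U \ A).Nonempty)
    (hB : (U ∩ B).Nonempty) (hB' : (U \ B).Nonempty) :
    ∃ i ∈ U ∩ A, ∃ j ∈ U \ A, (i ∈ B ∧ j ∉ B) ∨ (i ∉ B ∧ j ∈ B) := by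
  obtain ⟨a, ha⟩ := hA
  obtain ⟨a', ha'⟩ := hA'
  obtain ⟨b, hb⟩ := hB
  obtain ⟨b', hb'⟩ := hB'
  simp only [Set.mem_inter_iff, Set.mem_sdiff] at *
  grind

/-- Every cut of `A` is crossed by a pair whose operation is not `x`. -/
def LeafRel.ConnOn (x : X) (ρ : LeafRel X I) (A : Set I) : Prop :=
  ∀ B ⊆ A, B.Nonempty → (A \ B).Nonempty → ∃ i ∈ B, ∃ j ∈ A \ B, ∀ b, ρ i j ≠ some (x, b)

/-- The relation is that of a product `x(l, r)`, where `A` is the set of leaves of `l`, and `l` is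
not itself a product for the operation `x`. -/
structure LeafRel.IsSplit (x : X) (ρ : LeafRel X I) (A : Set I) : Prop where
  nonempty : A.Nonempty
  compl_nonempty : Aᶜ.Nonempty
  before : ∀ i ∈ A, ∀ j ∉ A, ρ i j = some (x, true)
  after : ∀ i ∈ A, ∀ j ∉ A, ρ j i = some (x, false)
  conn : ρ.ConnOn x A

/-- If `A` meets both `B` and its complement, the split `B` gives the operation `x` to every pair
crossing the cut of `A` by `B`, against the connectedness of `A`. If `A` and `B` are disjoint, a
point of each would precede the other. -/
theorem LeafRel.IsSplit.subset {x : X} {ρ : LeafRel X I} {A B : Set I}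
    (hA : ρ.IsSplit x A) (hB : ρ.IsSplit x B) : A ⊆ B := by
  by_contra h
  obtain ⟨a, ha, haB⟩ := Set.not_subset.1 h
  by_cases hAB : (A ∩ B).Nonempty
  · obtain ⟨i, hi, j, hj, hij⟩ := hA.conn (A ∩ B) Set.inter_subset_left hAB ⟨a, ha, fun h => haB h.2⟩
    exact hij true (hB.before i hi.2 j fun h => hj.2 ⟨hj.1, h⟩)
  · obtain ⟨b, hb⟩ := hB.nonempty
    have hbA : b ∉ A := fun h => hAB ⟨b, h, hb⟩
    have h1 := hA.before a ha b hbA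
    rw [hB.after b hb a haB] at h1
    simp at h1

/-- A pair crossing both cuts receives the operation `x` from one and `y` from the other, so they
agree; then the inclusion applies in both directions. -/
theorem LeafRel.IsSplit.unique {x y : X} {ρ : LeafRel X I} {A B : Set I}
    (hA : ρ.IsSplit x A) (hB : ρ.IsSplit y B) : x = y ∧ A = B := by
  obtain ⟨i, ⟨-, hi⟩, j, ⟨-, hj⟩, h⟩ := exists_crossing (U := Set.univ) (A := A) (B := B)
    (by simpa using hA.nonempty) (by simpa [Set.compl_eq_univ_sdiff] using hA.compl_nonempty)
    (by simpa using hB.nonempty) (by simpa [Set.compl_eq_univ_sdiff] using hB.compl_nonempty)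
  have hxy : x = y := by
    have h1 := hA.before i hi j hj
    rcases h with h | h
    · rw [hB.before i h.1 j h.2] at h1; simpa using h1.symm
    · rw [hB.after j h.2 i h.1] at h1; simp at h1
  subst hxy
  exact ⟨rfl, (hA.subset hB).antisymm (hB.subset hA)⟩

variable {K : Type u} [Field K] {R : Submodule K (Free K X (Fin 3))}

/-- The associativity relations hold modulo `R`. -/
def AssocIn (R : Submodule K (Free K X (Fin 3))) : Prop :=
  ∀ x, Finsupp.single (leftComb x x 1) 1 - Finsupp.single (rightComb x x 1) 1 ∈ R

theorem rel_node_assoc {L : Type} (x : X) (a : MTerm X I) (b : MTerm X J) (c : MTerm X L) :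
    (MTerm.node x (MTerm.node x a b) c).rel =
      ((MTerm.node x a (MTerm.node x b c)).relabel (Equiv.sumAssoc I J L).symm).rel := by
  rw [MTerm.rel_relabel]
  funext i j
  rcases i with (i | i) | i <;> rcases j with (j | j) | j <;> simp [LeafRel.map]

/-- Rotate `x(x(a, b), r)` to `x(a, x(b, r))` until the left factor is no longer an `x`-product, a
property recorded by `ConnOn`. Each rotation enlarges the right factor, hence the quantification
over `r` inside the induction on `l`. The equality of relations is carried along because the ideal
is not yet known to preserve them. -/
theorem exists_relEquiv_node (hR : AssocIn R) (I : Type) [Finite I] (l : MTerm X I) :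
    ∀ (x : X) (J : Type) [Finite J] (r : MTerm X J), ∃ (P Q : Type) (_ : Finite P) (_ : Finite Q)
      (p : MTerm X P) (q : MTerm X Q) (e : P ⊕ Q ≃ I ⊕ J), p.rel.ConnOn x Set.univ ∧
        RelEquiv R (MTerm.node x l r) ((MTerm.node x p q).relabel e) ∧
        (MTerm.node x l r).rel = ((MTerm.node x p q).relabel e).rel := by
  refine MTerm.induction (C := fun I _ l => ∀ (x : X) (J : Type) [Finite J] (r : MTerm X J),
    ∃ (P Q : Type) (_ : Finite P) (_ : Finite Q) (p : MTerm X P) (q : MTerm X Q)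
      (e : P ⊕ Q ≃ I ⊕ J), p.rel.ConnOn x Set.univ ∧
        RelEquiv R (MTerm.node x l r) ((MTerm.node x p q).relabel e) ∧
        (MTerm.node x l r).rel = ((MTerm.node x p q).relabel e).rel) ?_ ?_ ?_ I l
  · intro I I' _ _ f t ih x J _ r
    obtain ⟨P, Q, hP, hQ, p, q, e, h1, h2, h3⟩ := ih x J r
    refine ⟨P, Q, hP, hQ, p, q, e.trans (Equiv.sumCongr f (Equiv.refl J)), h1, ?_⟩
    have : MTerm.node x (t.relabel f) r =
        (MTerm.node x t r).relabel (Equiv.sumCongr f (Equiv.refl J)) := by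
      rw [← MTerm.node_relabel, MTerm.relabel_refl]
    rw [this, ← MTerm.relabel_relabel]
    exact ⟨h2.relabel _, by rw [MTerm.rel_relabel, h3, ← MTerm.rel_relabel]⟩
  · intro x J _ r
    refine ⟨Unit, J, inferInstance, inferInstance, MTerm.one, r, Equiv.refl _, ?_, ?_⟩
    · rintro B - ⟨⟨⟩, hB⟩ ⟨⟨⟩, hB'⟩
      exact absurd hB hB'.2
    · rw [MTerm.relabel_refl]; exact ⟨RelEquiv.refl _, rfl⟩
  · intro I I' _ _ y a b iha ihb x J _ r
    by_cases hxy : y = x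
    · subst hxy
      -- After one rotation the left factor is the smaller monomial `a`.
      obtain ⟨P, Q, hP, hQ, p, q, e, h1, h2, h3⟩ := iha y (I' ⊕ J) (MTerm.node y b r)
      refine ⟨P, Q, hP, hQ, p, q, e.trans (Equiv.sumAssoc I I' J).symm, h1, ?_⟩
      rw [← MTerm.relabel_relabel]
      exact ⟨(RelEquiv.assoc (hR y) a b r).trans (h2.relabel _), by
        rw [rel_node_assoc, MTerm.rel_relabel, h3, ← MTerm.rel_relabel]⟩
    · refine ⟨I ⊕ I', J, inferInstance, inferInstance, MTerm.node y a b, r, Equiv.refl _, ?_, ?_⟩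
      -- Every cut of the leaves of `y(a, b)` is crossed by a pair with one leaf in `a` and one in
      -- `b`, whose operation is `y ≠ x`.
      · intro B _ hB hB'
        obtain ⟨i0⟩ := a.nonempty
        obtain ⟨j0⟩ := b.nonempty
        obtain ⟨i, ⟨-, hi⟩, j, ⟨-, hj⟩, h⟩ := exists_crossing (U := Set.univ)
          (by simpa using hB) hB' (B := Set.range Sum.inl) ⟨Sum.inl i0, trivial, i0, rfl⟩
          ⟨Sum.inr j0, by simp⟩
        refine ⟨i, hi, j, ⟨trivial, hj⟩, fun c => ?_⟩
        rcases i with i | i <;> rcases j with j | j <;> simp_all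
      · rw [MTerm.relabel_refl]; exact ⟨RelEquiv.refl _, rfl⟩

open Classical in
-- Transports the rotated product to a subset `A` of the labels themselves, so that the first cuts
-- of two different monomials can be compared.
theorem exists_relEquiv_split (hR : AssocIn R) {I : Type} [Finite I] (t : MTerm X I) :
    (∃ i, t.1 = .leaf i ∧ ∀ j, j = i) ∨
    ∃ (x : X) (A : Set I) (p : MTerm X {i // i ∈ A}) (q : MTerm X {i // ¬ i ∈ A}),
      t.rel.IsSplit x A ∧
      RelEquiv R t ((MTerm.node x p q).relabel (Equiv.sumCompl fun i => i ∈ A)) ∧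
      t.rel = ((MTerm.node x p q).relabel (Equiv.sumCompl fun i => i ∈ A)).rel := by
  rcases t.exists_node with h | ⟨x, A', _, l, r, rfl⟩
  · exact .inl h
  right
  obtain ⟨P, Q, hP, hQ, p, q, e, h1, h2, h3⟩ := exists_relEquiv_node hR _ l x _ r
  set e' := e.trans (Equiv.sumCompl A') with he'
  let A : Set I := Set.range fun a => e' (Sum.inl a)
  have hA' : ∀ b, e' (Sum.inr b) ∉ A := by
    rintro b ⟨a, ha⟩
    simpa using e'.injective ha
  let f : P ≃ {i // i ∈ A} := Equiv.ofBijective (fun a => ⟨e' (Sum.inl a), a, rfl⟩)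
    ⟨fun a b h => by simpa using congrArg Subtype.val h, by rintro ⟨_, a, rfl⟩; exact ⟨a, rfl⟩⟩
  let g : Q ≃ {i // ¬ i ∈ A} := Equiv.ofBijective (fun b => ⟨e' (Sum.inr b), hA' b⟩)
    ⟨fun a b h => by simpa using congrArg Subtype.val h, by
      rintro ⟨i, hi⟩
      obtain ⟨a | b, rfl⟩ := e'.surjective i
      · exact absurd ⟨a, rfl⟩ hi
      · exact ⟨b, rfl⟩⟩
  have hfg : (Equiv.sumCongr f g).trans (Equiv.sumCompl fun i => i ∈ A) = e' := by
    ext (a | b) <;> rfl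
  have hnode : (MTerm.node x (p.relabel f) (q.relabel g)).relabel
      (Equiv.sumCompl fun i => i ∈ A) = (MTerm.node x p q).relabel e' := by
    rw [MTerm.node_relabel, MTerm.relabel_relabel, hfg]
  have hrel : ((MTerm.node x l r).relabel (Equiv.sumCompl A')).rel =
      ((MTerm.node x p q).relabel e').rel := by
    rw [MTerm.rel_relabel, h3, ← MTerm.rel_relabel, MTerm.relabel_relabel]
  refine ⟨x, A, p.relabel f, q.relabel g, ?_, ?_, ?_⟩
  · rw [hrel]
    have hb : ∀ i ∉ A, ∃ b, e' (Sum.inr b) = i := by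
      intro i hi
      obtain ⟨a | b, rfl⟩ := e'.surjective i
      · exact absurd ⟨a, rfl⟩ hi
      · exact ⟨b, rfl⟩
    refine ⟨?_, ?_, ?_, ?_, ?_⟩
    · exact p.nonempty.elim fun a => ⟨_, a, rfl⟩
    · exact q.nonempty.elim fun b => ⟨_, hA' b⟩
    · rintro _ ⟨a, rfl⟩ j hj
      obtain ⟨b, rfl⟩ := hb j hj
      simp [MTerm.rel_relabel_apply]
    · rintro _ ⟨a, rfl⟩ j hj
      obtain ⟨b, rfl⟩ := hb j hj
      simp [MTerm.rel_relabel_apply]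
    · rintro B hB ⟨b, hbB⟩ ⟨c, hcA, hcB⟩
      obtain ⟨b, rfl⟩ := hB hbB
      obtain ⟨c, rfl⟩ := hcA
      obtain ⟨i, hi, j, hj, hij⟩ := h1 {a | e' (Sum.inl a) ∈ B} (Set.subset_univ _) ⟨b, hbB⟩
        ⟨c, trivial, hcB⟩
      refine ⟨_, hi, _, ⟨⟨j, rfl⟩, hj.2⟩, fun d => ?_⟩
      rw [MTerm.rel_relabel_apply, MTerm.rel_node_inl_inl]
      exact hij d
  · rw [hnode, he', ← MTerm.relabel_relabel]
    exact h2.relabel _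
  · rw [hnode, hrel]

/-- Modulo associativity, a monomial is determined by the relation on its leaves. -/
theorem relEquiv_of_rel_eq (hR : AssocIn R) {I : Type} [Finite I] (t s : MTerm X I)
    (h : t.rel = s.rel) : RelEquiv R t s := by
  classical
  obtain ⟨N, hN⟩ : ∃ N, Nat.card I = N := ⟨_, rfl⟩
  induction N using Nat.strong_induction_on generalizing I with
  | _ N ih =>
    rcases exists_relEquiv_split hR t with ⟨i, hi, hj⟩ | ⟨x, A, p, q, h1, h2, h3⟩
    · rcases exists_relEquiv_split hR s with ⟨k, hk, -⟩ | ⟨y, B, p', q', h1', h2', h3'⟩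
      · have : t = s := Subtype.ext (by rw [hi, hk, hj k])
        rw [this]; exact RelEquiv.refl _
      · obtain ⟨a, ha⟩ := h1'.nonempty
        obtain ⟨b, hb⟩ := h1'.compl_nonempty
        rw [hj a, ← hj b] at ha
        exact absurd ha hb
    · rcases exists_relEquiv_split hR s with ⟨k, hk, hj⟩ | ⟨y, B, p', q', h1', h2', h3'⟩
      · obtain ⟨a, ha⟩ := h1.nonempty
        obtain ⟨b, hb⟩ := h1.compl_nonempty
        rw [hj a, ← hj b] at ha
        exact absurd ha hb
      -- The common relation determines the first operation and the leaves of the left factor; its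
      -- restrictions determine the two factors by induction.
      · obtain ⟨rfl, rfl⟩ := h1.unique (h ▸ h1')
        obtain ⟨a, ha⟩ := h1.nonempty
        obtain ⟨b, hb⟩ := h1.compl_nonempty
        have hp : p.rel = p'.rel := by
          funext i j
          have := congrFun (congrFun (h3.symm.trans (h.trans h3')) (Equiv.sumCompl _ (.inl i)))
            (Equiv.sumCompl _ (.inl j))
          simpa only [MTerm.rel_relabel_apply, MTerm.rel_node_inl_inl] using this
        have hq : q.rel = q'.rel := by
          funext i j
          have := congrFun (congrFun (h3.symm.trans (h.trans h3')) (Equiv.sumCompl _ (.inr i)))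
            (Equiv.sumCompl _ (.inr j))
          simpa only [MTerm.rel_relabel_apply, MTerm.rel_node_inr_inr] using this
        have e1 := ih _ (hN ▸ Finite.card_subtype_lt hb) p p' hp rfl
        have e2 := ih _ (hN ▸ Finite.card_subtype_lt (not_not.2 ha)) q q' hq rfl
        exact h2.trans (((e1.node x e2).relabel _).trans h2'.symm)

end NormalForm

/-! ## A basis of the operad of 2-associative algebras -/

/-- The relations defined by monomials. -/
def CoTree (X I : Type) : Type := {ρ : LeafRel X I // ∃ t : MTerm X I, t.rel = ρ}

namespace CoTree

variable {X I J : Type}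

/-- The class of a monomial. -/
noncomputable def mk (t : MTerm X I) : CoTree X I := ⟨t.rel, t, rfl⟩

theorem mk_surjective : Function.Surjective (mk : MTerm X I → CoTree X I) := by
  rintro ⟨_, t, rfl⟩; exact ⟨t, rfl⟩

theorem mk_eq_mk {t s : MTerm X I} : mk t = mk s ↔ t.rel = s.rel := Subtype.ext_iff

/-- Relabelling. -/
def map (f : I ≃ J) (ρ : CoTree X I) : CoTree X J :=
  ⟨ρ.1.map f, ρ.2.choose.relabel f, by rw [MTerm.rel_relabel, ρ.2.choose_spec]⟩

/-- Partial composition. -/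
def comp (i : I) (ρ : CoTree X I) (σ : CoTree X J) : CoTree X ({x : I // x ≠ i} ⊕ J) :=
  ⟨ρ.1.comp i σ.1, ρ.2.choose.subst i σ.2.choose, by
    rw [MTerm.rel_subst, ρ.2.choose_spec, σ.2.choose_spec]⟩

theorem mk_relabel (f : I ≃ J) (t : MTerm X I) : mk (t.relabel f) = (mk t).map f :=
  Subtype.ext (MTerm.rel_relabel t f)

theorem mk_subst (i : I) (t : MTerm X I) (s : MTerm X J) :
    mk (t.subst i s) = (mk t).comp i (mk s) :=
  Subtype.ext (MTerm.rel_subst i t s)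

theorem rel_self (ρ : CoTree X I) (i : I) : ρ.1 i i = none := by
  obtain ⟨_, t, rfl⟩ := ρ; exact t.rel_self i

end CoTree

section Basis

variable {K : Type u} [Field K] {X I : Type}

/-- A subspace of a space of formal combinations which contains the differences of the elements with
the same image under `f` contains the kernel of the linear extension of `f`. -/
theorem mem_of_mapDomain_eq_zero {S T : Type*} {f : S → T} {W : Submodule K (S →₀ K)}
    (h : ∀ s s', f s = f s' → Finsupp.single s 1 - Finsupp.single s' 1 ∈ W) {p : S →₀ K}
    (hp : Finsupp.mapDomain f p = 0) : p ∈ W := by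
  classical
  rcases isEmpty_or_nonempty S with hS | hS
  · rw [Subsingleton.elim p 0]; exact W.zero_mem
  -- Modulo `W`, each `p` agrees with the lift of its image along the section `Function.invFun f`,
  -- and that lift is zero when the image is.
  have key : ∀ p : S →₀ K,
      p - Finsupp.mapDomain (Function.invFun f) (Finsupp.mapDomain f p) ∈ W := by
    intro p
    induction p using Finsupp.induction_linear with
    | zero => simp
    | add a b ha hb =>
      rw [Finsupp.mapDomain_add, Finsupp.mapDomain_add, add_sub_add_comm]
      exact W.add_mem ha hb
    | single s a =>
      rw [Finsupp.mapDomain_single, Finsupp.mapDomain_single]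
      have := W.smul_mem a (h s (Function.invFun f (f s)) (Function.invFun_eq ⟨s, rfl⟩).symm)
      simpa [smul_sub] using this
  have := key p
  rwa [hp, Finsupp.mapDomain_zero, sub_zero] at this

variable (K) in
/-- The linear map sending a monomial to its relation. -/
noncomputable def toCoTree (I : Type) : Free K X I →ₗ[K] (CoTree X I →₀ K) :=
  Finsupp.lmapDomain K K CoTree.mk

theorem toCoTree_single (t : MTerm X I) (a : K) :
    toCoTree K I (Finsupp.single t a) = Finsupp.single (CoTree.mk t) a := by
  simp [toCoTree, Finsupp.mapDomain_single]

theorem toCoTree_freeMap {J : Type} (f : I ≃ J) (p : Free K X I) :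
    toCoTree K J (freeMap K f p) = Finsupp.lmapDomain K K (CoTree.map f) (toCoTree K I p) := by
  induction p using Finsupp.induction_linear with
  | zero => simp
  | add f g hf hg => simp only [map_add, hf, hg]
  | single t a => simp [freeMap_single, toCoTree_single, CoTree.mk_relabel, Finsupp.mapDomain_single]

theorem toCoTree_freeComp {J : Type} (i : I) (p : Free K X I) (q : Free K X J) :
    toCoTree K _ (freeComp K i p q) =
      Finsupp.linearCombination K (fun ρ : CoTree X I => Finsupp.lmapDomain K K
        (CoTree.comp (J := J) i ρ)) (toCoTree K I p) (toCoTree K J q) := by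
  induction p using Finsupp.induction_linear with
  | zero => simp
  | add f g hf hg => simp only [map_add, LinearMap.add_apply, hf, hg]
  | single t a =>
    induction q using Finsupp.induction_linear with
    | zero => simp
    | add f g hf hg => simp only [map_add, hf, hg]
    | single s b =>
      rw [freeComp_single, toCoTree_single, toCoTree_single, toCoTree_single, CoTree.mk_subst,
        Finsupp.linearCombination_single, LinearMap.smul_apply, Finsupp.lmapDomain_apply,
        Finsupp.mapDomain_single, Finsupp.smul_single, smul_eq_mul]

theorem leftComb_eq_relabel (x y : X) (σ : Equiv.Perm (Fin 3)) :
    leftComb x y σ = (leftComb x y 1).relabel σ :=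
  (MTerm.relabel_relabel _ (1 : Equiv.Perm (Fin 3)) σ).symm

theorem rightComb_eq_relabel (x y : X) (σ : Equiv.Perm (Fin 3)) :
    rightComb x y σ = (rightComb x y 1).relabel σ :=
  (MTerm.relabel_relabel _ (1 : Equiv.Perm (Fin 3)) σ).symm

/-- The kernel is itself an ideal, because relabelling and composition factor through relations; it
contains the generators, because the two bracketings have the same relation. -/
theorem relIdeal_le_ker_toCoTree (I : Type) [Finite I] :
    relIdeal (twoAsRel K) I ≤ LinearMap.ker (toCoTree K I) := by
  refine relIdeal_le (fun I _ => LinearMap.ker (toCoTree K I)) ?_ ?_ ?_ ?_ I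
  · refine Submodule.span_le.2 ?_
    rintro _ ⟨x, σ, rfl⟩
    rw [SetLike.mem_coe, LinearMap.mem_ker, map_sub, toCoTree_single, toCoTree_single, sub_eq_zero]
    congr 1
    rw [leftComb_eq_relabel, rightComb_eq_relabel, CoTree.mk_relabel, CoTree.mk_relabel]
    congr 1
    rw [CoTree.mk_eq_mk]
    funext i j
    fin_cases i <;> fin_cases j <;> simp [MTerm.rel, leftComb, rightComb, MTerm.relabel,
      BinTerm.relabel, BinTerm.bind, BinTerm.rel, BinTerm.leaves]
  · intro I J _ _ f p hp
    rw [LinearMap.mem_ker] at hp ⊢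
    rw [toCoTree_freeMap, hp, map_zero]
  · intro I J _ _ i p q hp
    rw [LinearMap.mem_ker] at hp ⊢
    rw [toCoTree_freeComp, hp, map_zero, LinearMap.zero_apply]
  · intro I J _ _ i p q hq
    rw [LinearMap.mem_ker] at hq ⊢
    rw [toCoTree_freeComp, hq, map_zero]

theorem assocIn_twoAsRel : AssocIn (twoAsRel K) := fun x => Submodule.subset_span ⟨x, 1, rfl⟩

/-- The new inclusion is the normal form theorem: monomials with equal relations differ by an
element of the ideal. -/
theorem ker_toCoTree (I : Type) [Finite I] :
    LinearMap.ker (toCoTree K I) = relIdeal (twoAsRel K) I := by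
  refine le_antisymm (fun p hp => ?_) (relIdeal_le_ker_toCoTree I)
  refine mem_of_mapDomain_eq_zero (f := CoTree.mk) (fun t s h => ?_) hp
  exact relEquiv_of_rel_eq assocIn_twoAsRel t s (CoTree.mk_eq_mk.1 h)

variable (K) in
/-- The space `2as(I)` is spanned freely by the relations of monomials. -/
noncomputable def twoAsEquiv (I : Type) [Finite I] :
    (Free K TwoOp I ⧸ relIdeal (twoAsRel K) I) ≃ₗ[K] (CoTree TwoOp I →₀ K) :=
  (Submodule.quotEquivOfEq (M := Free K TwoOp I) (relIdeal (twoAsRel K) I)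
    (LinearMap.ker (toCoTree K I)) (ker_toCoTree I).symm).trans
    (LinearMap.quotKerEquivOfSurjective (M := Free K TwoOp I) (toCoTree K I)
      (Finsupp.mapDomain_surjective CoTree.mk_surjective))

variable (K) in
/-- The basis of `2as(I)` indexed by the relations of monomials. -/
noncomputable def twoAsBasis (I : Type) [Finite I] :
    Module.Basis (CoTree TwoOp I) K ((quadOperad (twoAsRel K)).obj I) :=
  .ofRepr (twoAsEquiv K I)

theorem twoAsBasis_mk [Finite I] (t : MTerm TwoOp I) :
    twoAsBasis K I (CoTree.mk t) = quadMk (twoAsRel K) t :=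
  (Module.Basis.apply_eq_iff (b := twoAsBasis K I)).2 (toCoTree_single (K := K) t 1)

theorem quadOperad_map_quadMk (R : Submodule K (Free K X (Fin 3))) [Finite I] {J : Type} [Finite J]
    (f : I ≃ J) (t : MTerm X I) :
    (quadOperad R).map f (quadMk R t) = quadMk R (t.relabel f) :=
  congrArg (Submodule.Quotient.mk (p := relIdeal R J)) (freeMap_single K f t 1)

theorem quadOperad_comp_quadMk (R : Submodule K (Free K X (Fin 3))) [Finite I] {J : Type} [Finite J]
    (i : I) (t : MTerm X I) (s : MTerm X J) :
    (quadOperad R).comp i (quadMk R t) (quadMk R s) = quadMk R (t.subst i s) :=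
  congrArg (Submodule.Quotient.mk (p := relIdeal R ({x : I // x ≠ i} ⊕ J)))
    ((freeComp_single K i t s 1 1).trans (by rw [mul_one]))

theorem twoAs_map [Finite I] {J : Type} [Finite J] (f : I ≃ J) (ρ : CoTree TwoOp I) :
    (quadOperad (twoAsRel K)).map f (twoAsBasis K I ρ) = twoAsBasis K J (ρ.map f) := by
  obtain ⟨t, rfl⟩ := CoTree.mk_surjective ρ
  rw [← CoTree.mk_relabel, twoAsBasis_mk, twoAsBasis_mk, quadOperad_map_quadMk]

/-- Basis elements compose without coefficients, so `2as` is the linearization of a set operad. This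
is what lets the complexes `D(2as)(n)` be split according to the total composite. -/
theorem twoAs_comp [Finite I] {J : Type} [Finite J] (i : I) (ρ : CoTree TwoOp I)
    (σ : CoTree TwoOp J) :
    (quadOperad (twoAsRel K)).comp i (twoAsBasis K I ρ) (twoAsBasis K J σ) =
      twoAsBasis K _ (ρ.comp i σ) := by
  obtain ⟨t, rfl⟩ := CoTree.mk_surjective ρ
  obtain ⟨s, rfl⟩ := CoTree.mk_surjective σ
  rw [← CoTree.mk_subst, twoAsBasis_mk, twoAsBasis_mk, twoAsBasis_mk, quadOperad_comp_quadMk]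

end Basis

end Operadic

namespace Operadic

/-! ## Restriction of relations -/

/-- Delete the leaves outside the image of `f`, and suppress each vertex one of whose sides becomes
empty. The last common vertices of the remaining leaves survive. -/
theorem CoTree.exists_restrict {X : Type} (I : Type) [Finite I] (t : MTerm X I) :
    ∀ (J : Type) [Nonempty J] (f : J → I), Function.Injective f →
      ∃ s : MTerm X J, ∀ a b, s.rel a b = t.rel (f a) (f b) := by
  classical
  refine MTerm.induction (C := fun I _ t => ∀ (J : Type) [Nonempty J] (f : J → I),
    Function.Injective f → ∃ s : MTerm X J, ∀ a b, s.rel a b = t.rel (f a) (f b)) ?_ ?_ ?_ I t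
  · intro I I' _ _ e t ih J _ f hf
    obtain ⟨s, hs⟩ := ih J (e.symm ∘ f) (e.symm.injective.comp hf)
    exact ⟨s, fun a b => by rw [hs, MTerm.rel_relabel]; rfl⟩
  · intro J _ f hf
    obtain ⟨j⟩ := ‹Nonempty J›
    have hj : ∀ a, a = j := fun a => hf rfl
    let e : Unit ≃ J := ⟨fun _ => j, fun _ => (), fun _ => rfl, fun a => (hj a).symm⟩
    refine ⟨MTerm.one.relabel e, fun a b => ?_⟩
    rw [hj a, hj b, MTerm.rel_self, MTerm.rel_self]
  · intro I I' _ _ x l r hl hr J _ f hf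
    by_cases h1 : ∃ a i, f a = Sum.inl i
    · by_cases h2 : ∃ b i', f b = Sum.inr i'
      · obtain ⟨a0, i0, h1⟩ := h1
        obtain ⟨b0, j0, h2⟩ := h2
        have : Nonempty {a // (f a).isLeft} := ⟨⟨a0, by rw [h1]; rfl⟩⟩
        have : Nonempty {a // ¬ (f a).isLeft} := ⟨⟨b0, by rw [h2]; simp⟩⟩
        have hg : ∀ a : {a // (f a).isLeft}, ∃ i, f a.1 = Sum.inl i := by
          rintro ⟨a, ha⟩; exact Sum.isLeft_iff.1 ha
        have hg' : ∀ a : {a // ¬ (f a).isLeft}, ∃ i, f a.1 = Sum.inr i := by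
          rintro ⟨a, ha⟩
          exact Sum.isRight_iff.1 (by simpa using ha)
        choose g hg using hg
        choose g' hg' using hg'
        obtain ⟨s, hs⟩ := hl _ g fun a b h => Subtype.ext (hf (by rw [hg, hg, h]))
        obtain ⟨s', hs'⟩ := hr _ g' fun a b h => Subtype.ext (hf (by rw [hg', hg', h]))
        refine ⟨(MTerm.node x s s').relabel (Equiv.sumCompl _), fun a b => ?_⟩
        obtain ⟨a | a, rfl⟩ := (Equiv.sumCompl fun a => ((f a).isLeft : Prop)).surjective a <;>
        obtain ⟨b | b, rfl⟩ := (Equiv.sumCompl fun a => ((f a).isLeft : Prop)).surjective b <;>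
        rw [MTerm.rel_relabel_apply] <;> simp [hg, hg', hs, hs']
      · have hg : ∀ a, ∃ i, f a = Sum.inl i := fun a => by
          rcases h : f a with i | i
          · exact ⟨i, rfl⟩
          · exact absurd ⟨a, i, h⟩ h2
        choose g hg using hg
        obtain ⟨s, hs⟩ := hl _ g fun a b h => hf (by rw [hg, hg, h])
        exact ⟨s, fun a b => by rw [hs, hg, hg, MTerm.rel_node_inl_inl]⟩
    · have hg : ∀ a, ∃ i, f a = Sum.inr i := fun a => by
        rcases h : f a with i | i
        · exact absurd ⟨a, i, h⟩ h1
        · exact ⟨i, rfl⟩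
      choose g hg using hg
      obtain ⟨s, hs⟩ := hr _ g fun a b h => hf (by rw [hg, hg, h])
      exact ⟨s, fun a b => by rw [hs, hg, hg, MTerm.rel_node_inr_inr]⟩

/-! ## Decorated trees -/

section Trees

variable {n : ℕ} {T : Finset (Finset (Fin n))} {u w c c' : Finset (Fin n)}

theorem IsTree.cells_nested (hT : IsTree T) (hc : IsCell T c) (hc' : IsCell T c') :
    c ⊆ c' ∨ c' ⊆ c ∨ Disjoint c c' := by
  rcases hc' with h | h
  · exact hT.cell_nested h hc
  · obtain ⟨a, rfl⟩ := Finset.card_eq_one.1 h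
    by_cases ha : a ∈ c
    · exact .inr (.inl (by simpa using ha))
    · exact .inr (.inr (by simpa using ha))

theorem IsTree.input_unique (hT : IsTree T) (h : IsInput T w c) (h' : IsInput T w c') {i : Fin n}
    (hi : i ∈ c) (hi' : i ∈ c') : c = c' := by
  by_contra hne
  rcases hT.cells_nested h.1 h'.1 with h1 | h1 | h1
  · exact h.2.2 c' h'.1 (lt_of_le_of_ne h1 hne) h'.2.1
  · exact h'.2.2 c h.1 (lt_of_le_of_ne h1 (Ne.symm hne)) h.2.1
  · exact Finset.disjoint_left.1 h1 hi hi'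

theorem IsTree.exists_input (hT : IsTree T) (hw : w ∈ T) {i : Fin n} (hi : i ∈ w) :
    ∃ c : Inputs T w, i ∈ c.1 := by
  classical
  have hne : (Finset.univ.filter fun c => IsCell T c ∧ i ∈ c ∧ c ⊂ w).Nonempty := by
    refine ⟨{i}, by
      simp only [Finset.mem_filter, Finset.mem_univ, true_and, Finset.mem_singleton]
      refine ⟨.inr (by simp), ?_⟩
      refine Finset.ssubset_iff_subset_ne.2 ⟨by simpa using hi, ?_⟩
      rintro rfl
      have := hT.two_le _ hw
      simp at this⟩
  obtain ⟨c, hc⟩ := Finset.exists_maximal hne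
  have h1 := hc.1
  simp only [Finset.mem_filter, Finset.mem_univ, true_and] at h1
  refine ⟨⟨c, h1.1, h1.2.2, fun c' h2 h3 h4 => ?_⟩, h1.2.1⟩
  exact h3.2 (hc.2 (by simpa using ⟨h2, h3.1 h1.2.1, h4⟩) h3.1)

theorem IsTree.exists_parent (hT : IsTree T) (hu : u ∈ T) (hne : u ≠ Finset.univ) :
    ∃ w ∈ T, IsInput T w u := by
  classical
  have hne : (T.filter fun w => u ⊂ w).Nonempty :=
    ⟨Finset.univ, by simpa [hT.univ_mem] using Finset.ssubset_univ_iff.2 hne⟩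
  obtain ⟨w, hw⟩ := Finset.exists_minimal hne
  have h1 := Finset.mem_filter.1 hw.1
  refine ⟨w, h1.1, .inl hu, h1.2, fun c' h2 h3 h4 => ?_⟩
  have hc' : c' ∈ T := h2.resolve_right fun h => by
    have := Finset.card_lt_card h3
    have := hT.two_le u hu
    omega
  exact h4.2 (hw.2 (Finset.mem_filter.2 ⟨hc', h3⟩) h4.1)

/-- Take the smallest vertex containing both leaves; if they lay in the same input, that input would
be a smaller such vertex. -/
theorem IsTree.exists_last_common (hT : IsTree T) {i j : Fin n} (hij : i ≠ j) :
    ∃ (v : {v // v ∈ T}) (c c' : Inputs T v.1), c ≠ c' ∧ i ∈ c.1 ∧ j ∈ c'.1 := by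
  classical
  have hne : (T.filter fun w => i ∈ w ∧ j ∈ w).Nonempty := ⟨Finset.univ, by simp [hT.univ_mem]⟩
  obtain ⟨w, hw⟩ := Finset.exists_minimal hne
  have h1 := Finset.mem_filter.1 hw.1
  obtain ⟨c, hc⟩ := hT.exists_input h1.1 h1.2.1
  obtain ⟨c', hc'⟩ := hT.exists_input h1.1 h1.2.2
  refine ⟨⟨w, h1.1⟩, c, c', ?_, hc, hc'⟩
  rintro rfl
  have hcT : c.1 ∈ T := c.2.1.resolve_right fun h => by
    obtain ⟨a, ha⟩ := Finset.card_eq_one.1 h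
    rw [ha, Finset.mem_singleton] at hc hc'
    exact hij (hc.trans hc'.symm)
  exact c.2.2.1.2 (hw.2 (Finset.mem_filter.2 ⟨hcT, hc, hc'⟩) c.2.2.1.1)

variable {X : Type}

/-- All the elements of `v` are in the same relation to each point outside `v`. -/
def LeafRel.IsModule {I : Type} (ρ : LeafRel X I) (v : Set I) : Prop :=
  ∀ k ∉ v, ∀ i ∈ v, ∀ j ∈ v, ρ k i = ρ k j ∧ ρ i k = ρ j k

/-- The relation `ρ` is the composite of the relations `x v` decorating the vertices of a tree. -/
def IsComposite (x : ∀ v : {v // v ∈ T}, CoTree X (Inputs T v.1)) (ρ : CoTree X (Fin n)) : Prop :=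
  ∀ (v : {v // v ∈ T}) (c c' : Inputs T v.1), c ≠ c' → ∀ i ∈ c.1, ∀ j ∈ c'.1,
    ρ.1 i j = (x v).1 c c'

theorem IsComposite.unique (hT : IsTree T) {x : ∀ v : {v // v ∈ T}, CoTree X (Inputs T v.1)}
    {ρ ρ' : CoTree X (Fin n)} (h : IsComposite x ρ) (h' : IsComposite x ρ') : ρ = ρ' := by
  refine Subtype.ext (funext fun i => funext fun j => ?_)
  by_cases hij : i = j
  · rw [hij, ρ.rel_self, ρ'.rel_self]
  · obtain ⟨v, c, c', hne, hi, hj⟩ := hT.exists_last_common hij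
    rw [h v c c' hne i hi j hj, h' v c c' hne i hi j hj]

/-- Each value of a decoration is visible on `ρ`, at any two leaves chosen above the two inputs. So
a tree and a total composite leave no freedom in the decoration. -/
theorem IsComposite.decoration_unique (hT : IsTree T)
    {x x' : ∀ v : {v // v ∈ T}, CoTree X (Inputs T v.1)}
    {ρ : CoTree X (Fin n)} (h : IsComposite x ρ) (h' : IsComposite x' ρ) : x = x' := by
  refine funext fun v => Subtype.ext (funext fun c => funext fun c' => ?_)
  by_cases hne : c = c'
  · rw [hne, (x v).rel_self, (x' v).rel_self]
  · obtain ⟨i, hi⟩ := hT.cell_nonempty c.2.1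
    obtain ⟨j, hj⟩ := hT.cell_nonempty c'.2.1
    rw [← h v c c' hne i hi j hj, ← h' v c c' hne i hi j hj]

/-- A leaf outside `w` separates from the leaves of `w` at a vertex having all of `w` inside one
input, so it cannot tell them apart. -/
theorem IsComposite.isModule (hT : IsTree T)
    {x : ∀ v : {v // v ∈ T}, CoTree X (Inputs T v.1)} {ρ : CoTree X (Fin n)}
    (h : IsComposite x ρ) (hw : w ∈ T) : ρ.1.IsModule (w : Set (Fin n)) := by
  intro k hk i hi j hj
  have hki : k ≠ i := fun e => hk (e ▸ hi)
  obtain ⟨v, c, c', hne, hkc, hic⟩ := hT.exists_last_common hki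
  have hjc : j ∈ c'.1 := by
    rcases hT.cell_nested hw c'.2.1 with h1 | h1 | h1
    · by_cases he : c'.1 = w
      · rw [he]; exact hj
      · exfalso
        rcases hT.nested v.1 v.2 w hw with h2 | h2 | h2
        · exact hk (h2 (c.2.2.1.1 hkc))
        · refine c'.2.2.2 w (.inl hw) (lt_of_le_of_ne h1 he) (lt_of_le_of_ne h2 ?_)
          intro e; exact hk (e ▸ c.2.2.1.1 hkc)
        · exact Finset.disjoint_left.1 h2 (c'.2.2.1.1 hic) hi
    · exact h1 hj
    · exact absurd hi (Finset.disjoint_left.1 h1 hic)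
  exact ⟨by rw [h v c c' hne k hkc i hic, h v c c' hne k hkc j hjc],
    by rw [h v c' c hne.symm i hic k hkc, h v c' c hne.symm j hjc k hkc]⟩

/-- Decorate each vertex by the restriction of `ρ` to one representative leaf per input. The modules
make the choice of representatives immaterial. -/
theorem exists_decoration (hT : IsTree T) {ρ : CoTree X (Fin n)}
    (h : ∀ w ∈ T, ρ.1.IsModule (w : Set (Fin n))) :
    ∃ x : ∀ v : {v // v ∈ T}, CoTree X (Inputs T v.1), IsComposite x ρ := by
  have hrep : ∀ (v : {v // v ∈ T}) (c : Inputs T v.1), ∃ i, i ∈ c.1 := fun v c =>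
    hT.cell_nonempty c.2.1
  choose rep hrep using hrep
  have hinj : ∀ v, Function.Injective (rep v) := fun v c c' e => Subtype.ext
    (hT.input_unique c.2 c'.2 (hrep v c) (e ▸ hrep v c'))
  obtain ⟨t, ht⟩ := CoTree.mk_surjective ρ
  have hx : ∀ v : {v // v ∈ T}, ∃ s : MTerm X (Inputs T v.1), ∀ a b,
      s.rel a b = t.rel (rep v a) (rep v b) := fun v => by
    have : Nonempty (Inputs T v.1) := by
      obtain ⟨i, hi⟩ := hT.cell_nonempty (.inl v.2)
      exact ⟨(hT.exists_input v.2 hi).choose⟩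
    exact CoTree.exists_restrict _ t _ (rep v) (hinj v)
  choose s hs using hx
  refine ⟨fun v => CoTree.mk (s v), fun v c c' hne i hi j hj => ?_⟩
  have hmod : ∀ (c c' : Inputs T v.1), c ≠ c' → ∀ i ∈ c.1, ∀ j ∈ c.1, ∀ k ∈ c'.1,
      ρ.1 i k = ρ.1 j k ∧ ρ.1 k i = ρ.1 k j := fun c c' hne i hi j hj k hk => by
    have hkc : k ∉ c.1 := fun hkc => hne (Subtype.ext (hT.input_unique c.2 c'.2 hkc hk))
    rcases c.2.1 with h1 | h1
    · exact ⟨(h _ h1 k hkc i hi j hj).2, (h _ h1 k hkc i hi j hj).1⟩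
    · obtain ⟨a, ha⟩ := Finset.card_eq_one.1 h1
      rw [ha, Finset.mem_singleton] at hi hj
      rw [hi, hj]; exact ⟨rfl, rfl⟩
  rw [(hmod c c' hne i hi _ (hrep v c) j hj).1,
    (hmod c' c hne.symm j hj _ (hrep v c') _ (hrep v c)).2, ← ht]
  exact (hs v c c').symm

open Classical in
/-- Contraction of an internal edge of a tree decorated with relations. -/
noncomputable def contractRel (hT : IsTree T) (hu : u ∈ T)
    (x : ∀ v : {v // v ∈ T}, CoTree X (Inputs T v.1)) (v : {v // v ∈ T.erase u}) :
    CoTree X (Inputs (T.erase u) v.1) :=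
  if h : IsInput T v.1 u then
    ((x ⟨v.1, Finset.mem_of_mem_erase v.2⟩).comp ⟨u, h⟩ (x ⟨u, hu⟩)).map (contractEquiv hT hu h)
  else (x ⟨v.1, Finset.mem_of_mem_erase v.2⟩).map (keepEquiv hT hu h)

theorem contractRel_of_isInput (hT : IsTree T) (hu : u ∈ T)
    (x : ∀ v : {v // v ∈ T}, CoTree X (Inputs T v.1)) (v : {v // v ∈ T.erase u})
    (h : IsInput T v.1 u) (a b : {x : Inputs T v.1 // x ≠ ⟨u, h⟩} ⊕ Inputs T u) :
    (contractRel hT hu x v).1 (contractEquiv hT hu h a) (contractEquiv hT hu h b) =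
      ((x ⟨v.1, Finset.mem_of_mem_erase v.2⟩).1.comp ⟨u, h⟩ (x ⟨u, hu⟩).1) a b := by
  rw [contractRel, dif_pos h]
  simp only [CoTree.map, LeafRel.map, Equiv.symm_apply_apply, CoTree.comp]

theorem contractRel_of_not_isInput (hT : IsTree T) (hu : u ∈ T)
    (x : ∀ v : {v // v ∈ T}, CoTree X (Inputs T v.1)) (v : {v // v ∈ T.erase u})
    (h : ¬ IsInput T v.1 u) (a b : Inputs T v.1) :
    (contractRel hT hu x v).1 (keepEquiv hT hu h a) (keepEquiv hT hu h b) =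
      (x ⟨v.1, Finset.mem_of_mem_erase v.2⟩).1 a b := by
  rw [contractRel, dif_neg h]
  simp only [CoTree.map, LeafRel.map, Equiv.symm_apply_apply]

/-- Leaves separating at a vertex other than `u` still separate there, and those separating at `u`
now separate at `w`; in both cases the composed decoration takes the old value. -/
theorem isComposite_contractRel_iff (hT : IsTree T) (hu : u ∈ T) (hw : w ∈ T) (hwu : IsInput T w u)
    (x : ∀ v : {v // v ∈ T}, CoTree X (Inputs T v.1)) (ρ : CoTree X (Fin n)) :
    IsComposite (contractRel hT hu x) ρ ↔ IsComposite x ρ := by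
  constructor
  · intro H v c c' hne i hi j hj
    by_cases hvu : v.1 = u
    · obtain ⟨v, hv⟩ := v
      subst hvu
      let w' : {z // z ∈ T.erase v} := ⟨w, Finset.mem_erase.2 ⟨hwu.2.1.ne', hw⟩⟩
      have := H w' (contractEquiv hT hv hwu (.inr c)) (contractEquiv hT hv hwu (.inr c'))
        (fun e => hne (by simpa using e)) i hi j hj
      rw [this, contractRel_of_isInput hT hv x w' hwu]
      rfl
    · let v' : {z // z ∈ T.erase u} := ⟨v.1, Finset.mem_erase.2 ⟨hvu, v.2⟩⟩
      by_cases h : IsInput T v.1 u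
      -- The new input of `v` containing a leaf of `c` is `c` itself, except when `c` is the
      -- contracted vertex; then it is one of the inputs of `u`.
      · have key : ∀ (c : Inputs T v.1) (i : Fin n), i ∈ c.1 →
            ∃ a : {x : Inputs T v.1 // x ≠ ⟨u, h⟩} ⊕ Inputs T u,
              i ∈ (contractEquiv hT hu h a).1 ∧
              ((∃ hc : c ≠ ⟨u, h⟩, a = .inl ⟨c, hc⟩) ∨ (c = ⟨u, h⟩ ∧ ∃ d, a = .inr d)) := by
          intro c i hi
          by_cases hc : c = ⟨u, h⟩
          · obtain ⟨d, hd⟩ := hT.exists_input hu (i := i) (by rw [hc] at hi; exact hi)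
            exact ⟨.inr d, hd, .inr ⟨hc, d, rfl⟩⟩
          · exact ⟨.inl ⟨c, hc⟩, hi, .inl ⟨hc, rfl⟩⟩
        obtain ⟨a, ha, ha'⟩ := key c i hi
        obtain ⟨b, hb, hb'⟩ := key c' j hj
        have hab : a ≠ b := by
          rcases ha' with ⟨h1, rfl⟩ | ⟨h1, d, rfl⟩ <;> rcases hb' with ⟨h2, rfl⟩ | ⟨h2, e, rfl⟩
          · simpa using hne
          · simp
          · simp
          · exact absurd (h1.trans h2.symm) hne
        rw [H v' _ _ ((contractEquiv hT hu h).injective.ne hab) i ha j hb,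
          contractRel_of_isInput hT hu x v' h]
        rcases ha' with ⟨h1, rfl⟩ | ⟨h1, d, rfl⟩ <;> rcases hb' with ⟨h2, rfl⟩ | ⟨h2, e, rfl⟩
        · rfl
        · rw [h2]; rfl
        · rw [h1]; rfl
        · exact absurd (h1.trans h2.symm) hne
      · rw [H v' (keepEquiv hT hu h c) (keepEquiv hT hu h c')
          ((keepEquiv hT hu h).injective.ne hne) i hi j hj, contractRel_of_not_isInput hT hu x v' h]
  · intro H v c c' hne i hi j hj
    by_cases h : IsInput T v.1 u
    · obtain ⟨a, rfl⟩ := (contractEquiv hT hu h).surjective c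
      obtain ⟨b, rfl⟩ := (contractEquiv hT hu h).surjective c'
      rw [contractRel_of_isInput hT hu x v h]
      rcases a with a | a <;> rcases b with b | b
      · exact H ⟨v.1, Finset.mem_of_mem_erase v.2⟩ a.1 b.1
          (fun e => hne (by rw [Subtype.ext e])) i hi j hj
      · exact H ⟨v.1, Finset.mem_of_mem_erase v.2⟩ a.1 ⟨u, h⟩ a.2 i hi j (b.2.2.1.1 hj)
      · exact H ⟨v.1, Finset.mem_of_mem_erase v.2⟩ ⟨u, h⟩ b.1 b.2.symm i (a.2.2.1.1 hi) j hj
      · exact H ⟨u, hu⟩ a b (fun e => hne (by rw [e])) i hi j hj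
    · obtain ⟨a, rfl⟩ := (keepEquiv hT hu h).surjective c
      obtain ⟨b, rfl⟩ := (keepEquiv hT hu h).surjective c'
      rw [contractRel_of_not_isInput hT hu x v h]
      exact H ⟨v.1, Finset.mem_of_mem_erase v.2⟩ a b (fun e => hne (by rw [e])) i hi j hj

/-- Contract edges until only the root remains. Its inputs are then the single leaves, and its
decoration is a relation on `Fin n`. -/
theorem exists_composite (hT : IsTree T) (x : ∀ v : {v // v ∈ T}, CoTree X (Inputs T v.1)) :
    ∃ ρ : CoTree X (Fin n), IsComposite x ρ := by
  obtain ⟨N, hN⟩ : ∃ N, T.card = N := ⟨_, rfl⟩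
  induction N generalizing T with
  | zero => exact absurd hT.univ_mem (by rw [Finset.card_eq_zero.1 hN]; simp)
  | succ N ih =>
    by_cases hex : ∃ u ∈ T, u ≠ Finset.univ
    · obtain ⟨u, hu, hne⟩ := hex
      obtain ⟨w, hw, h⟩ := hT.exists_parent hu hne
      obtain ⟨ρ, hρ⟩ := ih (hT.erase h) (contractRel hT hu x) (by
        rw [Finset.card_erase_of_mem hu, hN, Nat.add_sub_cancel])
      exact ⟨ρ, (isComposite_contractRel_iff hT hu hw h x ρ).1 hρ⟩
    · push Not at hex
      have hcard : ∀ c : Inputs T Finset.univ, c.1.card = 1 := fun c =>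
        c.2.1.resolve_left fun h => c.2.2.1.ne (hex _ h)
      choose f hf using fun c : Inputs T Finset.univ => Finset.card_eq_one.1 (hcard c)
      let e : Inputs T Finset.univ ≃ Fin n := Equiv.ofBijective f
        ⟨fun c c' h => Subtype.ext (by rw [hf, hf, h]), fun i => by
          obtain ⟨c, hc⟩ := hT.exists_input hT.univ_mem (Finset.mem_univ i)
          rw [hf, Finset.mem_singleton] at hc
          exact ⟨c, hc.symm⟩⟩
      refine ⟨(x ⟨_, hT.univ_mem⟩).map e, fun v c c' hne i hi j hj => ?_⟩
      obtain ⟨v, hv⟩ := v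
      obtain rfl := hex v hv
      rw [hf, Finset.mem_singleton] at hi hj
      have hi' : e.symm i = c := by rw [hi]; exact e.symm_apply_apply c
      have hj' : e.symm j = c' := by rw [hj]; exact e.symm_apply_apply c'
      simp only [CoTree.map, LeafRel.map, hi', hj']

end Trees

end Operadic

namespace Operadic

/-! ## Simplicial cochains and cone-like homotopies -/

section Cochains

variable {K : Type u} [Field K] {V L : Type} [DecidableEq V] [LinearOrder L] (κ : V → L)

/-- The sign of the removal of `v` from `T`, when `T` is ordered by `κ`. -/
def eraseSign (v : V) (T : Finset V) : K := (-1) ^ (T.filter fun w => κ w < κ v).card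

/-- The simplicial coboundary, on functions on finite sets, where the point `r` is never removed. -/
def coboundary (r : V) (φ : Finset V → K) (T : Finset V) : K :=
  ∑ v ∈ T.erase r, eraseSign κ v T * φ (T.erase v)

variable {κ}

set_option linter.unusedSectionVars false in
theorem eraseSign_mul_self (v : V) (T : Finset V) :
    (eraseSign κ v T : K) * eraseSign κ v T = 1 := by
  rw [eraseSign, ← pow_add, ← two_mul, pow_mul]; simp

theorem eraseSign_erase {v w : V} {T : Finset V} (hw : w ∈ T) :
    (eraseSign κ v T : K) = (if κ w < κ v then -1 else 1) * eraseSign κ v (T.erase w) := by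
  rw [eraseSign, eraseSign, Finset.filter_erase]
  split_ifs with h
  · rw [Finset.card_erase_of_mem (Finset.mem_filter.2 ⟨hw, h⟩), ← pow_succ', Nat.sub_add_cancel]
    exact Finset.card_pos.2 ⟨w, Finset.mem_filter.2 ⟨hw, h⟩⟩
  · have hn : w ∉ T.filter fun z => κ z < κ v := fun h' => h (Finset.mem_filter.1 h').2
    rw [Finset.erase_eq_of_notMem hn, one_mul]

theorem eraseSign_mul_eraseSign (hκ : Function.Injective κ) {v w : V} {T : Finset V} (hv : v ∈ T)
    (hw : w ∈ T) (hvw : v ≠ w) :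
    (eraseSign κ v T : K) * eraseSign κ w T =
      -(eraseSign κ v (T.erase w) * eraseSign κ w (T.erase v)) := by
  rw [eraseSign_erase (v := v) hw, eraseSign_erase (v := w) hv]
  rcases lt_or_gt_of_ne (hκ.ne hvw) with h | h <;> simp [h, h.not_gt]

theorem eraseSign_mul_eraseSign_erase (hκ : Function.Injective κ) {v w : V} {T : Finset V}
    (hv : v ∈ T) (hw : w ∈ T) (hvw : v ≠ w) :
    (eraseSign κ v T : K) * eraseSign κ w (T.erase v) =
      -(eraseSign κ w T * eraseSign κ v (T.erase w)) := by
  rw [eraseSign_erase (v := v) hw, eraseSign_erase (v := w) hv]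
  rcases lt_or_gt_of_ne (hκ.ne hvw) with h | h <;> simp [h, h.not_gt, mul_comm]

/-- Removing two points in either order gives the same set with opposite signs. -/
theorem coboundary_coboundary (hκ : Function.Injective κ) (r : V) (φ : Finset V → K)
    (T : Finset V) : coboundary κ r (coboundary κ r φ) T = 0 := by
  simp only [coboundary, Finset.mul_sum]
  rw [Finset.sum_sigma']
  refine Finset.sum_involution (fun p _ => ⟨p.2, p.1⟩) ?_ ?_ ?_ ?_
  · rintro ⟨v, w⟩ h
    simp only [Finset.mem_sigma, Finset.mem_erase] at h
    rw [← mul_assoc, ← mul_assoc, eraseSign_mul_eraseSign_erase hκ h.1.2 h.2.2.2 h.2.2.1.symm,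
      Finset.erase_right_comm]
    ring
  · rintro ⟨v, w⟩ h _ e
    simp only [Finset.mem_sigma, Finset.mem_erase] at h
    exact h.2.2.1 (congrArg Sigma.fst e)
  · rintro ⟨v, w⟩ h
    simp only [Finset.mem_sigma, Finset.mem_erase] at h ⊢
    exact ⟨⟨h.2.1, h.2.2.2⟩, h.1.1, h.2.2.1.symm, h.1.2⟩
  · rintro ⟨v, w⟩ h
    rfl

variable (κ) in
/-- The operator which adds to `T` the point `c T`. -/
def coneOp (c : Finset V → V) (φ : Finset V → K) (T : Finset V) : K :=
  if c T ∈ T then 0 else eraseSign κ (c T) (insert (c T) T) * φ (insert (c T) T)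

/-- Data for the proof that the cochain complex of a family `F` of finite sets is exact at the sets
with `k + 1` elements: the point `c T` may be added to or removed from the sets `T` of the family
`G`, and the removal of a point from `T` either does not change `c T`, or decreases `f`. -/
structure IsConeLike (r : V) (F G : Set (Finset V)) (c : Finset V → V) (f : Finset V → ℕ)
    (k : ℕ) : Prop where
  mem : ∀ T ∈ F, T.card = k + 1 → T ∈ G
  erase_mem : ∀ T ∈ F, ∀ v ∈ T, v ≠ r → T.erase v ∈ F
  erase_mem' : ∀ T ∈ G, ∀ v ∈ T, v ≠ r → T.erase v ∈ G
  insert_mem : ∀ T ∈ G, insert (c T) T ∈ F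
  ne_root : ∀ T ∈ G, c T ≠ r
  le_card : ∀ T ∈ F, f T ≤ T.card
  insert_eq : ∀ T ∈ G, f (insert (c T) T) = f T
  erase : ∀ T ∈ G, ∀ v ∈ T, v ≠ r → c (T.erase v) = c T ∨
    (v ≠ c T ∧ f (T.erase v) < f T ∧ f ((insert (c T) T).erase v) < f T)

variable {r : V} {F G : Set (Finset V)} {c : Finset V → V} {f : Finset V → ℕ} {k : ℕ}

/-- For a constant cone point this is the contracting homotopy of a cone, applied to a cocycle. When
removing `v` moves the cone point, the unwanted terms are values of `φ` at sets where `f` is smaller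
than `f T`, and these vanish by `hlow`. -/
theorem IsConeLike.coboundary_coneOp (hκ : Function.Injective κ) (h : IsConeLike r F G c f k)
    {φ : Finset V → K} (hφ : ∀ T ∈ F, T.card = k + 2 → coboundary κ r φ T = 0) {T : Finset V}
    (hT : T ∈ F) (hk : T.card = k + 1)
    (hlow : ∀ S ∈ F, S.card = k + 1 → f S < f T → φ S = 0) :
    coboundary κ r (coneOp κ c φ) T = φ T := by
  have hG := h.mem T hT hk
  have hbad : ∀ v ∈ T, v ≠ r → f (T.erase v) < f T → coneOp κ c φ (T.erase v) = 0 := by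
    intro v hv hvr hlt
    rw [coneOp]
    split_ifs with hc
    · rfl
    · have hG' := h.erase_mem' T hG v hv hvr
      rw [hlow _ (h.insert_mem _ hG') (by
        rw [Finset.card_insert_of_notMem hc, Finset.card_erase_of_mem hv, hk]; rfl)
        (by rwa [h.insert_eq _ hG']), mul_zero]
  -- If the cone point lies in `T`, only its own removal contributes: any other face either still
  -- contains its cone point or is covered by `hbad`.
  by_cases hc : c T ∈ T
  · rw [coboundary, Finset.sum_eq_single (c T)]
    · have hcT : c (T.erase (c T)) = c T := by
        rcases h.erase T hG _ hc (h.ne_root T hG) with h1 | h1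
        · exact h1
        · exact absurd rfl h1.1
      rw [coneOp, hcT, if_neg (Finset.notMem_erase _ _), Finset.insert_erase hc, ← mul_assoc,
        eraseSign_mul_self, one_mul]
    · intro v hv hvc
      obtain ⟨hvr, hv⟩ := Finset.mem_erase.1 hv
      rcases h.erase T hG v hv hvr with h1 | h1
      · rw [coneOp, h1, if_pos (Finset.mem_erase.2 ⟨hvc.symm, hc⟩), mul_zero]
      · rw [hbad v hv hvr h1.2.1, mul_zero]
    · intro h1
      exact absurd (Finset.mem_erase.2 ⟨h.ne_root T hG, hc⟩) h1
  · have hins := h.insert_mem T hG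
    have hcard : (insert (c T) T).card = k + 2 := by rw [Finset.card_insert_of_notMem hc, hk]
    have h0 := hφ _ hins hcard
    rw [coboundary, Finset.erase_insert_of_ne (h.ne_root T hG),
      Finset.sum_insert (fun h' => hc (Finset.mem_of_mem_erase h')), Finset.erase_insert hc] at h0
    have hterm : ∀ v ∈ T.erase r, (eraseSign κ v T : K) * coneOp κ c φ (T.erase v) =
        -(eraseSign κ (c T) (insert (c T) T)) *
          (eraseSign κ v (insert (c T) T) * φ ((insert (c T) T).erase v)) := by
      intro v hv
      obtain ⟨hvr, hv⟩ := Finset.mem_erase.1 hv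
      have hvc : v ≠ c T := fun e => hc (e ▸ hv)
      rcases h.erase T hG v hv hvr with h1 | h1
      · rw [coneOp, h1, if_neg (fun h' => hc (Finset.mem_of_mem_erase h')),
          ← Finset.erase_insert_of_ne hvc.symm, ← mul_assoc, ← mul_assoc, neg_mul,
          eraseSign_mul_eraseSign hκ (Finset.mem_insert_self _ _) (Finset.mem_insert_of_mem hv)
            hvc.symm, Finset.erase_insert hc, neg_neg, mul_comm (eraseSign κ v T)]
      · rw [hbad v hv hvr h1.2.1, hlow _ (h.erase_mem _ hins v (Finset.mem_insert_of_mem hv) hvr)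
          (by rw [Finset.card_erase_of_mem (Finset.mem_insert_of_mem hv), hcard]; rfl) h1.2.2]
        ring
    rw [coboundary, Finset.sum_congr rfl hterm, ← Finset.mul_sum, neg_mul, ← mul_neg,
      ← eq_neg_of_add_eq_zero_left h0, ← mul_assoc, eraseSign_mul_self, one_mul]

/-- The cochain complex of a cone-like family is exact. -/
theorem IsConeLike.exists_primitive (hκ : Function.Injective κ) (h : IsConeLike r F G c f k)
    {φ : Finset V → K} (hφ : ∀ T ∈ F, T.card = k + 2 → coboundary κ r φ T = 0) :
    ∃ ψ : Finset V → K, ∀ T ∈ F, T.card = k + 1 → φ T = coboundary κ r ψ T := by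
  -- Here `φ` is assumed to vanish where `f T + j ≤ k + 1`. This is vacuous for `j = k + 2`, and for
  -- `j = 0` it gives `φ = 0` in the relevant size since `f T ≤ T.card`. Subtracting the coboundary
  -- of `coneOp κ c φ` gains one step.
  suffices H : ∀ (j : ℕ) (φ : Finset V → K),
      (∀ T ∈ F, T.card = k + 2 → coboundary κ r φ T = 0) →
      (∀ T ∈ F, T.card = k + 1 → f T + j ≤ k + 1 → φ T = 0) →
      ∃ ψ : Finset V → K, ∀ T ∈ F, T.card = k + 1 → φ T = coboundary κ r ψ T from
    H (k + 2) φ hφ fun T _ _ h' => by omega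
  intro j
  induction j with
  | zero =>
    intro φ _ h0
    refine ⟨0, fun T hT hk => ?_⟩
    rw [h0 T hT hk (by have := h.le_card T hT; omega)]
    simp [coboundary]
  | succ j ih =>
    intro φ hφ h0
    have hsub : ∀ φ ψ : Finset V → K, coboundary κ r (φ - ψ) = coboundary κ r φ - coboundary κ r ψ :=
      fun φ ψ => funext fun T => by
        simp only [coboundary, Pi.sub_apply, mul_sub, Finset.sum_sub_distrib]
    obtain ⟨ψ, hψ⟩ := ih (φ - coboundary κ r (coneOp κ c φ)) (fun T hT hk => by
        rw [hsub, Pi.sub_apply, hφ T hT hk, coboundary_coboundary hκ, sub_zero])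
      (fun T hT hk hj => by
        rw [Pi.sub_apply, h.coboundary_coneOp hκ hφ hT hk
          fun S hS hSk hlt => h0 S hS hSk (by omega), sub_self])
    refine ⟨ψ + coneOp κ c φ, fun T hT hk => ?_⟩
    have h1 := hψ T hT hk
    have h2 := congrFun (hsub (ψ + coneOp κ c φ) (coneOp κ c φ)) T
    rw [add_sub_cancel_right, ← h1, Pi.sub_apply, Pi.sub_apply] at h2
    exact sub_left_injective h2

end Cochains

end Operadic

namespace Operadic

/-! ## Strong modules and last points of the relations of monomials -/

namespace LeafRel

variable {X I J : Type}

/-- The set `u` is cut in two parts, related by the operation `x`. -/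
def HasCut (x : X) (ρ : LeafRel X I) (u : Set I) : Prop :=
  ∃ A : Set I, (u ∩ A).Nonempty ∧ (u \ A).Nonempty ∧ ∀ i ∈ u ∩ A, ∀ j ∈ u \ A,
    (∃ b, ρ i j = some (x, b)) ∧ ∃ b, ρ j i = some (x, b)

/-- There is a last point, related to all the other ones by the operation `x`. -/
def HasLast (x : X) (ρ : LeafRel X I) : Prop :=
  ∃ m, ∀ i, i ≠ m → ρ m i = some (x, false) ∧ ρ i m = some (x, true)

/-- There are a product `u` for an operation `y`, and a product of `u` and `w` for another operation
`x`. -/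
def HasAlternation (ρ : LeafRel X I) : Prop :=
  ∃ (u w : Set I) (x y : X), x ≠ y ∧ ρ.IsModule u ∧ ρ.IsModule (u ∪ w) ∧ Disjoint u w ∧
    w.Nonempty ∧ (∀ i ∈ u, ∀ k ∈ w, (∃ b, ρ i k = some (x, b)) ∧ ∃ b, ρ k i = some (x, b)) ∧
    ρ.HasCut y u

variable {ρ : LeafRel X I} {σ : LeafRel X J} {f : J → I}

theorem IsModule.image (h : ∀ a b, ρ (f a) (f b) = σ a b) (hf : ρ.IsModule (Set.range f))
    {u : Set J} (hu : σ.IsModule u) : ρ.IsModule (f '' u) := by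
  rintro k hk _ ⟨a, ha, rfl⟩ _ ⟨b, hb, rfl⟩
  by_cases hk' : k ∈ Set.range f
  · obtain ⟨k, rfl⟩ := hk'
    rw [h, h, h, h]
    exact hu k (fun h' => hk ⟨k, h', rfl⟩) a ha b hb
  · exact hf k hk' _ ⟨a, rfl⟩ _ ⟨b, rfl⟩

theorem HasCut.image (h : ∀ a b, ρ (f a) (f b) = σ a b) (hf : Function.Injective f) {x : X}
    {u : Set J} (hu : σ.HasCut x u) : ρ.HasCut x (f '' u) := by
  obtain ⟨A, ⟨a, ha⟩, ⟨b, hb⟩, hc⟩ := hu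
  refine ⟨f '' A, ⟨f a, ⟨a, ha.1, rfl⟩, a, ha.2, rfl⟩, ⟨f b, ⟨b, hb.1, rfl⟩, ?_⟩, ?_⟩
  · rintro ⟨a, ha, e⟩; exact hb.2 (hf e ▸ ha)
  · rintro _ ⟨⟨i, hi, rfl⟩, i', hi', e⟩ _ ⟨⟨j, hj, rfl⟩, hj'⟩
    rw [h, h]
    exact hc i ⟨hi, hf e ▸ hi'⟩ j ⟨hj, fun h' => hj' ⟨j, h', rfl⟩⟩

theorem HasAlternation.image (h : ∀ a b, ρ (f a) (f b) = σ a b) (hf : Function.Injective f)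
    (hmod : ρ.IsModule (Set.range f)) (hσ : σ.HasAlternation) : ρ.HasAlternation := by
  obtain ⟨u, w, x, y, hxy, hu, huw, hd, hw, hc, hcut⟩ := hσ
  refine ⟨f '' u, f '' w, x, y, hxy, IsModule.image h hmod hu, ?_, (Set.disjoint_image_iff hf).2 hd,
    hw.image f, ?_, hcut.image h hf⟩
  · rw [← Set.image_union]; exact IsModule.image h hmod huw
  · rintro _ ⟨i, hi, rfl⟩ _ ⟨k, hk, rfl⟩
    rw [h, h]; exact hc i hi k hk

theorem isModule_univ (ρ : LeafRel X I) : ρ.IsModule Set.univ := fun _ hk => absurd trivial hk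

/-- A product for `y` which is a factor of a product for `x ≠ y` does not overlap any module. -/
theorem HasAlternation.exists_strong (h : ρ.HasAlternation) :
    ∃ u : Set I, u.Nontrivial ∧ u ≠ Set.univ ∧ ρ.IsModule u ∧
      ∀ v, ρ.IsModule v → v ⊆ u ∨ u ⊆ v ∨ Disjoint v u := by
  obtain ⟨u, w, x, y, hxy, hu, huw, hd, ⟨k, hk⟩, hc, hcut⟩ := h
  refine ⟨u, ?_, ?_, hu, fun v hv => ?_⟩
  · obtain ⟨A, ⟨a, ha⟩, ⟨b, hb⟩, -⟩ := hcut
    exact ⟨a, ha.1, b, hb.1, fun e => hb.2 (e ▸ ha.2)⟩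
  · rintro rfl
    exact Set.disjoint_left.1 hd trivial hk
  · by_contra! hne
    obtain ⟨h1, h2, h3⟩ := hne
    obtain ⟨z, hzv, hzu⟩ := Set.not_subset.1 h1
    obtain ⟨a, hau, hav⟩ := Set.not_subset.1 h2
    obtain ⟨i, hiv, hiu⟩ := Set.not_disjoint_iff.1 h3
    -- As `u` and `v` are overlapping modules, `ρ a z` equals the value at any pair from `u \ v` to
    -- `u ∩ v`. Some pair of this kind crosses the `y`-cut of `u`, up to order.
    have key : ∀ z ∈ v, z ∉ u → ∃ b, ρ a z = some (y, b) := by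
      intro z hzv hzu
      obtain ⟨A, hA, hA', hcol⟩ := hcut
      obtain ⟨p, hp, q, hq, hpq⟩ := exists_crossing hA hA' (B := v) ⟨i, hiu, hiv⟩ ⟨a, hau, hav⟩
      have hcross : ∀ p ∈ u, p ∉ v → ∀ q ∈ u, q ∈ v → ρ a z = ρ p q := fun p hp hpv q hq hqv => by
        rw [(hu z hzu a hau p hp).2, (hv p hpv z hzv q hqv).1]
      rcases hpq with hpq | hpq
      · rw [hcross q hq.1 hpq.2 p hp.1 hpq.1]; exact (hcol p hp q hq).2
      · rw [hcross p hp.1 hpq.1 q hq.1 hpq.2]; exact (hcol p hp q hq).1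
    have hnw : ∀ z ∈ v, z ∉ u → z ∉ w := by
      intro z hzv hzu hzw
      obtain ⟨b, hb⟩ := key z hzv hzu
      obtain ⟨b', hb'⟩ := (hc a hau z hzw).1
      rw [hb] at hb'
      exact hxy (congrArg Prod.fst (Option.some.inj hb')).symm
    have hkv : k ∉ v := fun h => hnw k h (Set.disjoint_right.1 hd hk) hk
    -- Since `v` and `u ∪ w` are modules, `ρ k i = ρ k z = ρ a z`; the first has operation `x` and
    -- the last has operation `y`.
    obtain ⟨b, hb⟩ := key z hzv hzu
    obtain ⟨b', hb'⟩ := (hc i hiu k hk).2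
    rw [(hv k hkv i hiv z hzv).1, (huw z (fun h => h.elim hzu (hnw z hzv hzu)) k (.inr hk) a
      (.inl hau)).2, hb] at hb'
    exact hxy (congrArg Prod.fst (Option.some.inj hb')).symm

end LeafRel

/-- Follow the rightmost branch. If the right factor is a single leaf, it is a last point. If it is
a product for the same operation, its last point or its alternation is inherited. If it is a product
for another operation, the two factors form an alternation. The cut of the whole set is carried
along to remember the operation at the root. -/
theorem MTerm.hasLast_or_hasAlternation {X : Type} (I : Type) [Finite I] (t : MTerm X I) :
    Subsingleton I ∨ ∃ x, t.rel.HasCut x Set.univ ∧ (t.rel.HasLast x ∨ t.rel.HasAlternation) := by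
  refine MTerm.induction (C := fun I _ t => Subsingleton I ∨
    ∃ x, t.rel.HasCut x Set.univ ∧ (t.rel.HasLast x ∨ t.rel.HasAlternation)) ?_ ?_ ?_ I t
  · intro I J _ _ f t ih
    rcases ih with h | ⟨x, hx, h⟩
    · exact .inl f.symm.subsingleton
    · have hf : ∀ a b, (t.relabel f).rel (f a) (f b) = t.rel a b := t.rel_relabel_apply f
      refine .inr ⟨x, ?_, ?_⟩
      · have := hx.image hf f.injective
        rwa [Set.image_univ, f.surjective.range_eq] at this
      · rcases h with ⟨m, hm⟩ | h
        · refine .inl ⟨f m, fun i hi => ?_⟩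
          obtain ⟨i, rfl⟩ := f.surjective i
          rw [hf, hf]
          exact hm i fun e => hi (by rw [e])
        · refine .inr (h.image hf f.injective ?_)
          rw [f.surjective.range_eq]
          exact LeafRel.isModule_univ _
  · exact .inl inferInstance
  · intro I J _ _ x l r _ hr
    obtain ⟨i0⟩ := l.nonempty
    obtain ⟨j0⟩ := r.nonempty
    have hinr : ∀ a b, (MTerm.node x l r).rel (Sum.inr a) (Sum.inr b) = r.rel a b :=
      MTerm.rel_node_inr_inr x l r
    have hmod : (MTerm.node x l r).rel.IsModule (Set.range Sum.inr) := by
      rintro (k | k) hk _ ⟨a, rfl⟩ _ ⟨b, rfl⟩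
      · simp
      · exact absurd ⟨k, rfl⟩ hk
    refine .inr ⟨x, ⟨Set.range Sum.inl, ⟨Sum.inl i0, trivial, i0, rfl⟩,
      ⟨Sum.inr j0, trivial, by simp⟩, ?_⟩, ?_⟩
    · rintro _ ⟨-, i, rfl⟩ (j | j) ⟨-, hj⟩
      · exact absurd ⟨j, rfl⟩ hj
      · simp
    · rcases hr with h | ⟨y, hy, h⟩
      · refine .inl ⟨Sum.inr j0, ?_⟩
        rintro (i | i) hi
        · simp
        · exact absurd (congrArg Sum.inr (Subsingleton.elim i j0)) hi
      · by_cases hxy : x = y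
        · subst hxy
          rcases h with ⟨m, hm⟩ | h
          · refine .inl ⟨Sum.inr m, ?_⟩
            rintro (i | i) hi
            · simp
            · rw [hinr, hinr]; exact hm i fun e => hi (by rw [e])
          · exact .inr (h.image hinr Sum.inr_injective hmod)
        · right
          have := hy.image hinr Sum.inr_injective
          rw [Set.image_univ] at this
          refine ⟨Set.range Sum.inr, Set.range Sum.inl, x, y, hxy, hmod, ?_, ?_,
            ⟨Sum.inl i0, i0, rfl⟩, ?_, this⟩
          · rw [Set.union_comm, Set.range_inl_union_range_inr]
            exact LeafRel.isModule_univ _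
          · exact Set.isCompl_range_inl_range_inr.symm.disjoint
          · rintro _ ⟨j, rfl⟩ _ ⟨i, rfl⟩
            simp

/-! ## The trees compatible with a relation -/

section Faces

variable {n : ℕ} {T : Finset (Finset (Fin n))} {X : Type}

theorem IsTree.erase_of_ne_univ (hT : IsTree T) {u : Finset (Fin n)} (h : u ≠ Finset.univ) :
    IsTree (T.erase u) where
  univ_mem := Finset.mem_erase.2 ⟨h.symm, hT.univ_mem⟩
  two_le v hv := hT.two_le v (Finset.mem_of_mem_erase hv)
  nested v hv w hw := hT.nested v (Finset.mem_of_mem_erase hv) w (Finset.mem_of_mem_erase hw)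

theorem IsTree.insert (hT : IsTree T) {u : Finset (Fin n)} (h2 : 2 ≤ u.card)
    (h : ∀ w ∈ T, w ⊆ u ∨ u ⊆ w ∨ Disjoint w u) : IsTree (insert u T) where
  univ_mem := Finset.mem_insert_of_mem hT.univ_mem
  two_le v hv := by
    rcases Finset.mem_insert.1 hv with rfl | hv
    · exact h2
    · exact hT.two_le v hv
  nested v hv w hw := by
    rcases Finset.mem_insert.1 hv with hv | hv <;> rcases Finset.mem_insert.1 hw with hw | hw
    · exact .inl (by rw [hv, hw])
    · rw [hv]
      rcases h w hw with h' | h' | h'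
      · exact .inr (.inl h')
      · exact .inl h'
      · exact .inr (.inr h'.symm)
    · rw [hw]
      exact h v hv
    · exact hT.nested v hv w hw

/-- The trees all of whose vertices are modules of the relation `ρ`. -/
def compatibleTrees (ρ : LeafRel X (Fin n)) : Set (Finset (Finset (Fin n))) :=
  {T | IsTree T ∧ ∀ v ∈ T, ρ.IsModule (v : Set (Fin n))}

theorem erase_mem_compatibleTrees {ρ : LeafRel X (Fin n)} (hT : T ∈ compatibleTrees ρ)
    {u : Finset (Fin n)} (h : u ≠ Finset.univ) : T.erase u ∈ compatibleTrees ρ :=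
  ⟨hT.1.erase_of_ne_univ h, fun v hv => hT.2 v (Finset.mem_of_mem_erase hv)⟩

theorem insert_mem_compatibleTrees {ρ : LeafRel X (Fin n)} (hT : T ∈ compatibleTrees ρ)
    {u : Finset (Fin n)} (h2 : 2 ≤ u.card) (h : ∀ w ∈ T, w ⊆ u ∨ u ⊆ w ∨ Disjoint w u)
    (hu : ρ.IsModule (u : Set (Fin n))) : insert u T ∈ compatibleTrees ρ :=
  ⟨hT.1.insert h2 h, fun v hv => by
    rcases Finset.mem_insert.1 hv with rfl | hv
    · exact hu
    · exact hT.2 v hv⟩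

/-- A module overlapping no other module can be added to every compatible tree, so the complex is a
cone with constant apex; the counter `f` plays no role and is taken to be zero. -/
theorem exists_isConeLike_of_hasAlternation {ρ : LeafRel X (Fin n)} (h : ρ.HasAlternation)
    (k : ℕ) : ∃ c f, IsConeLike Finset.univ (compatibleTrees ρ) (compatibleTrees ρ) c f k := by
  classical
  obtain ⟨u, h1, h2, h3, h4⟩ := h.exists_strong
  lift u to Finset (Fin n) using Set.toFinite u
  have hu : u ≠ Finset.univ := fun e => h2 (by rw [e]; simp)
  refine ⟨fun _ => u, fun _ => 0, fun _ hT _ => hT,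
    fun T hT v _ hv => erase_mem_compatibleTrees hT hv,
    fun T hT v _ hv => erase_mem_compatibleTrees hT hv, fun T hT => ?_, fun _ _ => hu,
    fun _ _ => Nat.zero_le _, fun _ _ => rfl, fun _ _ _ _ _ => .inl rfl⟩
  refine insert_mem_compatibleTrees hT (Finset.one_lt_card_iff_nontrivial.2 h1) (fun w hw => ?_) h3
  simpa using h4 w (hT.2 w hw)

/-- Two consecutive sets `v' ⊂ v` in the chain of the elements of `T` which contain `m` (the chain
being completed by `{m}`) that differ by at least two points. -/
def IsGap (m : Fin n) (S : Finset (Finset (Fin n))) (v v' : Finset (Fin n)) : Prop :=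
  v ∈ S ∧ (v' ∈ S ∨ v' = {m}) ∧ v' ⊂ v ∧ (∀ w ∈ S, v' ⊂ w → ¬ w ⊂ v) ∧ 2 ≤ (v \ v').card

/-- The elements of `T` that contain `m`. -/
def chainAt (m : Fin n) (T : Finset (Finset (Fin n))) : Finset (Finset (Fin n)) :=
  T.filter fun v => m ∈ v

open Classical in
/-- The difference of the first consecutive sets that differ by at least two points. -/
noncomputable def gap (m : Fin n) (S : Finset (Finset (Fin n))) : Finset (Fin n) :=
  if h : ∃ v v', IsGap m S v v' then h.choose \ h.choose_spec.choose else ∅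

theorem exists_gap_eq {m : Fin n} {S : Finset (Finset (Fin n))} (h : ∃ v v', IsGap m S v v') :
    ∃ v v', IsGap m S v v' ∧ gap m S = v \ v' :=
  ⟨_, _, h.choose_spec.choose_spec, dif_pos h⟩

/-- The input of `v` containing `m` is the next member of the chain, or the leaf `m`; without gaps,
one step removes exactly one point. -/
theorem card_eq_of_not_exists_gap {m : Fin n}
    (h : ¬ ∃ v v', IsGap m (chainAt m T) v v') {v : Finset (Fin n)} (hv : v ∈ T)
    {c : Finset (Fin n)} (hc : IsInput T v c) (hm : m ∈ c) : v.card = c.card + 1 := by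
  have hcv := hc.2.1
  have h1 := Finset.card_sdiff_add_card_eq_card hcv.1
  have h2 := Finset.card_lt_card hcv
  by_contra hne
  refine h ⟨v, c, Finset.mem_filter.2 ⟨hv, hcv.1 hm⟩, ?_, hcv, fun w hw h3 h4 =>
    hc.2.2 w (.inl (Finset.mem_filter.1 hw).1) h3 h4, by omega⟩
  rcases hc.1 with h3 | h3
  · exact .inl (Finset.mem_filter.2 ⟨h3, hm⟩)
  · obtain ⟨a, rfl⟩ := Finset.card_eq_one.1 h3
    rw [Finset.mem_singleton] at hm
    exact .inr (by rw [hm])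

/-- A tree without gap is maximal, and all its vertices contain `m`. -/
theorem mem_of_not_exists_gap (hT : IsTree T) {m : Fin n}
    (h : ¬ ∃ v v', IsGap m (chainAt m T) v v') {u : Finset (Fin n)} (hu : 2 ≤ u.card)
    (hnest : ∀ w ∈ T, w ⊆ u ∨ u ⊆ w ∨ Disjoint w u) : u ∈ T ∧ m ∈ u := by
  classical
  have hne : (T.filter fun w => u ⊆ w ∧ m ∈ w).Nonempty :=
    ⟨Finset.univ, by simp [hT.univ_mem]⟩
  obtain ⟨w, hw⟩ := Finset.exists_minimal hne
  obtain ⟨hwT, huw, hmw⟩ := Finset.mem_filter.1 hw.1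
  obtain ⟨⟨c, hc⟩, hmc⟩ := hT.exists_input hwT hmw
  have hcard := card_eq_of_not_exists_gap h hwT hc hmc
  rcases huw.eq_or_ssubset with rfl | hss
  · exact ⟨hwT, hmw⟩
  have hlt := Finset.card_lt_card hss
  rcases hc.1 with hcT | hc1
  · rcases hnest c hcT with h1 | h1 | h1
    · have := Finset.eq_of_subset_of_card_le h1 (by omega)
      exact ⟨this ▸ hcT, this ▸ hmc⟩
    · exact absurd (hw.2 (Finset.mem_filter.2 ⟨hcT, h1, hmc⟩) hc.2.1.1) hc.2.1.2
    · have h2 : u ⊆ w \ c := fun i hi =>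
        Finset.mem_sdiff.2 ⟨huw hi, fun hi' => Finset.disjoint_left.1 h1 hi' hi⟩
      have h3 := Finset.card_le_card h2
      have h4 := Finset.card_sdiff_add_card_eq_card hc.2.1.1
      omega
  · omega

/-- All vertices contain `m`, so they form a chain, and without gaps it has exactly one member of
each size from `2` to `n`. -/
theorem card_of_not_exists_gap (hT : IsTree T) {m : Fin n}
    (h : ¬ ∃ v v', IsGap m (chainAt m T) v v') : T.card = n - 1 := by
  have hm : ∀ v ∈ T, m ∈ v := fun v hv =>
    (mem_of_not_exists_gap hT h (hT.two_le v hv) fun w hw => hT.nested w hw v hv).2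
  have hinj : Set.InjOn Finset.card (T : Set (Finset (Fin n))) := by
    intro v hv w hw e
    rcases hT.nested v hv w hw with h1 | h1 | h1
    · exact Finset.eq_of_subset_of_card_le h1 e.ge
    · exact (Finset.eq_of_subset_of_card_le h1 e.le).symm
    · exact absurd (hm w hw) (Finset.disjoint_left.1 h1 (hm v hv))
  have hsurj : ∀ d s, s + d = n → 2 ≤ s → ∃ v ∈ T, v.card = s := by
    intro d
    induction d with
    | zero => exact fun s hs _ => ⟨Finset.univ, hT.univ_mem, by simpa using hs.symm⟩
    | succ d ih =>
      intro s hs h2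
      obtain ⟨v, hv, hvs⟩ := ih (s + 1) (by omega) (by omega)
      obtain ⟨⟨c, hc⟩, hmc⟩ := hT.exists_input hv (hm v hv)
      have := card_eq_of_not_exists_gap h hv hc hmc
      exact ⟨c, hc.1.resolve_right (by omega), by omega⟩
  have himg : T.image Finset.card = Finset.Icc 2 n := by
    ext s
    simp only [Finset.mem_image, Finset.mem_Icc]
    constructor
    · rintro ⟨v, hv, rfl⟩
      exact ⟨hT.two_le v hv, by simpa using Finset.card_le_univ v⟩
    · rintro ⟨h1, h2⟩
      exact hsurj (n - s) s (by omega) h1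
  rw [← Finset.card_image_of_injOn hinj, himg, Nat.card_Icc]
  omega

theorem chainAt_erase (m : Fin n) (v : Finset (Fin n)) :
    chainAt m (T.erase v) = (chainAt m T).erase v := Finset.filter_erase _ _ _

/-- A vertex through `m` contains `v` or lies in `v'`, as these are consecutive. A vertex avoiding
`m` lies in `v'`, in `v \ v'`, outside `v`, or contains neither part improperly, by nesting with `v`
and `v'`. -/
theorem nested_gap (hT : IsTree T) {m : Fin n} {v v' : Finset (Fin n)}
    (h : IsGap m (chainAt m T) v v') {w : Finset (Fin n)} (hw : w ∈ T) :
    w ⊆ v \ v' ∨ v \ v' ⊆ w ∨ Disjoint w (v \ v') := by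
  obtain ⟨hv, hv', hss, hbet, -⟩ := h
  obtain ⟨hvT, hmv⟩ := Finset.mem_filter.1 hv
  have hmv' : m ∈ v' := by
    rcases hv' with h | h
    · exact (Finset.mem_filter.1 h).2
    · simp [h]
  have hdisj : w ⊆ v' → Disjoint w (v \ v') := fun h =>
    Finset.disjoint_of_subset_left h Finset.disjoint_sdiff
  have hcell : IsCell T v' := hv'.imp (fun h => (Finset.mem_filter.1 h).1) fun h => by simp [h]
  by_cases hmw : m ∈ w
  · rcases hT.nested v hvT w hw with h1 | h1 | h1
    · exact .inr (.inl (Finset.sdiff_subset.trans h1))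
    · rcases h1.eq_or_ssubset with rfl | h1
      · exact .inr (.inl Finset.sdiff_subset)
      · right; right
        rcases hT.cell_nested hw hcell with h2 | h2 | h2
        · rcases h2.eq_or_ssubset with rfl | h2
          · exact hdisj le_rfl
          · exact absurd h1 (hbet w (Finset.mem_filter.2 ⟨hw, hmw⟩) h2)
        · exact hdisj h2
        · exact absurd hmw (Finset.disjoint_left.1 h2 hmv')
    · exact absurd hmw (Finset.disjoint_left.1 h1 hmv)
  · rcases hT.nested w hw v hvT with h1 | h1 | h1
    · rcases hT.cell_nested hw hcell with h2 | h2 | h2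
      · exact absurd (h2 hmv') hmw
      · exact .inr (.inr (hdisj h2))
      · exact .inl fun i hi => Finset.mem_sdiff.2 ⟨h1 hi, Finset.disjoint_right.1 h2 hi⟩
    · exact absurd (h1 hmv) hmw
    · exact .inr (.inr (Finset.disjoint_of_subset_right Finset.sdiff_subset h1))

/-- As `v'` is a module or the point `m`, each of its elements sees everything outside `v'` as `m`
does, that is, uniformly. Elements outside `v` see `v` uniformly because `v` is a module. -/
theorem isModule_gap {ρ : LeafRel X (Fin n)} (hT : T ∈ compatibleTrees ρ) {m : Fin n}
    {a b : Option (X × Bool)} (hm : ∀ i, i ≠ m → ρ m i = a ∧ ρ i m = b)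
    {v v' : Finset (Fin n)} (h : IsGap m (chainAt m T) v v') :
    ρ.IsModule ((v \ v' : Finset (Fin n)) : Set (Fin n)) := by
  obtain ⟨hv, hv', hss, -, -⟩ := h
  obtain ⟨hvT, hmv⟩ := Finset.mem_filter.1 hv
  have key : ∀ k ∈ v', ∀ i, i ∉ v' → ρ k i = a ∧ ρ i k = b := by
    intro k hk i hi
    rcases hv' with h | h
    · obtain ⟨h1, h2⟩ := Finset.mem_filter.1 h
      obtain ⟨h3, h4⟩ := hT.2 v' h1 i hi k hk m h2
      rw [h3, h4]
      exact hm i fun e => hi (e ▸ h2)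
    · subst h
      rw [Finset.mem_singleton] at hk hi
      subst hk
      exact hm i hi
  intro k hk i hi j hj
  simp only [Finset.coe_sdiff, Set.mem_sdiff, Finset.mem_coe, not_and, not_not] at hk hi hj
  by_cases hkv : k ∈ v
  · rw [(key k (hk hkv) i hi.2).1, (key k (hk hkv) i hi.2).2, (key k (hk hkv) j hj.2).1,
      (key k (hk hkv) j hj.2).2]
    exact ⟨rfl, rfl⟩
  · exact hT.2 v hvT k hkv i hi.1 j hj.1

/-- The cone point is a gap of the chain through `m`. It depends only on this chain and avoids `m`,
so adding it, or removing a vertex that avoids `m`, does not change it. Removing a vertex through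
`m` shortens the chain, whose length is `f`. The condition `k + 2 ≠ n` ensures that trees with `k +
1` vertices have a gap. -/
theorem exists_isConeLike_of_last {ρ : LeafRel X (Fin n)} {m : Fin n}
    {a b : Option (X × Bool)} (hm : ∀ i, i ≠ m → ρ m i = a ∧ ρ i m = b) {k : ℕ} (hk : k + 2 ≠ n) :
    ∃ G c f, IsConeLike Finset.univ (compatibleTrees ρ) G c f k := by
  have hn : 0 < n := m.pos
  have hnotin : ∀ {T : Finset (Finset (Fin n))}, (∃ v v', IsGap m (chainAt m T) v v') →
      m ∉ gap m (chainAt m T) := by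
    intro T h
    obtain ⟨v, v', h1, h2⟩ := exists_gap_eq h
    rw [h2, Finset.mem_sdiff]
    rintro ⟨-, h3⟩
    rcases h1.2.1 with h | h
    · exact h3 (Finset.mem_filter.1 h).2
    · exact h3 (by simp [h])
  have hins : ∀ {T : Finset (Finset (Fin n))}, (∃ v v', IsGap m (chainAt m T) v v') →
      chainAt m (insert (gap m (chainAt m T)) T) = chainAt m T := fun h => by
    rw [chainAt, Finset.filter_insert, if_neg (hnotin h)]; rfl
  refine ⟨{T | T ∈ compatibleTrees ρ ∧ ∃ v v', IsGap m (chainAt m T) v v'},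
    fun T => gap m (chainAt m T), fun T => (chainAt m T).card, ?_,
    fun T hT v _ hv => erase_mem_compatibleTrees hT hv, ?_, ?_, ?_, ?_, ?_, ?_⟩
  · intro T hT hcard
    refine ⟨hT, ?_⟩
    by_contra h
    have := card_of_not_exists_gap hT.1 h
    omega
  -- A tree without gap admits no further vertex, so it cannot arise by removing one.
  · rintro T ⟨hT, -⟩ v hv hvu
    refine ⟨erase_mem_compatibleTrees hT hvu, ?_⟩
    by_contra h
    have := mem_of_not_exists_gap (hT.1.erase_of_ne_univ hvu) h (hT.1.two_le v hv) fun w hw =>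
      hT.1.nested w (Finset.mem_of_mem_erase hw) v hv
    exact Finset.notMem_erase _ _ this.1
  · rintro T ⟨hT, hg⟩
    obtain ⟨v, v', h1, h2⟩ := exists_gap_eq hg
    simp only [h2]
    exact insert_mem_compatibleTrees hT h1.2.2.2.2 (fun w hw => nested_gap hT.1 h1 hw)
      (isModule_gap hT hm h1)
  · rintro T ⟨-, hg⟩ h
    exact hnotin hg (h ▸ Finset.mem_univ m)
  · exact fun T _ => Finset.card_le_card (Finset.filter_subset _ _)
  · rintro T ⟨-, hg⟩
    simp only [hins hg]
  · rintro T ⟨hT, hg⟩ v hv hvu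
    by_cases hmv : m ∈ v
    · right
      have hlt := Finset.card_erase_lt_of_mem (s := chainAt m T) (Finset.mem_filter.2 ⟨hv, hmv⟩)
      refine ⟨fun e => hnotin hg (e ▸ hmv), ?_, ?_⟩
      · rw [chainAt_erase]; exact hlt
      · rw [chainAt_erase, hins hg]; exact hlt
    · left
      have hn : v ∉ chainAt m T := fun h => hmv (Finset.mem_filter.1 h).2
      rw [chainAt_erase, Finset.erase_eq_of_notMem hn]

theorem exists_isConeLike (ρ : CoTree X (Fin n)) (hn : 2 ≤ n) {k : ℕ} (hk : k + 2 ≠ n) :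
    ∃ G c f, IsConeLike Finset.univ (compatibleTrees ρ.1) G c f k := by
  obtain ⟨t, rfl⟩ := CoTree.mk_surjective ρ
  rcases t.hasLast_or_hasAlternation with h | ⟨x, -, ⟨m, hm⟩ | h⟩
  · have := Fin.subsingleton_iff_le_one.1 h
    omega
  · exact exists_isConeLike_of_last hm hk
  · exact ⟨_, exists_isConeLike_of_hasAlternation h k⟩

end Faces

end Operadic

namespace Operadic

/-! ## The operad of 2-associative algebras is Koszul -/

section Koszul

variable {K : Type u} [Field K] {n k : ℕ} {T : Finset (Finset (Fin n))}

/-- The basis of `2as(T)` consisting of the decorations of `T` by relations. -/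
noncomputable def treeBasis (T : Finset (Finset (Fin n))) :
    Module.Basis (∀ v : {v // v ∈ T}, CoTree TwoOp (Inputs T v.1)) K
      (TreeSpace (quadOperad (twoAsRel K)) T) :=
  Basis.piTensorProduct fun v => twoAsBasis K (Inputs T v.1)

open Classical in
variable (K) in
/-- The element of `2as(T)` whose composite is the relation `ρ`. -/
noncomputable def treeElem (ρ : CoTree TwoOp (Fin n)) (T : Finset (Finset (Fin n))) :
    TreeSpace (quadOperad (twoAsRel K)) T :=
  if h : ∃ x : ∀ v : {v // v ∈ T}, CoTree TwoOp (Inputs T v.1), IsComposite x ρ then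
    treeBasis T h.choose else 0

theorem treeElem_eq (hT : IsTree T) {x : ∀ v : {v // v ∈ T}, CoTree TwoOp (Inputs T v.1)}
    {ρ : CoTree TwoOp (Fin n)} (h : IsComposite x ρ) : treeElem K ρ T = treeBasis T x := by
  have h' : ∃ x : ∀ v : {v // v ∈ T}, CoTree TwoOp (Inputs T v.1), IsComposite x ρ := ⟨x, h⟩
  rw [treeElem, dif_pos h', h'.choose_spec.decoration_unique hT h]

theorem contract_treeBasis (hT : IsTree T) {u w : Finset (Fin n)} (hu : u ∈ T) (hw : w ∈ T)
    (h : IsInput T w u) (x : ∀ v : {v // v ∈ T}, CoTree TwoOp (Inputs T v.1)) :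
    Operadic.contract (quadOperad (twoAsRel K)) hT hu hw h (treeBasis T x) =
      treeBasis (T.erase u) (contractRel hT hu x) := by
  rw [treeBasis, Basis.piTensorProduct_apply, treeBasis, Basis.piTensorProduct_apply,
    Operadic.contract, PiTensorProduct.lift.tprod]
  change PiTensorProduct.tprod K _ = _
  congr 1
  funext v
  rw [contractFun, contractRel]
  split_ifs with h'
  · rw [twoAs_comp, twoAs_map]
  · rw [twoAs_map]

/-- Contraction keeps the total composite, so the elements attached to a fixed `ρ` behave like the
simplices of a complex under removal of vertices. -/
theorem contract_treeElem {ρ : CoTree TwoOp (Fin n)} (hT : T ∈ compatibleTrees ρ.1)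
    {u w : Finset (Fin n)} (hu : u ∈ T) (hw : w ∈ T) (h : IsInput T w u) :
    Operadic.contract (quadOperad (twoAsRel K)) hT.1 hu hw h (treeElem K ρ T) =
      treeElem K ρ (T.erase u) := by
  obtain ⟨x, hx⟩ := exists_decoration hT.1 hT.2
  rw [treeElem_eq hT.1 hx, contract_treeBasis,
    treeElem_eq (hT.1.erase h) ((isComposite_contractRel_iff hT.1 hu hw h x ρ).2 hx)]

open Classical in
/-- The values of a cochain on the elements whose composite is `ρ`. -/
noncomputable def cochainOf (φ : DChains (quadOperad (twoAsRel K)) n k) (ρ : CoTree TwoOp (Fin n))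
    (T : Finset (Finset (Fin n))) : K :=
  if h : IsTree T ∧ T.card = k then
    φ (LinearMap.single K (fun S : Tree n k => TreeSpace (quadOperad (twoAsRel K)) S.1) ⟨T, h⟩
      (treeElem K ρ T)) else 0

open Classical in
theorem cochainOf_eq (φ : DChains (quadOperad (twoAsRel K)) n k) (ρ : CoTree TwoOp (Fin n))
    (T : Tree n k) : cochainOf φ ρ T.1 =
      φ (LinearMap.single K (fun S : Tree n k => TreeSpace (quadOperad (twoAsRel K)) S.1) T
        (treeElem K ρ T.1)) := dif_pos T.2

/-- Every decorated tree has a total composite, so the elements `treeElem K ρ T` with `T` compatible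
exhaust the bases of the spaces `2as(T)`. -/
theorem dChains_ext {φ ψ : DChains (quadOperad (twoAsRel K)) n k}
    (h : ∀ (ρ : CoTree TwoOp (Fin n)), ∀ T ∈ compatibleTrees ρ.1, T.card = k →
      cochainOf φ ρ T = cochainOf ψ ρ T) : φ = ψ := by
  classical
  refine LinearMap.pi_ext' fun T => (treeBasis T.1).ext fun x => ?_
  obtain ⟨ρ, hρ⟩ := exists_composite T.2.1 x
  have := h ρ T.1 ⟨T.2.1, fun v hv => hρ.isModule T.2.1 hv⟩ T.2.2
  rw [cochainOf_eq, cochainOf_eq, treeElem_eq T.2.1 hρ] at this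
  rw [LinearMap.comp_apply, LinearMap.comp_apply]
  convert this

/-- On a given tree, decorations and compatible composites determine each other, so the values for
the different pairs `(ρ, T)` can be prescribed independently. -/
theorem exists_cochainOf_eq (ψ : CoTree TwoOp (Fin n) → Finset (Finset (Fin n)) → K) :
    ∃ φ : DChains (quadOperad (twoAsRel K)) n k, ∀ (ρ : CoTree TwoOp (Fin n)),
      ∀ T ∈ compatibleTrees ρ.1, T.card = k → cochainOf φ ρ T = ψ ρ T := by
  classical
  refine ⟨∑ T : Tree n k, ((treeBasis T.1).constr K fun x =>
    ψ (exists_composite T.2.1 x).choose T.1) ∘ₗ LinearMap.proj T, fun ρ T hT hk => ?_⟩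
  obtain ⟨x, hx⟩ := exists_decoration hT.1 hT.2
  let T' : Tree n k := ⟨T, hT.1, hk⟩
  change cochainOf _ ρ T'.1 = _
  rw [cochainOf_eq, LinearMap.sum_apply, Finset.sum_eq_single T']
  · rw [LinearMap.comp_apply, LinearMap.proj_apply, LinearMap.single_apply, Pi.single_eq_same,
      treeElem_eq hT.1 hx, Module.Basis.constr_basis,
      (exists_composite T'.2.1 x).choose_spec.unique hT.1 hx]
  · intro S _ hS
    rw [LinearMap.comp_apply, LinearMap.proj_apply, LinearMap.single_apply,
      Pi.single_eq_of_ne hS, map_zero]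
  · exact fun h => absurd (Finset.mem_univ _) h

/-- Internal edges correspond to the vertices other than the root, each having a unique vertex below
it, and both signs count the vertices preceding in colexicographic order. So the differential is the
simplicial coboundary that never removes the root. -/
theorem cochainOf_dDiff (φ : DChains (quadOperad (twoAsRel K)) n k) (ρ : CoTree TwoOp (Fin n))
    (hT : T ∈ compatibleTrees ρ.1) (hk : T.card = k + 1) :
    cochainOf (dDiff _ n k φ) ρ T = coboundary toColex Finset.univ (cochainOf φ ρ) T := by
  classical
  let T' : Tree n (k + 1) := ⟨T, hT.1, hk⟩
  change cochainOf _ ρ T'.1 = _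
  rw [cochainOf_eq, dDiff, LinearMap.dualMap_apply, barDiff, LinearMap.sum_apply,
    Finset.sum_eq_single T']
  · rw [LinearMap.sum_apply, map_sum, coboundary]
    refine Finset.sum_bij (fun e _ => e.1.2.1) ?_ ?_ ?_ ?_
    · exact fun e _ => Finset.mem_erase.2
        ⟨fun h => (h ▸ e.2.2.1).2 (Finset.subset_univ _), e.1.2.2⟩
    · rintro ⟨⟨w, u⟩, h⟩ _ ⟨⟨w', u'⟩, h'⟩ _ e
      obtain rfl : u = u' := Subtype.ext e
      obtain rfl : w = w' := Subtype.ext (hT.1.isInput_unique w.2 w'.2 h h')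
      rfl
    · intro u hu
      obtain ⟨hne, hu⟩ := Finset.mem_erase.1 hu
      obtain ⟨w, hw, h⟩ := hT.1.exists_parent hu hne
      exact ⟨⟨⟨⟨w, hw⟩, ⟨u, hu⟩⟩, h⟩, Finset.mem_univ _, rfl⟩
    · intro e _
      change φ (((edgeSign e : ℤ) : K) • LinearMap.single K
        (fun S : Tree n k => TreeSpace (quadOperad (twoAsRel K)) S.1) (T'.contract e)
        (Operadic.contract (quadOperad (twoAsRel K)) hT.1 e.1.2.2 e.1.1.2 e.2
          ((Pi.single T' (treeElem K ρ T) : BarChains (quadOperad (twoAsRel K)) n (k + 1)) T'))) = _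
      rw [Pi.single_eq_same, map_smul, contract_treeElem hT, smul_eq_mul]
      congr 1
      · simp [edgeSign, eraseSign, T']
      · exact (cochainOf_eq φ ρ (T'.contract e)).symm
  · intro S _ hS
    rw [LinearMap.sum_apply]
    refine Finset.sum_eq_zero fun e _ => ?_
    change ((edgeSign e : ℤ) : K) • LinearMap.single K
      (fun S : Tree n k => TreeSpace (quadOperad (twoAsRel K)) S.1) (S.contract e)
      (Operadic.contract (quadOperad (twoAsRel K)) S.2.1 e.1.2.2 e.1.1.2 e.2
        ((Pi.single T' (treeElem K ρ T) : BarChains (quadOperad (twoAsRel K)) n (k + 1)) S)) = _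
    rw [Pi.single_eq_of_ne hS, map_zero]
    exact (congrArg _ (map_zero (LinearMap.single K
      (fun S : Tree n k => TreeSpace (quadOperad (twoAsRel K)) S.1) (S.contract e)))).trans
        (smul_zero _)
  · exact fun h => absurd (Finset.mem_univ _) h

/-- The complex decomposes over the total composites, so primitives are chosen for each `ρ`
separately and reassembled. -/
theorem isKoszul_twoAs : (twoAs K).IsKoszul := by
  change (quadOperad (twoAsRel K)).IsKoszul
  intro n k hk φ
  -- Compatible trees are closed under removal of non-root vertices, so the coboundary at one
  -- involves only values at others.
  have hcongr : ∀ (ρ : CoTree TwoOp (Fin n)) (j : ℕ) (f g : Finset (Finset (Fin n)) → K),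
      (∀ T ∈ compatibleTrees ρ.1, T.card = j → f T = g T) → ∀ T ∈ compatibleTrees ρ.1,
      T.card = j + 1 → coboundary toColex Finset.univ f T = coboundary toColex Finset.univ g T := by
    intro ρ j f g h T hT hj
    refine Finset.sum_congr rfl fun v hv => ?_
    obtain ⟨hne, hv⟩ := Finset.mem_erase.1 hv
    rw [h _ (erase_mem_compatibleTrees hT hne) (by rw [Finset.card_erase_of_mem hv, hj]; rfl)]
  constructor
  · intro hφ
    -- With fewer than two leaves there is no reduced tree, since the root needs two inputs.
    rcases lt_or_ge n 2 with hn | hn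
    · refine ⟨0, dChains_ext fun ρ T hT _ => ?_⟩
      have := hT.1.two_le _ hT.1.univ_mem
      rw [Finset.card_univ, Fintype.card_fin] at this
      omega
    · have hψ : ∀ ρ : CoTree TwoOp (Fin n), ∃ ψ : Finset (Finset (Fin n)) → K,
          ∀ T ∈ compatibleTrees ρ.1, T.card = k + 1 →
            cochainOf φ ρ T = coboundary toColex Finset.univ ψ T := by
        intro ρ
        obtain ⟨G, c, f, h⟩ := exists_isConeLike ρ hn hk
        refine h.exists_primitive toColex.injective fun T hT hT' => ?_
        rw [← cochainOf_dDiff φ ρ hT hT', hφ, cochainOf]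
        split_ifs <;> rfl
      choose ψ hψ using hψ
      obtain ⟨Ψ, hΨ⟩ := exists_cochainOf_eq (k := k) ψ
      refine ⟨Ψ, dChains_ext fun ρ T hT hT' => ?_⟩
      rw [cochainOf_dDiff Ψ ρ hT hT', hψ ρ T hT hT', hcongr ρ k _ _ (hΨ ρ) T hT hT']
  · rintro ⟨ψ, rfl⟩
    refine dChains_ext fun ρ T hT hT' => ?_
    rw [cochainOf_dDiff _ ρ hT hT', hcongr ρ (k + 1) _ _ (fun S hS hS' =>
      cochainOf_dDiff ψ ρ hS hS') T hT hT', coboundary_coboundary toColex.injective, cochainOf]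
    split_ifs <;> rfl

end Koszul

end Operadic

namespace Operadic

/-! ## The quadratic dual of `2as` -/

section QuadraticDual

variable {X : Type}

theorem leftComb_val (x y : X) (σ : Equiv.Perm (Fin 3)) :
    (leftComb x y σ).1 = .node x (.node y (.leaf (σ 0)) (.leaf (σ 1))) (.leaf (σ 2)) := rfl

theorem rightComb_val (x y : X) (σ : Equiv.Perm (Fin 3)) :
    (rightComb x y σ).1 = .node x (.leaf (σ 0)) (.node y (.leaf (σ 1)) (.leaf (σ 2))) := rfl

theorem perm_fin_three_ext {σ τ : Equiv.Perm (Fin 3)} (h0 : σ 0 = τ 0) (h1 : σ 1 = τ 1)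
    (h2 : σ 2 = τ 2) : σ = τ := by
  ext i
  fin_cases i
  exacts [congrArg Fin.val h0, congrArg Fin.val h1, congrArg Fin.val h2]

theorem exists_perm_fin_three : ∀ a b c : Fin 3, a ≠ b → a ≠ c → b ≠ c →
    ∃ σ : Equiv.Perm (Fin 3), σ 0 = a ∧ σ 1 = b ∧ σ 2 = c := by
  decide

theorem BinTerm.leaves_length_pos {I : Type} (t : BinTerm X I) : 0 < t.leaves.length :=
  List.length_pos_of_mem t.exists_mem_leaves.choose_spec

theorem BinTerm.eq_leaf {I : Type} {t : BinTerm X I} (h : t.leaves.length < 2) :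
    ∃ i, t = .leaf i := by
  rcases t with i | ⟨x, l, r⟩
  · exact ⟨i, rfl⟩
  · have := l.leaves_length_pos
    have := r.leaves_length_pos
    simp only [BinTerm.leaves, List.length_append] at h
    omega

theorem BinTerm.eq_node_leaf {I : Type} {t : BinTerm X I} (h : t.leaves.length = 2) :
    ∃ x i j, t = .node x (.leaf i) (.leaf j) := by
  rcases t with i | ⟨x, l, r⟩
  · simp [BinTerm.leaves] at h
  · have := l.leaves_length_pos
    have := r.leaves_length_pos
    simp only [BinTerm.leaves, List.length_append] at h
    obtain ⟨i, rfl⟩ := l.eq_leaf (by omega)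
    obtain ⟨j, rfl⟩ := r.eq_leaf (by omega)
    exact ⟨x, i, j, rfl⟩

theorem MTerm.leaves_length {n : ℕ} (t : MTerm X (Fin n)) : t.1.leaves.length = n := by
  have : t.1.leaves.Perm (List.finRange n) :=
    (List.perm_ext_iff_of_nodup t.2.1 (List.nodup_finRange n)).2 fun i => by simp [t.2.2 i]
  rw [this.length_eq, List.length_finRange]

/-- The ternary monomials. -/
def comb : (X × X × Equiv.Perm (Fin 3)) ⊕ (X × X × Equiv.Perm (Fin 3)) → MTerm X (Fin 3) :=
  Sum.elim (fun p => leftComb p.1 p.2.1 p.2.2) (fun p => rightComb p.1 p.2.1 p.2.2)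

/-- With three leaves, one factor of the root has two of them and the other has one; the order of
the leaves is a permutation. -/
theorem comb_bijective : Function.Bijective (comb (X := X)) := by
  constructor
  · rintro (⟨x, y, σ⟩ | ⟨x, y, σ⟩) (⟨x', y', τ⟩ | ⟨x', y', τ⟩) h <;>
      have h := congrArg Subtype.val h <;>
      simp only [comb, Sum.elim_inl, Sum.elim_inr, leftComb_val, rightComb_val,
        BinTerm.node.injEq, BinTerm.leaf.injEq, reduceCtorEq, and_false] at h
    · obtain ⟨rfl, ⟨rfl, h0, h1⟩, h2⟩ := h
      rw [perm_fin_three_ext h0 h1 h2]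
    · obtain ⟨rfl, h0, rfl, h1, h2⟩ := h
      rw [perm_fin_three_ext h0 h1 h2]
  · intro t
    have hlen := t.leaves_length
    obtain ⟨t, ht⟩ := t
    rcases t with i | ⟨x, l, r⟩
    · simp [BinTerm.leaves] at hlen
    · have := l.leaves_length_pos
      have := r.leaves_length_pos
      simp only [BinTerm.leaves, List.length_append] at hlen
      by_cases h : l.leaves.length = 2
      · obtain ⟨y, a, b, rfl⟩ := BinTerm.eq_node_leaf h
        obtain ⟨c, rfl⟩ := r.eq_leaf (by omega)
        have h3 := ht.1
        simp only [BinTerm.leaves, List.cons_append, List.nil_append,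
          List.nodup_cons, List.mem_cons, List.not_mem_nil, or_false, not_or] at h3
        obtain ⟨σ, rfl, rfl, rfl⟩ := exists_perm_fin_three a b c h3.1.1 h3.1.2 h3.2.1
        exact ⟨.inl (x, y, σ), rfl⟩
      · obtain ⟨a, rfl⟩ := l.eq_leaf (by omega)
        obtain ⟨y, b, c, rfl⟩ := BinTerm.eq_node_leaf (t := r) (by
          simp only [BinTerm.leaves, List.length_singleton] at hlen; omega)
        have h3 := ht.1
        simp only [BinTerm.leaves, List.cons_append, List.nil_append,
          List.nodup_cons, List.mem_cons, List.not_mem_nil, or_false, not_or] at h3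
        obtain ⟨σ, rfl, rfl, rfl⟩ := exists_perm_fin_three a b c h3.1.1 h3.1.2 h3.2.1
        exact ⟨.inr (x, y, σ), rfl⟩

theorem leftComb_ne_rightComb (x y x' y' : X) (σ τ : Equiv.Perm (Fin 3)) :
    leftComb x y σ ≠ rightComb x' y' τ := fun h =>
  Sum.inl_ne_inr (comb_bijective.1 (a₁ := .inl (x, y, σ)) (a₂ := .inr (x', y', τ)) h)

theorem leftComb_inj {x y x' y' : X} {σ τ : Equiv.Perm (Fin 3)} :
    leftComb x y σ = leftComb x' y' τ ↔ x = x' ∧ y = y' ∧ σ = τ := by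
  rw [← Prod.mk_inj, ← Prod.mk_inj]
  exact (comb_bijective.1.eq_iff (a := .inl (x, y, σ)) (b := .inl (x', y', τ))).trans
    Sum.inl_injective.eq_iff

theorem rightComb_inj {x y x' y' : X} {σ τ : Equiv.Perm (Fin 3)} :
    rightComb x y σ = rightComb x' y' τ ↔ x = x' ∧ y = y' ∧ σ = τ := by
  rw [← Prod.mk_inj, ← Prod.mk_inj]
  exact (comb_bijective.1.eq_iff (a := .inr (x, y, σ)) (b := .inr (x', y', τ))).trans
    Sum.inr_injective.eq_iff

theorem orderSign_perm : ∀ σ : Equiv.Perm (Fin 3), orderSign (σ 0) (σ 1) (σ 2) = 1 ∨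
    orderSign (σ 0) (σ 1) (σ 2) = -1 := by
  decide

variable {K : Type u} [Field K]

theorem dualPairing_sub (g f f' : Free K X (Fin 3)) :
    dualPairing g (f - f') = dualPairing g f - dualPairing g f' := by
  simp only [dualPairing, Finsupp.sum, Finsupp.sub_apply, mul_sub, sub_mul, Finset.sum_sub_distrib]

theorem dualPairing_single (g : Free K X (Fin 3)) (t : MTerm X (Fin 3)) :
    dualPairing g (Finsupp.single t 1) = g t * (combSign t.1 : K) := by
  classical
  rw [dualPairing, Finsupp.sum, Finset.sum_eq_single t]
  · simp
  · intro s _ hs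
    simp [Finsupp.single_eq_of_ne hs]
  · intro h
    simp [Finsupp.notMem_support_iff.1 h]

/-- The opposite signs of `combSign` on the two bracketings turn the difference in the relation into
a sum of coefficients; the remaining factor is a sign. -/
theorem mem_quadDualRel_twoAsRel {g : Free K TwoOp (Fin 3)} :
    g ∈ quadDualRel (twoAsRel K) ↔ ∀ x σ, g (leftComb x x σ) + g (rightComb x x σ) = 0 := by
  have key : ∀ x σ, dualPairing g (Finsupp.single (leftComb x x σ) 1 -
      Finsupp.single (rightComb x x σ) 1) = (orderSign (σ 0) (σ 1) (σ 2) : K) *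
        (g (leftComb x x σ) + g (rightComb x x σ)) := by
    intro x σ
    rw [dualPairing_sub, dualPairing_single, dualPairing_single, leftComb_val, rightComb_val]
    simp only [combSign]
    push_cast
    ring
  constructor
  · intro hg x σ
    have := hg _ (Submodule.subset_span ⟨x, σ, rfl⟩)
    rw [key] at this
    rcases orderSign_perm σ with h | h
    · simpa [h] using this
    · rwa [h, Int.cast_neg, Int.cast_one, neg_one_mul, neg_eq_zero] at this
  · intro hg f hf
    induction hf using Submodule.span_induction with
    | mem f hf =>
      obtain ⟨x, σ, rfl⟩ := hf
      rw [key, hg, mul_zero]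
    | zero => simp [dualPairing]
    | add f f' _ _ h h' =>
      rw [dualPairing] at h h' ⊢
      simp only [Finsupp.sum, Finsupp.add_apply, mul_add, add_mul, Finset.sum_add_distrib] at h h' ⊢
      rw [h, h', add_zero]
    | smul a f _ h =>
      rw [dualPairing] at h ⊢
      simp only [Finsupp.sum, Finsupp.smul_apply, smul_eq_mul] at h ⊢
      rw [← mul_zero a, ← h, Finset.mul_sum]
      exact Finset.sum_congr rfl fun _ _ => by ring

theorem assoc_mem_twoAsZeroRel (x : TwoOp) (σ : Equiv.Perm (Fin 3)) :
    Finsupp.single (leftComb x x σ) 1 - Finsupp.single (rightComb x x σ) 1 ∈ twoAsZeroRel K :=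
  Submodule.mem_sup_left (Submodule.subset_span ⟨x, σ, rfl⟩)

theorem leftComb_mem_twoAsZeroRel {x y : TwoOp} (h : x ≠ y) (σ : Equiv.Perm (Fin 3)) :
    Finsupp.single (leftComb x y σ) 1 ∈ twoAsZeroRel K :=
  Submodule.mem_sup_right (Submodule.subset_span ⟨x, y, σ, h, .inl rfl⟩)

theorem rightComb_mem_twoAsZeroRel {x y : TwoOp} (h : x ≠ y) (σ : Equiv.Perm (Fin 3)) :
    Finsupp.single (rightComb x y σ) 1 ∈ twoAsZeroRel K :=
  Submodule.mem_sup_right (Submodule.subset_span ⟨x, y, σ, h, .inr rfl⟩)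

theorem quadDualRel_twoAsRel : quadDualRel (twoAsRel K) = twoAsZeroRel K := by
  classical
  apply le_antisymm
  · intro g hg
    rw [mem_quadDualRel_twoAsRel] at hg
    -- Expand `g` over all ternary monomials, the two bracketings with the same `(x, y, σ)` being
    -- paired. Pairs with `x = y` are multiples of associativity; the others split into the
    -- vanishing monomials.
    let e := Equiv.ofBijective _ (comb_bijective (X := TwoOp))
    let _ : Fintype (MTerm TwoOp (Fin 3)) := Fintype.ofEquiv _ e
    rw [← Finsupp.sum_single g, Finsupp.sum_fintype _ _ (fun _ => Finsupp.single_zero _),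
      ← e.sum_comp, Fintype.sum_sum_type, ← Finset.sum_add_distrib]
    refine Submodule.sum_mem _ fun p _ => ?_
    obtain ⟨x, y, σ⟩ := p
    change Finsupp.single (leftComb x y σ) (g (leftComb x y σ)) +
      Finsupp.single (rightComb x y σ) (g (rightComb x y σ)) ∈ _
    by_cases h : x = y
    · subst h
      rw [← neg_eq_of_add_eq_zero_right (hg x σ), Finsupp.single_neg, ← sub_eq_add_neg]
      have := Submodule.smul_mem _ (g (leftComb x x σ)) (assoc_mem_twoAsZeroRel (K := K) x σ)
      rwa [smul_sub, Finsupp.smul_single, Finsupp.smul_single, smul_eq_mul, mul_one] at this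
    · refine Submodule.add_mem _ ?_ ?_
      · rw [← mul_one (g _), ← smul_eq_mul, ← Finsupp.smul_single]
        exact Submodule.smul_mem _ _ (leftComb_mem_twoAsZeroRel h σ)
      · rw [← mul_one (g _), ← smul_eq_mul, ← Finsupp.smul_single]
        exact Submodule.smul_mem _ _ (rightComb_mem_twoAsZeroRel h σ)
  · refine sup_le (Submodule.span_le.2 ?_) (Submodule.span_le.2 ?_)
    · rintro _ ⟨x, σ, rfl⟩
      refine mem_quadDualRel_twoAsRel.2 fun y τ => ?_
      simp [Finsupp.single_apply, leftComb_inj, rightComb_inj, leftComb_ne_rightComb,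
        (leftComb_ne_rightComb _ _ _ _ _ _).symm]
    · rintro _ ⟨x, y, σ, h, rfl | rfl⟩ <;>
      · refine mem_quadDualRel_twoAsRel.2 fun z τ => ?_
        have h' : ∀ z, ¬ (x = z ∧ y = z) := fun z hz => h (hz.1.trans hz.2.symm)
        simp [leftComb_inj, rightComb_inj, leftComb_ne_rightComb,
          (leftComb_ne_rightComb _ _ _ _ _ _).symm, ← and_assoc, h']

end QuadraticDual

end Operadic

namespace Operadic

/-! ## The dual operad of `2as` -/

namespace BinTerm

variable {X I J : Type}

/-- All the vertices are decorated by `x`. -/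
def IsMono (x : X) : BinTerm X I → Prop
  | leaf _ => True
  | node y l r => y = x ∧ l.IsMono x ∧ r.IsMono x

theorem isMono_bind {x : X} {t : BinTerm X I} {f : I → BinTerm X J} :
    (t.bind f).IsMono x ↔ t.IsMono x ∧ ∀ i ∈ t.leaves, (f i).IsMono x := by
  induction t with
  | leaf i => simp [bind, IsMono, leaves]
  | node y l r hl hr =>
    simp only [bind, IsMono, hl, hr, leaves, List.mem_append, or_imp, forall_and]
    tauto

theorem isMono_relabel {x : X} {t : BinTerm X I} {f : I → J} :
    (t.relabel f).IsMono x ↔ t.IsMono x :=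
  isMono_bind.trans (and_iff_left fun _ _ => trivial)

theorem isMono_subst {x : X} {i : I} {t : BinTerm X I} {s : BinTerm X J} (hi : i ∈ t.leaves) :
    (t.subst i s).IsMono x ↔ t.IsMono x ∧ s.IsMono x := by
  rw [subst, isMono_bind]
  refine and_congr_right fun _ => ⟨fun h => ?_, fun h k _ => ?_⟩
  · have := h i hi
    rwa [plug_self, isMono_relabel] at this
  · by_cases hk : k = i
    · subst hk
      rwa [plug_self, isMono_relabel]
    · rw [plug_of_ne _ _ _ hk]
      trivial

-- In a monomial with a single operation the relation only records the order of the leaves, whatever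
-- the bracketing. The normal form theorem then identifies such monomials when they have the same
-- word.
open Classical in
theorem IsMono.rel_eq {x : X} {t : BinTerm X I} (ht : t.IsMono x) {i j : I} (hij : i ≠ j)
    (hi : i ∈ t.leaves) (hj : j ∈ t.leaves) :
    t.rel i j = some (x, decide (t.leaves.idxOf i < t.leaves.idxOf j)) := by
  induction t with
  | leaf k =>
    simp only [leaves, List.mem_singleton] at hi hj
    exact absurd (hi.trans hj.symm) hij
  | node y l r hl hr =>
    obtain ⟨rfl, hml, hmr⟩ := ht
    simp only [leaves, List.mem_append] at hi hj
    by_cases hi' : i ∈ l.leaves <;> by_cases hj' : j ∈ l.leaves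
    · simp only [rel, hi', hj', if_true, hl hml hi' hj', leaves, List.idxOf_append]
    · have := List.idxOf_lt_length_of_mem hi'
      simp only [rel, hi', hj', if_true, if_false, leaves, List.idxOf_append]
      simp only [Option.some.injEq, Prod.mk.injEq, true_and, Bool.true_eq, decide_eq_true_eq]
      omega
    · have := List.idxOf_lt_length_of_mem hj'
      simp only [rel, hi', hj', if_true, if_false, leaves, List.idxOf_append]
      simp only [Option.some.injEq, Prod.mk.injEq, true_and, Bool.false_eq, decide_eq_false_iff_not]
      omega
    · simp only [rel, hi', hj', if_false, leaves, List.idxOf_append,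
        hr hmr (hi.resolve_left hi') (hj.resolve_left hj'), Nat.add_lt_add_iff_right]

end BinTerm

theorem MTerm.rel_eq_of_isMono {X I : Type} {x : X} {t s : MTerm X I} (ht : t.1.IsMono x)
    (hs : s.1.IsMono x) (h : t.1.leaves = s.1.leaves) : t.rel = s.rel := by
  funext i j
  by_cases hij : i = j
  · subst hij
    rw [MTerm.rel_self, MTerm.rel_self]
  · exact (ht.rel_eq hij (t.2.2 i) (t.2.2 j)).trans
      ((hs.rel_eq hij (s.2.2 i) (s.2.2 j)).trans (by rw [h])).symm

/-! ### Words of leaves as invariants of the dual operad -/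

section WordMap

variable {K : Type u} [Field K] {X I J : Type}

open Classical in
variable (K I) in
/-- The word of the leaves of a monomial in the operation `x`; the other monomials are sent to
zero. -/
noncomputable def wordMap (x : X) : Free K X I →ₗ[K] (List I →₀ K) :=
  Finsupp.linearCombination K fun t => if t.1.IsMono x then Finsupp.single t.1.leaves 1 else 0

open Classical in
theorem wordMap_single (x : X) (t : MTerm X I) (a : K) : wordMap K I x (Finsupp.single t a) =
    if t.1.IsMono x then Finsupp.single t.1.leaves a else 0 := by
  rw [wordMap, Finsupp.linearCombination_single]
  split_ifs <;> simp

theorem wordMap_freeMap (x : X) (f : I ≃ J) (p : Free K X I) :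
    wordMap K J x (freeMap K f p) = Finsupp.lmapDomain K K (List.map f) (wordMap K I x p) := by
  classical
  induction p using Finsupp.induction_linear with
  | zero => simp
  | add f g hf hg => simp only [map_add, hf, hg]
  | single t a =>
    have h : (t.relabel f).1.IsMono x ↔ t.1.IsMono x := BinTerm.isMono_relabel
    rw [freeMap_single, wordMap_single, wordMap_single, if_congr h rfl rfl]
    split_ifs
    · rw [Finsupp.lmapDomain_apply, Finsupp.mapDomain_single]
      exact congrArg (Finsupp.single · a) (BinTerm.leaves_relabel f t.1)
    · rw [map_zero]

open Classical in
/-- Substitution of the word `m` for the letter `i`. -/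
noncomputable def substWord (i : I) (l : List I) (m : List J) : List ({k : I // k ≠ i} ⊕ J) :=
  l.flatMap fun k => if h : k = i then m.map Sum.inr else [Sum.inl ⟨k, h⟩]

theorem leaves_subst (i : I) (t : BinTerm X I) (s : BinTerm X J) :
    (t.subst i s).leaves = substWord i t.leaves s.leaves := by
  rw [BinTerm.subst, BinTerm.leaves_bind, substWord]
  congr 1
  funext k
  by_cases h : k = i
  · subst h
    rw [BinTerm.plug_self, BinTerm.leaves_relabel, dif_pos rfl]
  · rw [BinTerm.plug_of_ne _ _ _ h, dif_neg h, BinTerm.leaves]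

theorem wordMap_freeComp (x : X) (i : I) (p : Free K X I) (q : Free K X J) :
    wordMap K _ x (freeComp K i p q) =
      Finsupp.linearCombination K (fun l : List I => Finsupp.lmapDomain K K (substWord (J := J) i l))
        (wordMap K I x p) (wordMap K J x q) := by
  classical
  induction p using Finsupp.induction_linear with
  | zero => simp
  | add f g hf hg => simp only [map_add, LinearMap.add_apply, hf, hg]
  | single t a =>
    induction q using Finsupp.induction_linear with
    | zero => simp
    | add f g hf hg => simp only [map_add, hf, hg]
    | single s b =>
      have h : (t.subst i s).1.IsMono x ↔ t.1.IsMono x ∧ s.1.IsMono x :=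
        BinTerm.isMono_subst (t.2.2 i)
      rw [freeComp_single, wordMap_single, wordMap_single, wordMap_single, if_congr h rfl rfl]
      by_cases h1 : t.1.IsMono x
      · by_cases h2 : s.1.IsMono x
        · rw [if_pos ⟨h1, h2⟩, if_pos h1, if_pos h2, Finsupp.linearCombination_single,
            LinearMap.smul_apply, Finsupp.lmapDomain_apply, Finsupp.mapDomain_single,
            Finsupp.smul_single, smul_eq_mul]
          exact congrArg (Finsupp.single · _) (leaves_subst i t.1 s.1)
        · rw [if_neg fun h => h2 h.2, if_neg h2, map_zero]
      · rw [if_neg fun h => h1 h.1, if_neg h1, map_zero, LinearMap.zero_apply]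

/-- The two bracketings have the same word, and mixed monomials are sent to zero. The kernel is an
ideal because words compose by substitution. -/
theorem relIdeal_le_ker_wordMap (x : TwoOp) (I : Type) [Finite I] :
    relIdeal (twoAsZeroRel K) I ≤ LinearMap.ker (wordMap K I x) := by
  classical
  refine relIdeal_le (fun I _ => LinearMap.ker (wordMap K I x)) ?_ ?_ ?_ ?_ I
  · refine sup_le (Submodule.span_le.2 ?_) (Submodule.span_le.2 ?_)
    · rintro _ ⟨y, σ, rfl⟩
      rw [SetLike.mem_coe, LinearMap.mem_ker, map_sub, wordMap_single, wordMap_single,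
        leftComb_val, rightComb_val]
      simp [BinTerm.IsMono, BinTerm.leaves]
    · rintro _ ⟨y, z, σ, h, rfl | rfl⟩ <;>
      · have h' : ¬ (y = x ∧ z = x) := fun hz => h (hz.1.trans hz.2.symm)
        rw [SetLike.mem_coe, LinearMap.mem_ker, wordMap_single]
        simp only [leftComb_val, rightComb_val, BinTerm.IsMono]
        simp [h']
  · intro I J _ _ f p hp
    rw [LinearMap.mem_ker] at hp ⊢
    rw [wordMap_freeMap, hp, map_zero]
  · intro I J _ _ i p q hp
    rw [LinearMap.mem_ker] at hp ⊢
    rw [wordMap_freeComp, hp, map_zero, LinearMap.zero_apply]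
  · intro I J _ _ i p q hq
    rw [LinearMap.mem_ker] at hq ⊢
    rw [wordMap_freeComp, hq, map_zero]

end WordMap

/-! ### Vanishing of mixed monomials and coordinates on the dual operad -/

section DualOperad

variable {K : Type u} [Field K] {I : Type} [Finite I]

/-- The monomials which involve both operations vanish in the dual operad. -/
theorem mem_relIdeal_or_isMono (I : Type) [Finite I] (t : MTerm TwoOp I) :
    (Finsupp.single t 1 : Free K TwoOp I) ∈ relIdeal (twoAsZeroRel K) I ∨ ∃ x, t.1.IsMono x := by
  refine MTerm.induction (C := fun I _ t => (Finsupp.single t 1 : Free K TwoOp I) ∈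
    relIdeal (twoAsZeroRel K) I ∨ ∃ x, t.1.IsMono x) ?_ ?_ ?_ I t
  · intro I J _ _ f t ih
    refine ih.imp (fun h => ?_) fun ⟨x, h⟩ => ⟨x, BinTerm.isMono_relabel.2 h⟩
    have := freeMap_mem_relIdeal f h
    rwa [freeMap_single] at this
  · exact .inr ⟨.star, trivial⟩
  · intro I J _ _ x l r hl hr
    -- A left factor that is a product for `z ≠ x` makes the whole monomial an instance `x(z(a, b),
    -- r)` of a vanishing comb. A leaf counts as a monomial in any operation.
    have key_left : (Finsupp.single (MTerm.node x l r) 1 : Free K TwoOp (I ⊕ J)) ∈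
        relIdeal (twoAsZeroRel K) (I ⊕ J) ∨ l.1.IsMono x := by
      rcases hl with hl | ⟨y, hy⟩
      · have := freeNode_mem_relIdeal_left x (Finsupp.single r 1) hl
        rw [freeNode_single, one_mul] at this
        exact .inl this
      · rcases l.exists_node with ⟨i, hi, -⟩ | ⟨z, A, _, a, b, hab⟩
        · rw [hi]
          exact .inr trivial
        · obtain rfl : z = y := by
            rw [hab] at hy
            exact (BinTerm.isMono_relabel.1 hy).1
          by_cases hxz : x = z
          · exact .inr (hxz ▸ hy)
          · left
            have := freeMap_mem_relIdeal (Equiv.sumCongr (Equiv.sumCompl A) (Equiv.refl J))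
              (plugThree_mem a b r (leftComb_mem_twoAsZeroRel (K := K) hxz 1))
            rwa [plugThree_leftComb, freeMap_single, ← MTerm.node_relabel, ← hab,
              MTerm.relabel_refl] at this
    have key_right : (Finsupp.single (MTerm.node x l r) 1 : Free K TwoOp (I ⊕ J)) ∈
        relIdeal (twoAsZeroRel K) (I ⊕ J) ∨ r.1.IsMono x := by
      rcases hr with hr | ⟨y, hy⟩
      · have := freeNode_mem_relIdeal_right x (Finsupp.single l 1) hr
        rw [freeNode_single, one_mul] at this
        exact .inl this
      · rcases r.exists_node with ⟨i, hi, -⟩ | ⟨z, A, _, a, b, hab⟩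
        · rw [hi]
          exact .inr trivial
        · obtain rfl : z = y := by
            rw [hab] at hy
            exact (BinTerm.isMono_relabel.1 hy).1
          by_cases hxz : x = z
          · exact .inr (hxz ▸ hy)
          · left
            have := freeMap_mem_relIdeal ((Equiv.sumAssoc _ _ _).trans
              (Equiv.sumCongr (Equiv.refl I) (Equiv.sumCompl A)))
              (plugThree_mem l a b (rightComb_mem_twoAsZeroRel (K := K) hxz 1))
            rw [plugThree_rightComb, freeMap_single, MTerm.relabel_relabel, ← Equiv.trans_assoc,
              Equiv.symm_trans_self, Equiv.refl_trans, ← MTerm.node_relabel, ← hab,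
              MTerm.relabel_refl] at this
            exact this
    rcases key_left with h | h
    · exact .inl h
    · rcases key_right with h' | h'
      · exact .inl h'
      · exact .inr ⟨x, rfl, BinTerm.isMono_relabel.2 h, BinTerm.isMono_relabel.2 h'⟩

theorem assocIn_twoAsZeroRel : AssocIn (twoAsZeroRel K) := fun x => assoc_mem_twoAsZeroRel x 1

variable {R : Submodule K (Free K TwoOp (Fin 3))}

theorem quadMk_eq_zero (hR : R = twoAsZeroRel K) {t : MTerm TwoOp I} (ht : ∀ x, ¬ t.1.IsMono x) :
    quadMk R t = 0 := by
  subst hR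
  exact (Submodule.Quotient.mk_eq_zero _).2
    ((mem_relIdeal_or_isMono I t).resolve_right fun ⟨x, h⟩ => ht x h)

theorem quadMk_eq_quadMk (hR : R = twoAsZeroRel K) {x : TwoOp} {t s : MTerm TwoOp I}
    (ht : t.1.IsMono x) (hs : s.1.IsMono x) (h : t.1.leaves = s.1.leaves) :
    quadMk R t = quadMk R s := by
  subst hR
  exact (Submodule.Quotient.eq _).2
    (relEquiv_of_rel_eq assocIn_twoAsZeroRel t s (MTerm.rel_eq_of_isMono ht hs h))

/-- The coefficient of a word descends to the quotient; these functionals separate the permuted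
iterated products. -/
theorem exists_wordCoord (hR : R = twoAsZeroRel K) (x : TwoOp) (w : List I) :
    ∃ f : Module.Dual K ((quadOperad R).obj I),
      ∀ t : MTerm TwoOp I, f (quadMk R t) = wordMap K I x (Finsupp.single t 1) w := by
  subst hR
  exact ⟨(relIdeal (twoAsZeroRel K) I).liftQ (Finsupp.lapply w ∘ₗ wordMap K I x)
    ((relIdeal_le_ker_wordMap x I).trans (LinearMap.ker_le_ker_comp _ _)), fun t => rfl⟩

end DualOperad

end Operadic

namespace Operadic

/-! ## Permutations -/

section Permutations

variable {n : ℕ}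

/-- The permutation of `Fin (n + 1)` which fixes `0` and acts by `σ` on the other elements. -/
def permCons (σ : Equiv.Perm (Fin n)) : Equiv.Perm (Fin (n + 1)) :=
  Equiv.Perm.decomposeFin.symm (0, σ)

theorem permCons_zero (σ : Equiv.Perm (Fin n)) : permCons σ 0 = 0 :=
  Equiv.Perm.decomposeFin_symm_apply_zero 0 σ

theorem permCons_succ (σ : Equiv.Perm (Fin n)) (k : Fin n) : permCons σ k.succ = (σ k).succ := by
  rw [permCons, Equiv.Perm.decomposeFin_symm_apply_succ, Equiv.swap_self, Equiv.refl_apply]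

theorem sign_permCons (σ : Equiv.Perm (Fin n)) :
    Equiv.Perm.sign (permCons σ) = Equiv.Perm.sign σ := by
  rw [permCons, Equiv.Perm.decomposeFin.symm_sign, if_pos rfl, one_mul]

/-- The permutation which sends `0` to `a`, `1` to the element `b` of the complement of `a`, and is
increasing on the other elements. -/
def pairShuffle (a : Fin (n + 2)) (b : Fin (n + 1)) : Equiv.Perm (Fin (n + 2)) :=
  a.cycleRange.symm * permCons b.cycleRange.symm

theorem pairShuffle_zero (a : Fin (n + 2)) (b : Fin (n + 1)) : pairShuffle a b 0 = a := by
  rw [pairShuffle, Equiv.Perm.mul_apply, permCons_zero, Fin.cycleRange_symm_zero]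

theorem pairShuffle_one (a : Fin (n + 2)) (b : Fin (n + 1)) :
    pairShuffle a b 1 = a.succAbove b := by
  rw [pairShuffle, Equiv.Perm.mul_apply, ← Fin.succ_zero_eq_one, permCons_succ,
    Fin.cycleRange_symm_zero, Fin.cycleRange_symm_succ]

theorem pairShuffle_succ_succ (a : Fin (n + 2)) (b : Fin (n + 1)) (k : Fin n) :
    pairShuffle a b k.succ.succ = a.succAbove (b.succAbove k) := by
  rw [pairShuffle, Equiv.Perm.mul_apply, permCons_succ, Fin.cycleRange_symm_succ,
    Fin.cycleRange_symm_succ]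

/-- Once the images of `0` and `1` are fixed, both permutations enumerate the remaining elements
increasingly, and an increasing enumeration is determined by its range. -/
theorem mem_pairShuffles {ρ : Equiv.Perm (Fin (n + 2))} :
    ρ ∈ pairShuffles n ↔ ∃ a b, pairShuffle a b = ρ := by
  rw [pairShuffles, Finset.mem_filter, and_iff_right (Finset.mem_univ _)]
  constructor
  · intro h
    obtain ⟨b, hb⟩ := Fin.exists_succAbove_eq (x := ρ 1) (y := ρ 0)
      (ρ.injective.ne (by simp))
    refine ⟨ρ 0, b, ?_⟩
    have hmono : StrictMono fun k : Fin n => ρ k.succ.succ := fun k l hkl =>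
      h _ _ (by simp) (by simpa using hkl)
    have hmono' : StrictMono fun k : Fin n => (ρ 0).succAbove (b.succAbove k) :=
      (Fin.strictMono_succAbove _).comp (Fin.strictMono_succAbove _)
    have hrange : (fun k : Fin n => ρ k.succ.succ) =
        fun k : Fin n => (ρ 0).succAbove (b.succAbove k) := by
      refine (hmono.range_inj hmono').1 (Set.ext fun i => ⟨?_, ?_⟩)
      · rintro ⟨k, rfl⟩
        obtain ⟨c, hc⟩ := Fin.exists_succAbove_eq (x := ρ k.succ.succ) (y := ρ 0)
          (ρ.injective.ne (Fin.succ_ne_zero _))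
        obtain ⟨d, rfl⟩ := Fin.exists_succAbove_eq (x := c) (y := b) (by
          rintro rfl
          rw [hb] at hc
          rw [← Fin.succ_zero_eq_one] at hc
          exact Fin.succ_ne_zero k (Fin.succ_injective _ (ρ.injective hc)).symm)
        exact ⟨d, hc⟩
      · rintro ⟨k, rfl⟩
        obtain ⟨i, hi⟩ := ρ.surjective ((ρ 0).succAbove (b.succAbove k))
        rcases i.eq_zero_or_eq_succ with rfl | ⟨i, rfl⟩
        · exact absurd hi.symm (Fin.succAbove_ne _ _)
        · rcases i.eq_zero_or_eq_succ with rfl | ⟨i, rfl⟩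
          · rw [Fin.succ_zero_eq_one, ← hb] at hi
            exact absurd (Fin.succAbove_right_injective hi).symm (Fin.succAbove_ne _ _)
          · exact ⟨i, hi⟩
    refine Equiv.ext fun i => ?_
    rcases i.eq_zero_or_eq_succ with rfl | ⟨i, rfl⟩
    · exact pairShuffle_zero _ _
    · rcases i.eq_zero_or_eq_succ with rfl | ⟨i, rfl⟩
      · rw [Fin.succ_zero_eq_one, pairShuffle_one, hb]
      · rw [pairShuffle_succ_succ]
        exact (congrFun hrange i).symm
  · rintro ⟨a, b, rfl⟩ k l hk hkl
    obtain ⟨k, rfl⟩ : ∃ k' : Fin n, k = k'.succ.succ :=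
      ⟨⟨k.1 - 2, by omega⟩, Fin.ext (by simp only [Fin.val_succ]; omega)⟩
    obtain ⟨l, rfl⟩ : ∃ l' : Fin n, l = l'.succ.succ :=
      ⟨⟨l.1 - 2, by have : k.succ.succ.1 < l.1 := hkl; omega⟩, Fin.ext (by
        have : k.succ.succ.1 < l.1 := hkl
        simp only [Fin.val_succ] at this ⊢; omega)⟩
    rw [pairShuffle_succ_succ, pairShuffle_succ_succ]
    exact Fin.strictMono_succAbove _ (Fin.strictMono_succAbove _ (by simpa using hkl))

theorem pairShuffle_injective :
    Function.Injective fun p : Fin (n + 2) × Fin (n + 1) => pairShuffle p.1 p.2 := by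
  rintro ⟨a, b⟩ ⟨a', b'⟩ h
  have h : pairShuffle a b = pairShuffle a' b' := h
  obtain rfl : a = a' := by rw [← pairShuffle_zero a b, h, pairShuffle_zero]
  have h1 : a.succAbove b = a.succAbove b' := by rw [← pairShuffle_one, h, pairShuffle_one]
  rw [Fin.succAbove_right_injective h1]

/-- The permutation of `Fin (n + 2)` obtained from `τ` by doubling the element `0`. -/
def permDouble (τ : Equiv.Perm (Fin (n + 1))) : Equiv.Perm (Fin (n + 2)) :=
  permCons τ * (τ.symm 0).castSucc.cycleRange

theorem permDouble_castSucc (τ : Equiv.Perm (Fin (n + 1))) :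
    permDouble τ (τ.symm 0).castSucc = 0 := by
  rw [permDouble, Equiv.Perm.mul_apply, Fin.cycleRange_self, permCons_zero]

theorem permDouble_succAbove (τ : Equiv.Perm (Fin (n + 1))) (k : Fin (n + 1)) :
    permDouble τ ((τ.symm 0).castSucc.succAbove k) = (τ k).succ := by
  rw [permDouble, Equiv.Perm.mul_apply, Fin.cycleRange_succAbove, permCons_succ]

/-- The cycle bringing position `j` to `0` has sign `(-1)^j`. This is the source of the alternating
signs of `b'`. -/
theorem sign_permDouble (τ : Equiv.Perm (Fin (n + 1))) :
    Equiv.Perm.sign (permDouble τ) = Equiv.Perm.sign τ * (-1) ^ (τ.symm 0).val := by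
  rw [permDouble, Equiv.Perm.sign_mul, sign_permCons, Fin.sign_cycleRange, Fin.val_castSucc]

/-- A permutation of `Fin (n + 2)` and two consecutive elements correspond to the choice of two
elements and a permutation of `Fin (n + 1)`. -/
theorem shuffle_bijective : Function.Bijective
    fun p : (Fin (n + 2) × Fin (n + 1)) × Equiv.Perm (Fin (n + 1)) =>
      (pairShuffle p.1.1 p.1.2 * permDouble p.2, p.2.symm 0) := by
  rw [Fintype.bijective_iff_injective_and_card]
  -- Both sides have `(n + 2) (n + 1) (n + 1)!` elements, so injectivity suffices. The composite
  -- permutation sends `j` and `j + 1` to the chosen pair, where `j` is the second component, so the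
  -- pair is recovered first and `τ` afterwards.
  constructor
  · rintro ⟨⟨a, b⟩, τ⟩ ⟨⟨a', b'⟩, τ'⟩ h
    obtain ⟨h, hj⟩ := Prod.mk.inj h
    dsimp only at h hj
    have h0 := Equiv.congr_fun h (τ.symm 0).castSucc
    rw [Equiv.Perm.mul_apply, Equiv.Perm.mul_apply, permDouble_castSucc, hj, permDouble_castSucc,
      pairShuffle_zero, pairShuffle_zero] at h0
    subst h0
    have h1 := Equiv.congr_fun h ((τ.symm 0).castSucc.succAbove (τ.symm 0))
    rw [Equiv.Perm.mul_apply, Equiv.Perm.mul_apply, permDouble_succAbove, hj, permDouble_succAbove,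
      ← hj, Equiv.apply_symm_apply, hj, Equiv.apply_symm_apply, Fin.succ_zero_eq_one,
      pairShuffle_one, pairShuffle_one] at h1
    obtain rfl := Fin.succAbove_right_injective h1
    have hd : permDouble τ = permDouble τ' := mul_left_cancel h
    congr 1
    refine Equiv.ext fun k => Fin.succ_injective _ ?_
    rw [← permDouble_succAbove, ← permDouble_succAbove, hd, hj]
  · simp only [Fintype.card_prod, Fintype.card_fin, Fintype.card_perm, Nat.factorial_succ]
    ring

/-- Reindexing by `shuffle_bijective`: choosing a pair of inputs and then ordering the result is the
same as ordering all the inputs and choosing two consecutive ones. -/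
theorem sum_pairShuffles {K M : Type*} [Field K] [AddCommGroup M] [Module K M]
    (F : Equiv.Perm (Fin (n + 2)) → Fin (n + 1) → M) :
    ∑ ρ ∈ pairShuffles n, ((Equiv.Perm.sign ρ : ℤ) : K) • ∑ τ : Equiv.Perm (Fin (n + 1)),
        ((Equiv.Perm.sign τ : ℤ) : K) • F (ρ * permDouble τ) (τ.symm 0) =
      ∑ π, ((Equiv.Perm.sign π : ℤ) : K) • ∑ j, (-1 : K) ^ j.val • F π j := by
  classical
  have himage : pairShuffles n =
      Finset.univ.image fun p : Fin (n + 2) × Fin (n + 1) => pairShuffle p.1 p.2 := by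
    ext ρ
    simp [mem_pairShuffles]
  rw [himage, Finset.sum_image pairShuffle_injective.injOn]
  simp only [Finset.smul_sum, smul_smul]
  have key : ∀ p : (Fin (n + 2) × Fin (n + 1)) × Equiv.Perm (Fin (n + 1)),
      ((Equiv.Perm.sign (pairShuffle p.1.1 p.1.2 * permDouble p.2) : ℤ) : K) *
        (-1) ^ (p.2.symm 0).val =
      ((Equiv.Perm.sign (pairShuffle p.1.1 p.1.2) : ℤ) : K) * ((Equiv.Perm.sign p.2 : ℤ) : K) := by
    intro p
    rw [Equiv.Perm.sign_mul, sign_permDouble]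
    push_cast
    rw [mul_assoc, mul_assoc, ← pow_add, Even.neg_one_pow ⟨_, rfl⟩, mul_one]
  have hsum := (shuffle_bijective (n := n)).sum_comp fun q : Equiv.Perm (Fin (n + 2)) × Fin (n + 1) =>
    (((Equiv.Perm.sign q.1 : ℤ) : K) * (-1) ^ q.2.val) • F q.1 q.2
  dsimp only at hsum
  simp only [key] at hsum
  rw [Fintype.sum_prod_type, Fintype.sum_prod_type (f := fun q : Equiv.Perm (Fin (n + 2)) ×
    Fin (n + 1) => (((Equiv.Perm.sign q.1 : ℤ) : K) * (-1) ^ q.2.val) • F q.1 q.2)] at hsum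
  exact hsum

/-- The word obtained by doubling the letter in position `j`: earlier letters keep their positions,
and later ones move by one. -/
theorem flatMap_finRange {α : Type*} : ∀ (n : ℕ) (j : Fin (n + 1)) (f : Fin (n + 1) → List α)
    (h : Fin (n + 2) → α), (∀ k < j, f k = [h k.castSucc]) → f j = [h j.castSucc, h j.succ] →
    (∀ k, j < k → f k = [h k.succ]) → (List.finRange (n + 1)).flatMap f =
      (List.finRange (n + 2)).map h := by
  have tail : ∀ (m : ℕ) (f : Fin m → List α) (h : Fin m → α), (∀ k, f k = [h k]) →
      (List.finRange m).flatMap f = (List.finRange m).map h := by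
    intro m f h hf
    rw [funext hf, List.map_eq_flatMap]
  intro n
  induction n with
  | zero =>
    intro j f h _ hj _
    obtain rfl : j = 0 := Fin.eq_zero j
    simp [List.finRange_succ, hj]
  | succ n ih =>
    intro j f h hlt hj hgt
    rw [List.finRange_succ, List.flatMap_cons, List.flatMap_map]
    rcases j.eq_zero_or_eq_succ with rfl | ⟨j, rfl⟩
    · rw [hj, tail _ _ (fun k => h k.succ.succ) fun k => hgt _ (Fin.succ_pos k),
        List.finRange_succ (n := n + 2), List.finRange_succ (n := n + 1)]
      simp [Function.comp_def]
    · rw [hlt 0 (Fin.succ_pos j), ih j (fun k => f k.succ) (fun k => h k.succ)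
        (fun k hk => hlt k.succ (Fin.succ_lt_succ_iff.2 hk)) hj
        (fun k hk => hgt k.succ (Fin.succ_lt_succ_iff.2 hk)), List.finRange_succ (n := n + 2)]
      simp [Function.comp_def]

theorem exists_perm_map_finRange {l : List (Fin n)} (hl : l.Nodup) (h : ∀ i, i ∈ l) :
    ∃ σ : Equiv.Perm (Fin n), (List.finRange n).map σ = l := by
  have hlen : l.length = n := by
    rw [((List.perm_ext_iff_of_nodup hl (List.nodup_finRange n)).2 fun i => by simp [h i]).length_eq,
      List.length_finRange]
  have hinj : Function.Injective fun i : Fin n => l[i.val]'(by rw [hlen]; exact i.2) :=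
    fun i j hij => Fin.ext (hl.getElem_inj_iff.1 hij)
  refine ⟨Equiv.ofBijective _ (Finite.injective_iff_bijective.1 hinj), ?_⟩
  refine List.ext_getElem (by simp [hlen]) fun i _ _ => by simp

end Permutations

end Operadic

namespace Operadic

/-! ## The iterated products in the dual operad -/

section Powers

variable {X : Type}

theorem isMono_powTerm (x : X) (n : ℕ) : (powTerm x n).IsMono x := by
  induction n with
  | zero => trivial
  | succ n ih => exact ⟨rfl, BinTerm.isMono_relabel.2 ih, trivial⟩

/-- At least one vertex is needed, since a leaf is a monomial in every operation. The restriction to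
arity at least two below comes from here. -/
theorem eq_of_isMono_powTerm {x y : X} {n : ℕ} (h : (powTerm x (n + 1)).IsMono y) : x = y := h.1

theorem leaves_powTerm (x : X) (n : ℕ) : (powTerm x n).leaves = List.finRange (n + 1) := by
  induction n with
  | zero => rfl
  | succ n ih =>
    rw [powTerm, BinTerm.leaves, BinTerm.leaves_relabel, ih, List.finRange_succ_last (n := n + 1)]
    rfl

variable {K : Type u} [Field K]

theorem map_powElem {R : Submodule K (Free K X (Fin 3))} (x : X) {n : ℕ}
    (σ : Equiv.Perm (Fin (n + 1))) :
    (quadOperad R).map σ (powElem R x (n + 1)) =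
      quadMk R (MTerm.relabel σ ⟨powTerm x n, isMultilinear_powTerm x n⟩) :=
  quadOperad_map_quadMk R σ _

variable {R : Submodule K (Free K TwoOp (Fin 3))}

/-- The coordinate of the identity word in the operation `x`. Together with `dual_ext` it shows that
the dual operad is free over the symmetric group on the two iterated products. -/
theorem exists_dualVector (hR : R = twoAsZeroRel K) (n : ℕ) (x : TwoOp) :
    ∃ f : Module.Dual K ((quadOperad R).obj (Fin (n + 2))), ∀ y σ,
      f ((quadOperad R).map σ (powElem R y (n + 2))) = if y = x ∧ σ = 1 then 1 else 0 := by
  classical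
  obtain ⟨f, hf⟩ := exists_wordCoord (K := K) (I := Fin (n + 2)) hR x (List.finRange (n + 2))
  refine ⟨f, fun y σ => ?_⟩
  have hleaves : (MTerm.relabel σ ⟨powTerm y (n + 1), isMultilinear_powTerm y (n + 1)⟩).1.leaves =
      (List.finRange (n + 2)).map σ :=
    (BinTerm.leaves_relabel σ _).trans (by rw [leaves_powTerm])
  have hmono : (MTerm.relabel σ ⟨powTerm y (n + 1), isMultilinear_powTerm y (n + 1)⟩).1.IsMono x ↔
      y = x :=
    BinTerm.isMono_relabel.trans ⟨eq_of_isMono_powTerm, fun h => h ▸ isMono_powTerm y _⟩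
  have hσ : (List.finRange (n + 2)).map σ = List.finRange (n + 2) ↔ σ = 1 := by
    constructor
    · intro h
      refine Equiv.ext fun i => ?_
      have h' : (List.finRange (n + 2)).map σ = (List.finRange (n + 2)).map id := by
        rw [h, List.map_id]
      exact List.map_inj_left.1 h' i (List.mem_finRange i)
    · rintro rfl
      exact List.map_id _
  rw [map_powElem, hf, wordMap_single, if_congr hmono rfl rfl, hleaves]
  by_cases hy : y = x
  · rw [if_pos hy, Finsupp.single_apply, if_congr hσ rfl rfl]
    simp only [hy, true_and]
  · rw [if_neg hy, if_neg fun h => hy h.1, Finsupp.zero_apply]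

/-- The permuted iterated products span: a mixed monomial vanishes, and any other equals the
permuted product with the same word. -/
theorem dual_ext (hR : R = twoAsZeroRel K) {n : ℕ}
    {f g : Module.Dual K ((quadOperad R).obj (Fin (n + 2)))}
    (h : ∀ x σ, f ((quadOperad R).map σ (powElem R x (n + 2))) =
      g ((quadOperad R).map σ (powElem R x (n + 2)))) : f = g := by
  have key : ∀ t : MTerm TwoOp (Fin (n + 2)), f (quadMk R t) = g (quadMk R t) := by
    intro t
    by_cases ht : ∃ x, t.1.IsMono x
    · obtain ⟨x, ht⟩ := ht
      obtain ⟨σ, hσ⟩ := exists_perm_map_finRange t.2.1 t.2.2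
      have := h x σ
      rwa [map_powElem, quadMk_eq_quadMk hR (BinTerm.isMono_relabel.2 (isMono_powTerm x (n + 1))) ht
        ((BinTerm.leaves_relabel σ _).trans (by rw [leaves_powTerm, hσ]))] at this
    · rw [quadMk_eq_zero hR (not_exists.1 ht), map_zero, map_zero]
  refine LinearMap.ext fun p => ?_
  obtain ⟨p, rfl⟩ := Submodule.Quotient.mk_surjective _ p
  change Free K TwoOp (Fin (n + 2)) at p
  have hlin : f ∘ₗ (relIdeal R (Fin (n + 2))).mkQ = g ∘ₗ (relIdeal R (Fin (n + 2))).mkQ :=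
    Finsupp.lhom_ext' fun t => LinearMap.ext_ring (key t)
  exact LinearMap.congr_fun hlin p

/-- The composite of an iterated product with a generator at the first input. -/
theorem insertFront_powElem (hR : R = twoAsZeroRel K) (x y : TwoOp) {n : ℕ}
    (τ : Equiv.Perm (Fin (n + 2))) :
    insertFront R x (n + 1) ((quadOperad R).map τ (powElem R y (n + 2))) =
      if y = x then (quadOperad R).map (permDouble τ) (powElem R y (n + 3)) else 0 := by
  let p : MTerm TwoOp (Fin (n + 2)) := ⟨powTerm y (n + 1), isMultilinear_powTerm y (n + 1)⟩
  have h1 : insertFront R x (n + 1) ((quadOperad R).map τ (powElem R y (n + 2))) =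
      quadMk R (((p.relabel τ).subst 0 (MTerm.gen x)).relabel (frontEquiv (n + 1))) := by
    rw [map_powElem, insertFront, LinearMap.comp_apply, LinearMap.flip_apply,
      quadOperad_comp_quadMk, quadOperad_map_quadMk]
  have hmono : ∀ z, (((p.relabel τ).subst 0 (MTerm.gen x)).relabel (frontEquiv (n + 1))).1.IsMono z ↔
      (powTerm y (n + 1)).IsMono z ∧ x = z := fun z =>
    BinTerm.isMono_relabel.trans ((BinTerm.isMono_subst ((p.relabel τ).2.2 0)).trans
      (and_congr BinTerm.isMono_relabel ⟨fun h => h.1, fun h => ⟨h, trivial, trivial⟩⟩))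
  rw [h1]
  split_ifs with hxy
  · subst hxy
    rw [map_powElem]
    refine quadMk_eq_quadMk hR ((hmono y).2 ⟨isMono_powTerm y _, rfl⟩)
      (BinTerm.isMono_relabel.2 (isMono_powTerm y _)) ?_
    have h2 : (MTerm.relabel (permDouble τ)
        ⟨powTerm y (n + 2), isMultilinear_powTerm y (n + 2)⟩).1.leaves =
          (List.finRange (n + 3)).map (permDouble τ) :=
      (BinTerm.leaves_relabel _ _).trans (by rw [leaves_powTerm])
    have h3 : (((p.relabel τ).subst 0 (MTerm.gen y)).relabel (frontEquiv (n + 1))).1.leaves =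
        (List.finRange (n + 2)).flatMap fun k => if τ k = 0 then [0, 1] else [(τ k).succ] := by
      refine (BinTerm.leaves_relabel _ _).trans ?_
      change List.map _ (BinTerm.subst 0 (BinTerm.relabel τ (powTerm y (n + 1))) _).leaves = _
      rw [leaves_subst, BinTerm.leaves_relabel, leaves_powTerm, substWord, List.flatMap_map,
        List.map_flatMap]
      congr 1
      funext k
      by_cases hk : τ k = 0
      · rw [dif_pos hk, if_pos hk]
        rfl
      · rw [dif_neg hk, if_neg hk]
        rfl
    rw [h2, h3]
    -- The input being replaced stands in position `τ.symm 0`; it becomes the pair `0, 1`, and all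
    -- other labels are shifted by one.
    refine flatMap_finRange (n + 1) (τ.symm 0) _ _ (fun k hk => ?_) ?_ (fun k hk => ?_)
    · have hne : τ k ≠ 0 := fun e => hk.ne (τ.eq_symm_apply.2 e)
      rw [if_neg hne, ← permDouble_succAbove, Fin.succAbove_castSucc_of_lt _ _ hk]
    · rw [τ.apply_symm_apply, if_pos rfl, permDouble_castSucc]
      have := permDouble_succAbove τ (τ.symm 0)
      rw [Fin.succAbove_castSucc_self, τ.apply_symm_apply, Fin.succ_zero_eq_one] at this
      rw [this]
    · have hne : τ k ≠ 0 := fun e => hk.ne' (τ.eq_symm_apply.2 e)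
      rw [if_neg hne, ← permDouble_succAbove, Fin.succAbove_castSucc_of_le _ _ hk.le]
  · exact quadMk_eq_zero hR fun z hz =>
      hxy ((eq_of_isMono_powTerm ((hmono z).1 hz).1).trans ((hmono z).1 hz).2.symm)

end Powers

/-! ## The projections of the Koszul complex onto the Hochschild complexes -/

section Projection

variable {K : Type u} [Field K] {A : Type v} [AddCommGroup A] [Module K A]

theorem permAct_tmul (P : SymOperad K) {n : ℕ} (σ : Equiv.Perm (Fin n))
    (φ : Module.Dual K (P.obj (Fin n))) (a : ⨂[K] _ : Fin n, A) :
    permAct A P σ (φ ⊗ₜ a) =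
      (φ ∘ₗ P.map σ.symm) ⊗ₜ[K] PiTensorProduct.reindex K (fun _ : Fin n => A) σ a := rfl

theorem permAct_permAct (P : SymOperad K) {n : ℕ} (σ τ : Equiv.Perm (Fin n)) (m : KoszulPre A P n) :
    permAct A P σ (permAct A P τ m) = permAct A P (σ * τ) m := by
  induction m using TensorProduct.induction_on with
  | zero => simp
  | add m m' h h' => rw [map_add, map_add, map_add, h, h']
  | tmul φ a =>
    rw [permAct_tmul, permAct_tmul, permAct_tmul]
    congr 1
    · refine LinearMap.ext fun p => congrArg φ ?_
      exact (P.map_trans σ.symm τ.symm p).symm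
    · exact LinearEquiv.congr_fun (PiTensorProduct.reindex_trans (R := K) (s := fun _ => A) τ σ) a

section

variable {X : Type} (R : Submodule K (Free K X (Fin 3))) (x : X) {n : ℕ}

theorem koszulProj_tmul (φ : Module.Dual K ((quadDual R).obj (Fin n))) (a : ⨂[K] _ : Fin n, A) :
    koszulProj A R x n (φ ⊗ₜ a) = ∑ σ : Equiv.Perm (Fin n), ((Equiv.Perm.sign σ : ℤ) : K) •
      φ ((quadDual R).map σ (powElem (quadDualRel R) x n)) •
        PiTensorProduct.reindex K (fun _ : Fin n => A) σ.symm a := by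
  rw [koszulProj, LinearMap.sum_apply]
  rfl

/-- Reindexing the signed sum by left multiplication with `τ` produces the sign, so the projections
vanish on the coinvariance relations. -/
theorem koszulProj_permAct (τ : Equiv.Perm (Fin n)) (m : KoszulPre A (quadDual R) n) :
    koszulProj A R x n (permAct A (quadDual R) τ m) =
      ((Equiv.Perm.sign τ : ℤ) : K) • koszulProj A R x n m := by
  let L : KoszulPre A (quadDual R) n →ₗ[K] ⨂[K] _ : Fin n, A :=
    (TensorProduct.lid K _).toLinearMap ∘ₗ
      TensorProduct.map (Module.Dual.eval K _ (powElem (quadDualRel R) x n)) LinearMap.id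
  have hL : ∀ m, koszulProj A R x n m = ∑ σ : Equiv.Perm (Fin n),
      ((Equiv.Perm.sign σ : ℤ) : K) • L (permAct A (quadDual R) σ.symm m) := fun m => by
    rw [koszulProj, LinearMap.sum_apply]
    rfl
  rw [hL, hL, Finset.smul_sum, ← Equiv.sum_comp (Equiv.mulLeft τ)]
  refine Finset.sum_congr rfl fun σ _ => ?_
  have h : Equiv.symm (τ * σ) * τ = σ.symm := by
    change (τ * σ)⁻¹ * τ = σ⁻¹
    rw [mul_inv_rev, inv_mul_cancel_right]
  rw [permAct_permAct, Equiv.coe_mulLeft, h, smul_smul, Equiv.Perm.sign_mul, Units.val_mul,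
    Int.cast_mul]

theorem coinvRel_le_ker_koszulProj :
    coinvRel A (quadDual R) n ≤ LinearMap.ker (koszulProj A R x n) := by
  refine Submodule.span_le.2 ?_
  rintro _ ⟨σ, m, rfl⟩
  rw [SetLike.mem_coe, LinearMap.mem_ker, map_sub, map_smul, koszulProj_permAct, smul_smul,
    ← Int.cast_mul, ← Units.val_mul, Int.units_mul_self, Units.val_one, Int.cast_one, one_smul,
    sub_self]

end

-- The section tensors with the functional dual to the unpermuted product for `x`, for which only
-- the identity contributes to the projection. By freeness each functional is a combination of
-- translates of these two, and modulo the coinvariance relations a translate can be moved to the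
-- tensor factor, with its sign.
variable (K A) in
theorem exists_section (n : ℕ) :
    ∃ s : TwoOp → (⨂[K] _ : Fin (n + 2), A) →ₗ[K] KoszulPre A (quadDual (twoAsRel K)) (n + 2),
      (∀ x y a, koszulProj A (twoAsRel K) y (n + 2) (s x a) = if y = x then a else 0) ∧
      ∀ m, m - ∑ x, s x (koszulProj A (twoAsRel K) x (n + 2) m) ∈
        coinvRel A (quadDual (twoAsRel K)) (n + 2) := by
  classical
  choose f hf using exists_dualVector (K := K) quadDualRel_twoAsRel n
  let f' : TwoOp → Module.Dual K ((quadDual (twoAsRel K)).obj (Fin (n + 2))) := f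
  have hf' : ∀ x y σ, f' x ((quadDual (twoAsRel K)).map σ
      (powElem (quadDualRel (twoAsRel K)) y (n + 2))) = if y = x ∧ σ = 1 then 1 else 0 := hf
  refine ⟨fun x => TensorProduct.mk K _ _ (f' x), fun x y a => ?_, fun m => ?_⟩
  · rw [TensorProduct.mk_apply, koszulProj_tmul, Finset.sum_eq_single 1]
    · rw [hf']
      by_cases h : y = x
      · rw [if_pos ⟨h, rfl⟩, if_pos h, Equiv.Perm.sign_one, Units.val_one, Int.cast_one, one_smul,
          one_smul]
        exact LinearEquiv.congr_fun (PiTensorProduct.reindex_refl (R := K) (s := fun _ => A)) a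
      · rw [if_neg fun h' => h h'.1, if_neg h, zero_smul, smul_zero]
    · intro σ _ hσ
      rw [hf', if_neg fun h => hσ h.2, zero_smul, smul_zero]
    · exact fun h => absurd (Finset.mem_univ _) h
  · induction m using TensorProduct.induction_on with
    | zero => simp
    | add m m' h h' =>
      simp only [map_add, Finset.sum_add_distrib, add_sub_add_comm]
      exact Submodule.add_mem _ h h'
    | tmul φ a =>
      let w (x : TwoOp) (σ : Equiv.Perm (Fin (n + 2))) : KoszulPre A (quadDual (twoAsRel K)) (n + 2) :=
        f' x ⊗ₜ PiTensorProduct.reindex K (fun _ : Fin (n + 2) => A) σ.symm a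
      let c (x : TwoOp) (σ : Equiv.Perm (Fin (n + 2))) : K :=
        φ ((quadDual (twoAsRel K)).map σ (powElem (quadDualRel (twoAsRel K)) x (n + 2)))
      have h1 : ∀ x, TensorProduct.mk K _ _ (f' x) (koszulProj A (twoAsRel K) x (n + 2) (φ ⊗ₜ a)) =
          ∑ σ, c x σ • ((Equiv.Perm.sign σ : ℤ) : K) • w x σ := by
        intro x
        rw [koszulProj_tmul, map_sum]
        refine Finset.sum_congr rfl fun σ _ => ?_
        rw [map_smul, map_smul, smul_comm]
        rfl
      -- The expansion of `φ` in the dual basis, checked on the permuted products.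
      have hφ : φ = ∑ x, ∑ σ, c x σ • (f' x ∘ₗ (quadDual (twoAsRel K)).map σ.symm) := by
        refine dual_ext quadDualRel_twoAsRel fun y τ => ?_
        have hmap : ∀ σ : Equiv.Perm (Fin (n + 2)),
            f' y ((quadDual (twoAsRel K)).map σ.symm ((quadDual (twoAsRel K)).map τ
              (powElem (quadDualRel (twoAsRel K)) y (n + 2)))) = if σ = τ then 1 else 0 := by
          intro σ
          refine ((congrArg (f' y) ((quadDual (twoAsRel K)).map_trans τ σ.symm
            (powElem (quadDualRel (twoAsRel K)) y (n + 2)))).symm.trans (hf' y y _)).trans ?_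
          refine if_congr ((and_iff_right rfl).trans ?_) rfl rfl
          change σ⁻¹ * τ = 1 ↔ _
          rw [inv_mul_eq_one]
        have hmap' : ∀ x, x ≠ y → ∀ σ : Equiv.Perm (Fin (n + 2)),
            f' x ((quadDual (twoAsRel K)).map σ.symm ((quadDual (twoAsRel K)).map τ
              (powElem (quadDualRel (twoAsRel K)) y (n + 2)))) = 0 := by
          intro x hx σ
          refine ((congrArg (f' x) ((quadDual (twoAsRel K)).map_trans τ σ.symm
            (powElem (quadDualRel (twoAsRel K)) y (n + 2)))).symm.trans (hf' x y _)).trans ?_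
          rw [if_neg fun h => hx h.1.symm]
        change c y τ = (∑ x, ∑ σ, c x σ • (f' x ∘ₗ (quadDual (twoAsRel K)).map σ.symm))
          ((quadDual (twoAsRel K)).map τ (powElem (quadDualRel (twoAsRel K)) y (n + 2)))
        simp only [LinearMap.sum_apply, LinearMap.smul_apply, LinearMap.comp_apply]
        rw [Finset.sum_eq_single y, Finset.sum_eq_single τ]
        · rw [hmap, if_pos rfl, smul_eq_mul, mul_one]
        · intro σ _ hσ
          rw [hmap, if_neg hσ, smul_zero]
        · exact fun h => absurd (Finset.mem_univ _) h
        · intro x _ hx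
          exact Finset.sum_eq_zero fun σ _ => by rw [hmap' x hx, smul_zero]
        · exact fun h => absurd (Finset.mem_univ _) h
      have hw : ∀ x σ, permAct A (quadDual (twoAsRel K)) σ (w x σ) =
          (f' x ∘ₗ (quadDual (twoAsRel K)).map σ.symm) ⊗ₜ[K] a := by
        intro x σ
        rw [permAct_tmul]
        congr 1
        refine (LinearEquiv.congr_fun (PiTensorProduct.reindex_trans (R := K) (s := fun _ => A)
          σ.symm σ) a).trans ?_
        rw [Equiv.symm_trans_self]
        exact LinearEquiv.congr_fun (PiTensorProduct.reindex_refl (R := K) (s := fun _ => A)) a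
      have h2 : φ ⊗ₜ[K] a = ∑ x, ∑ σ, c x σ • permAct A (quadDual (twoAsRel K)) σ (w x σ) := by
        simp only [hw, TensorProduct.smul_tmul', ← TensorProduct.sum_tmul]
        rw [← hφ]
      have h3 : φ ⊗ₜ[K] a - ∑ x, TensorProduct.mk K _ _ (f' x)
          (koszulProj A (twoAsRel K) x (n + 2) (φ ⊗ₜ a)) = ∑ x, ∑ σ, c x σ •
            (permAct A (quadDual (twoAsRel K)) σ (w x σ) -
              ((Equiv.Perm.sign σ : ℤ) : K) • w x σ) := by
        simp only [h1, smul_sub, Finset.sum_sub_distrib]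
        rw [h2]
      change φ ⊗ₜ[K] a - ∑ x, TensorProduct.mk K _ _ (f' x)
        (koszulProj A (twoAsRel K) x (n + 2) (φ ⊗ₜ a)) ∈ _
      rw [h3]
      refine Submodule.sum_mem _ fun x _ => Submodule.sum_mem _ fun σ _ =>
        Submodule.smul_mem _ _ ?_
      -- The required difference is a generator of the relations multiplied by `-sgn σ`, as the
      -- square of the sign is one.
      have h4 := Submodule.smul_mem _ (-((Equiv.Perm.sign σ : ℤ) : K)) (Submodule.subset_span
        ⟨σ, w x σ, rfl⟩ : _ ∈ coinvRel A (quadDual (twoAsRel K)) (n + 2))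
      rwa [smul_sub, smul_smul, neg_mul, ← Int.cast_mul, ← Units.val_mul, Int.units_mul_self,
        Units.val_one, Int.cast_one, neg_smul, neg_smul, one_smul, sub_neg_eq_add,
        neg_add_eq_sub] at h4

end Projection

end Operadic

namespace Operadic

/-! ## Comparison of the Koszul complex with the Hochschild complexes -/

section Comparison

variable {K : Type u} [Field K] {A : Type v} [AddCommGroup A] [Module K A]

/-- Multiplying the first two entries and permuting by `τ` places the product in position `τ.symm
0`. The same results from permuting by `permDouble τ`, which makes the two entries adjacent there,
and then multiplying. -/
theorem mulAtFun_zero_comp {n : ℕ} (μ : A →ₗ[K] A →ₗ[K] A) (c : Fin (n + 2) → A)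
    (τ : Equiv.Perm (Fin (n + 1))) :
    (fun k => mulAtFun μ 0 c (τ k)) = mulAtFun μ (τ.symm 0) fun k => c (permDouble τ k) := by
  funext k
  rcases lt_trichotomy k (τ.symm 0) with h | h | h
  · have hne : τ k ≠ 0 := fun e => h.ne (τ.eq_symm_apply.2 e)
    have := permDouble_succAbove τ k
    rw [Fin.succAbove_castSucc_of_lt _ _ h] at this
    rw [mulAtFun, mulAtFun, if_neg (Fin.not_lt_zero _), if_neg hne, if_pos h, this]
  · subst h
    have := permDouble_succAbove τ (τ.symm 0)
    rw [Fin.succAbove_castSucc_self] at this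
    rw [mulAtFun, mulAtFun, if_neg (Fin.not_lt_zero _), if_neg (lt_irrefl _), if_pos rfl,
      if_pos (τ.apply_symm_apply 0), permDouble_castSucc, this, τ.apply_symm_apply]
    rfl
  · have hne : τ k ≠ 0 := fun e => h.ne' (τ.eq_symm_apply.2 e)
    have := permDouble_succAbove τ k
    rw [Fin.succAbove_castSucc_of_le _ _ h.le] at this
    rw [mulAtFun, mulAtFun, if_neg (Fin.not_lt_zero _), if_neg hne, if_neg h.not_gt, if_neg h.ne',
      this]

theorem mulAt_tprod {n : ℕ} (μ : A →ₗ[K] A →ₗ[K] A) (k : Fin n) (a : Fin (n + 1) → A) :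
    mulAt μ k (PiTensorProduct.tprod K a) = PiTensorProduct.tprod K (mulAtFun μ k a) :=
  PiTensorProduct.lift.tprod a

theorem koszulProj_tmul_tprod {X : Type} (R : Submodule K (Free K X (Fin 3))) (x : X) {n : ℕ}
    (φ : Module.Dual K ((quadDual R).obj (Fin n))) (a : Fin n → A) :
    koszulProj A R x n (φ ⊗ₜ PiTensorProduct.tprod K a) =
      ∑ σ : Equiv.Perm (Fin n), ((Equiv.Perm.sign σ : ℤ) : K) •
        φ ((quadDual R).map σ (powElem (quadDualRel R) x n)) •
          PiTensorProduct.tprod K fun i => a (σ i) := by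
  rw [koszulProj_tmul]
  refine Finset.sum_congr rfl fun σ _ => ?_
  rw [PiTensorProduct.reindex_tprod]
  rfl

/-- Only the summand `x = y` survives, since a generator for another operation makes the iterated
product vanish. -/
theorem koszulProj_koszulFront (op : TwoOp → A →ₗ[K] A →ₗ[K] A) (y : TwoOp) (n : ℕ)
    (φ : Module.Dual K ((quadDual (twoAsRel K)).obj (Fin (n + 3)))) (a : Fin (n + 3) → A) :
    koszulProj A (twoAsRel K) y (n + 2)
        (koszulFront (twoAsRel K) op (n + 1) (φ ⊗ₜ PiTensorProduct.tprod K a)) =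
      ∑ τ : Equiv.Perm (Fin (n + 2)), ((Equiv.Perm.sign τ : ℤ) : K) •
        φ ((quadDual (twoAsRel K)).map (permDouble τ)
          (powElem (quadDualRel (twoAsRel K)) y (n + 3))) •
            PiTensorProduct.tprod K (mulAtFun (op y) (τ.symm 0) fun k => a (permDouble τ k)) := by
  let ψ (x : TwoOp) : Module.Dual K ((quadDual (twoAsRel K)).obj (Fin (n + 2))) :=
    φ ∘ₗ insertFront (quadDualRel (twoAsRel K)) x (n + 1)
  have h : koszulFront (twoAsRel K) op (n + 1) (φ ⊗ₜ PiTensorProduct.tprod K a) =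
      ∑ x, ψ x ⊗ₜ[K] PiTensorProduct.tprod K (mulAtFun (op x) 0 a) := by
    rw [koszulFront, LinearMap.sum_apply]
    exact Finset.sum_congr rfl fun x _ => congrArg (ψ x ⊗ₜ[K] ·) (mulAt_tprod (op x) 0 a)
  have h' : ∀ x τ, ψ x ((quadDual (twoAsRel K)).map τ
      (powElem (quadDualRel (twoAsRel K)) y (n + 2))) =
      φ (if y = x then (quadDual (twoAsRel K)).map (permDouble τ)
        (powElem (quadDualRel (twoAsRel K)) y (n + 3)) else 0) := fun x τ =>
    congrArg φ (insertFront_powElem quadDualRel_twoAsRel x y τ)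
  rw [h, map_sum, Finset.sum_eq_single y]
  · rw [koszulProj_tmul_tprod]
    simp only [h', if_true, mulAtFun_zero_comp]
  · intro x _ hx
    rw [koszulProj_tmul_tprod]
    refine Finset.sum_eq_zero fun τ _ => ?_
    rw [h', if_neg hx.symm, map_zero, zero_smul, smul_zero]
  · exact fun h => absurd (Finset.mem_univ _) h

/-- The projections anticommute with the differentials. -/
theorem koszulProj_koszulDiff (op : TwoOp → A →ₗ[K] A →ₗ[K] A) (y : TwoOp) (n : ℕ)
    (m : KoszulPre A (quadDual (twoAsRel K)) (n + 3)) :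
    koszulProj A (twoAsRel K) y (n + 2) (koszulDiff (twoAsRel K) op (n + 2) m) =
      -hochDiff (op y) (n + 2) (koszulProj A (twoAsRel K) y (n + 3) m) := by
  induction m using TensorProduct.induction_on with
  | zero => simp
  | add m m' h h' => rw [map_add, map_add, h, h', map_add, map_add, neg_add]
  | tmul φ a =>
    induction a using PiTensorProduct.induction_on with
    | add a b h h' => rw [TensorProduct.tmul_add, map_add, map_add, h, h', map_add, map_add, neg_add]
    | smul_tprod r a =>
      rw [TensorProduct.tmul_smul, map_smul, map_smul, map_smul, map_smul, ← smul_neg]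
      congr 1
      have hD : koszulDiff (twoAsRel K) op (n + 2) (φ ⊗ₜ PiTensorProduct.tprod K a) =
          ∑ ρ ∈ pairShuffles (n + 1), ((Equiv.Perm.sign ρ : ℤ) : K) •
            koszulFront (twoAsRel K) op (n + 1) ((φ ∘ₗ (quadDual (twoAsRel K)).map ρ) ⊗ₜ[K]
              PiTensorProduct.tprod K fun i => a (ρ i)) := by
        rw [koszulDiff, LinearMap.sum_apply]
        refine Finset.sum_congr rfl fun ρ _ => ?_
        rw [LinearMap.smul_apply, LinearMap.comp_apply, permAct_tmul, PiTensorProduct.reindex_tprod]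
        rfl
      let F (π : Equiv.Perm (Fin (n + 3))) (j : Fin (n + 2)) : ⨂[K] _ : Fin (n + 2), A :=
        φ ((quadDual (twoAsRel K)).map π (powElem (quadDualRel (twoAsRel K)) y (n + 3))) •
          PiTensorProduct.tprod K (mulAtFun (op y) j fun i => a (π i))
      have hF : ∀ ρ : Equiv.Perm (Fin (n + 3)), koszulProj A (twoAsRel K) y (n + 2)
          (koszulFront (twoAsRel K) op (n + 1) ((φ ∘ₗ (quadDual (twoAsRel K)).map ρ) ⊗ₜ[K]
              PiTensorProduct.tprod K fun i => a (ρ i))) =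
          ∑ τ : Equiv.Perm (Fin (n + 2)), ((Equiv.Perm.sign τ : ℤ) : K) •
            F (ρ * permDouble τ) (τ.symm 0) := by
        intro ρ
        rw [koszulProj_koszulFront]
        refine Finset.sum_congr rfl fun τ _ => ?_
        congr 2
        exact congrArg φ ((quadDual (twoAsRel K)).map_trans (permDouble τ) ρ _).symm
      rw [hD, map_sum, Finset.sum_congr rfl fun ρ _ => (map_smul _ _ _).trans
        (congrArg _ (hF ρ)), sum_pairShuffles, koszulProj_tmul_tprod, map_sum,
        ← Finset.sum_neg_distrib]
      refine Finset.sum_congr rfl fun π _ => ?_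
      rw [map_smul, map_smul, ← smul_neg]
      congr 1
      -- The shuffles give `(-1)^j`, while `b'` counts positions from one and has `(-1)^(j + 1)`;
      -- hence the global minus sign.
      rw [hochDiff, LinearMap.sum_apply, Finset.smul_sum, ← Finset.sum_neg_distrib]
      refine Finset.sum_congr rfl fun j _ => ?_
      rw [LinearMap.smul_apply, mulAt_tprod, smul_comm, pow_succ, mul_neg_one, neg_smul, smul_neg,
        neg_neg]

/-- By the section, an element with vanishing projections is itself a coinvariance relation. So in
arity at least two the coinvariants are exactly two copies of the tensor power. -/
theorem mem_coinvRel_iff {n : ℕ} {m : KoszulPre A (quadDual (twoAsRel K)) (n + 2)} :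
    m ∈ coinvRel A (quadDual (twoAsRel K)) (n + 2) ↔
      ∀ x, koszulProj A (twoAsRel K) x (n + 2) m = 0 := by
  refine ⟨fun h x => coinvRel_le_ker_koszulProj (twoAsRel K) x h, fun h => ?_⟩
  obtain ⟨s, -, hs⟩ := exists_section K A n
  have := hs m
  simpa only [h, map_zero, Finset.sum_const_zero, sub_zero] using this

theorem exists_koszulProj_eq (n : ℕ) (a : TwoOp → ⨂[K] _ : Fin (n + 2), A) :
    ∃ m, ∀ x, koszulProj A (twoAsRel K) x (n + 2) m = a x := by
  classical
  obtain ⟨s, hs, -⟩ := exists_section K A n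
  refine ⟨∑ y, s y (a y), fun x => ?_⟩
  rw [map_sum, Finset.sum_congr rfl fun y _ => hs y x (a y), Finset.sum_ite_eq,
    if_pos (Finset.mem_univ _)]

/-- The degree is at least three because the differential must land in degree at least two, where
the projections detect the coinvariants. -/
theorem mem_koszulCycles_iff (op : TwoOp → A →ₗ[K] A →ₗ[K] A) {n : ℕ}
    {m : KoszulPre A (quadDual (twoAsRel K)) (n + 3)} :
    m ∈ koszulCycles (twoAsRel K) op (n + 3) ↔
      ∀ x, koszulProj A (twoAsRel K) x (n + 3) m ∈ hochCycles (op x) (n + 3) := by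
  refine (mem_coinvRel_iff (n := n)).trans (forall_congr' fun x => ?_)
  rw [koszulProj_koszulDiff, neg_eq_zero]
  rfl

/-- For the converse, primitives for the two operations are lifted to one element `w`. Since the
projections anticommute with the differentials, it is the sum of the given element and the
differential of `w` that becomes a coinvariance relation. -/
theorem mem_koszulBoundaries_iff (op : TwoOp → A →ₗ[K] A →ₗ[K] A) {n : ℕ}
    {m : KoszulPre A (quadDual (twoAsRel K)) (n + 2)} :
    m ∈ koszulBoundaries (twoAsRel K) op (n + 2) ↔
      ∀ x, koszulProj A (twoAsRel K) x (n + 2) m ∈ LinearMap.range (hochDiff (op x) (n + 2)) := by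
  constructor
  · intro hm x
    obtain ⟨r, hr, _, ⟨w, rfl⟩, rfl⟩ := Submodule.mem_sup.1 hm
    rw [map_add, mem_coinvRel_iff.1 hr, zero_add, koszulProj_koszulDiff]
    exact ⟨-_, map_neg _ _⟩
  · intro hm
    choose a ha using hm
    obtain ⟨w, hw⟩ := exists_koszulProj_eq (K := K) (A := A) (n + 1) a
    refine Submodule.mem_sup.2 ⟨m + koszulDiff (twoAsRel K) op (n + 2) w, ?_, _, ⟨-w, rfl⟩, ?_⟩
    · refine mem_coinvRel_iff.2 fun x => ?_
      rw [map_add, koszulProj_koszulDiff, hw, ha, add_neg_cancel]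
    · rw [map_neg, add_neg_cancel_right]

/-- The two projections, restricted to cycles, are jointly onto and have exactly the boundaries as
joint kernel, so the isomorphism is the induced map on the quotient. -/
theorem exists_koszulHomology_equiv (op : TwoOp → A →ₗ[K] A →ₗ[K] A) (n : ℕ) :
    ∃ e : KoszulHomology (twoAsRel K) op (n + 3) ≃ₗ[K]
        HochHomology (op .star) (n + 3) × HochHomology (op .dot) (n + 3),
      ∀ z : koszulCycles (twoAsRel K) op (n + 3),
        ∃ (h₁ : koszulProj A (twoAsRel K) .star (n + 3) z.1 ∈ hochCycles (op .star) (n + 3))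
          (h₂ : koszulProj A (twoAsRel K) .dot (n + 3) z.1 ∈ hochCycles (op .dot) (n + 3)),
          e (Submodule.Quotient.mk z) =
            (Submodule.Quotient.mk ⟨_, h₁⟩, Submodule.Quotient.mk ⟨_, h₂⟩) := by
  have hz : ∀ x, ∀ z ∈ koszulCycles (twoAsRel K) op (n + 3),
      koszulProj A (twoAsRel K) x (n + 3) z ∈ hochCycles (op x) (n + 3) := fun x z hz =>
    (mem_koszulCycles_iff op).1 hz x
  let g (x : TwoOp) : koszulCycles (twoAsRel K) op (n + 3) →ₗ[K] HochHomology (op x) (n + 3) :=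
    Submodule.mkQ _ ∘ₗ (koszulProj A (twoAsRel K) x (n + 3)).restrict (hz x)
  let f := (g .star).prod (g .dot)
  have hker : (koszulBoundaries (twoAsRel K) op (n + 3)).submoduleOf
      (koszulCycles (twoAsRel K) op (n + 3)) = LinearMap.ker f := by
    ext z
    have hg : ∀ x, g x z = 0 ↔
        koszulProj A (twoAsRel K) x (n + 3) z.1 ∈ LinearMap.range (hochDiff (op x) (n + 3)) :=
      fun x => Submodule.Quotient.mk_eq_zero _
    rw [LinearMap.mem_ker]
    refine (mem_koszulBoundaries_iff op (n := n + 1)).trans ⟨fun h => ?_, fun h x => ?_⟩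
    · exact Prod.ext ((hg _).2 (h _)) ((hg _).2 (h _))
    · rcases x with _ | _
      · exact (hg _).1 (congrArg Prod.fst h)
      · exact (hg _).1 (congrArg Prod.snd h)
  have hsurj : Function.Surjective f := by
    rintro ⟨a, b⟩
    obtain ⟨a, rfl⟩ := Submodule.Quotient.mk_surjective _ a
    obtain ⟨b, rfl⟩ := Submodule.Quotient.mk_surjective _ b
    obtain ⟨m, hm⟩ := exists_koszulProj_eq (K := K) (A := A) (n + 1)
      (fun x => match x with | .star => a.1 | .dot => b.1)
    refine ⟨⟨m, (mem_koszulCycles_iff op).2 fun x => ?_⟩, Prod.ext ?_ ?_⟩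
    · rw [hm]
      rcases x with _ | _
      exacts [a.2, b.2]
    · exact congrArg Submodule.Quotient.mk (Subtype.ext (hm .star))
    · exact congrArg Submodule.Quotient.mk (Subtype.ext (hm .dot))
  refine ⟨(Submodule.quotEquivOfEq _ _ hker).trans (f.quotKerEquivOfSurjective hsurj), fun z => ?_⟩
  exact ⟨hz _ _ z.2, hz _ _ z.2, rfl⟩

end Comparison

end Operadic

theorem mainTheorem9 (K : Type u) [Field K] :
    (twoAs K).IsKoszul ∧
    quadDualRel (twoAsRel K) = twoAsZeroRel K ∧
    ∀ (A : Type v) [AddCommGroup A] [Module K A] (op : TwoOp → A →ₗ[K] A →ₗ[K] A),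
      (∀ x a b c, op x (op x a b) c = op x a (op x b c)) →
      ∀ n : ℕ, 3 ≤ n →
        ∃ e : KoszulHomology (twoAsRel K) op n ≃ₗ[K]
            HochHomology (op .star) n × HochHomology (op .dot) n,
          ∀ z : koszulCycles (twoAsRel K) op n,
            ∃ (h₁ : koszulProj A (twoAsRel K) .star n z.1 ∈ hochCycles (op .star) n)
              (h₂ : koszulProj A (twoAsRel K) .dot n z.1 ∈ hochCycles (op .dot) n),
              e (Submodule.Quotient.mk z) =
                (Submodule.Quotient.mk ⟨_, h₁⟩, Submodule.Quotient.mk ⟨_, h₂⟩) := by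
  refine ⟨isKoszul_twoAs, quadDualRel_twoAsRel, fun A _ _ op _ n hn => ?_⟩
  obtain ⟨n, rfl⟩ := Nat.exists_eq_add_of_le' hn
  exact exists_koszulHomology_equiv op n
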